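/- Let $p$ be an odd prime, $m=2s\ge 4$, and let $l$ be an integer with $1\le l\le m-1$, $l\ne s$. Put $d=\gcd(s,l)$ and $d'=\gcd(s+l,2l)$. Let $\alpha$ be a primitive element of $\mathbb F_{p^m}$, and let $\mathbb C$ be the cyclic code over $\mathbb F_p$ of length $p^m-1$ with parity-check polynomial $h_1h_{p^s+1}h_{p^l+1}$, where $h_1,h_{p^s+1},h_{p^l+1}$ are the minimal polynomials over $\mathbb F_p$ of $\alpha,\alpha^{p^s+1},\alpha^{p^l+1}$. Write $\mathcal C^\perp$ for the dual of a code $\mathcal C$ and $\overline{\mathcal C}$ for its extension by one coordinate that makes the sum of all coordinates zero, and let $\mathcal K=\overline{\mathbb C^\perp}^{\perp}$, a code of length $p^m$. When coordinate $j$ is labelled by $x=\alpha^{-j}$ for $0\le j<p^m-1$, and the last coordinate by $x=0$, $$\mathcal K=\{(Tr_s(ax^{p^s+1})+Tr_m(bx^{p^l+1}+cx)+h)_{x\in\mathbb F_{p^m}} : a\in\mathbb F_{p^s},\ b,c\in\mathbb F_{p^m},\ h\in\mathbb F_p\},$$ where $Tr_r(x)=x+x^p+\dots+x^{p^{r-1}}$.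 Then for each pair $(i,\lambda)$ listed below, $i$ and $\lambda$ are natural numbers, $\mathcal K$ has codewords of Hamming weight $i$, and the set of the supports of all codewords of weight $i$ in $\mathcal K$ is the block set of a simple $2$-$(p^m,i,\lambda)$ design (every two points lie in exactly $\lambda$ blocks). The pairs are written as $(i,\ \mu\,(i-1))$, that is, $\lambda=\mu(i-1)$. (1) If $d'=d$ is odd: * $i=(p-1)(p^{m-1}-p^{s-1})$, $\mu=\frac{p^{s+d-1}(p^m-1)}{2(p^d+1)}$; * $i=p^{m-1}(p-1)+p^{s-1}$, $\mu=\frac{p^{s+d-1}[p^s(p-1)+1](p^s+1)}{2(p^d+1)}$; * $i=(p-1)(p^{m-1}+p^{s-1})$, $\mu=\frac{p^{s+d-1}(p^m-2p^{m-d}+1)}{2(p^d-1)}$; * $i=p^{m-1}(p-1)-p^{s-1}$, $\mu=\frac{p^{s+d-1}[p^s(p-1)-1](p^m-2p^{m-d}+1)}{2(p^d-1)(p^s+1)}$; * for each sign $\varepsilon=\pm1$: $i=p^{m-1}(p-1)+\varepsilon p^{s+\frac{d-1}2}$, $\mu=\mu_\varepsilon:=\frac12p^{m-\frac{3d+1}2}[p^{s-\frac{d-1}2-1}(p-1)+\varepsilon]$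 (if $d=1$, only $\varepsilon=+1$); * $i=p^{s+d-1}(p-1)(p^{s-d}+1)$, $\mu=\frac{p^{s-d-1}(p^{s-d}+1)(p^{s-d}-1)}{p^{2d}-1}$; * $i=p^{m-1}(p-1)-p^{s+d-1}$, $\mu=\mu':=\frac{p^{s-d-1}[p^{s-d}(p-1)-1](p^{s-d}-1)}{p^{2d}-1}$ if $d\ge3$; if $d=1$, this weight is also $p^{m-1}(p-1)-p^{s+\frac{d-1}2}$, and $\mu=\mu'+\mu_{-1}$; * $i=p^{m-1}(p-1)$, $\lambda=(p^m-p^{m-1}-1)(p^{3s-d}-p^{3s-2d}+p^{3s-2d-1}+p^{3s-3d}-p^{m-2d}+1)$. (2) If $d'=d$ is even: * $i=p^{s-1}(p-1)(p^s-1)$, $\mu=\frac{p^{s+d-1}(p^m-1)}{2(p^d+1)}$; * $i=p^{s-1}(p^{s+1}-p^s+1)$, $\mu=\frac{p^{s+d-1}(p^{s+1}-p^s+1)(p^s+1)}{2(p^d+1)}$; * $i=p^{s-1}(p-1)(p^s+1)$, $\mu=\frac{p^{s+d-1}(p^m-2p^{m-d}+1)}{2(p^d-1)}$; * $i=p^{s-1}(p^{s+1}-p^s-1)$,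 $\mu=\frac{p^{s+d-1}(p^{s+1}-p^s-1)(p^m-2p^{m-d}+1)}{2(p^d-1)(p^s+1)}$; * for each sign $\varepsilon=\pm1$: $i=p^{s+\frac d2-1}(p-1)(p^{s-\frac d2}+\varepsilon)$, $\mu=\frac12p^{m-\frac{3d}2-1}(p^{s-\frac d2}+\varepsilon)$; * for each sign $\varepsilon=\pm1$: $i=p^{s+\frac d2-1}(p^{s-\frac d2+1}-p^{s-\frac d2}+\varepsilon)$, $\mu=\frac12p^{m-\frac{3d}2-1}(p^{s-\frac d2+1}-p^{s-\frac d2}+\varepsilon)$; * $i=p^{s+d-1}(p-1)(p^{s-d}+1)$, $\mu=\frac{p^{s-d-1}(p^{m-2d}-1)}{p^{2d}-1}$; * $i=p^{s+d-1}(p^{s-d+1}-p^{s-d}-1)$, $\mu=\frac{p^{s-d-1}(p^{s-d+1}-p^{s-d}-1)(p^{s-d}-1)}{p^{2d}-1}$; * $i=p^{m-1}(p-1)$, $\lambda=(p^m-p^{m-1}-1)(p^{3s-d}-p^{3s-2d}+p^{3s-3d}-p^{m-2d}+1)$. (3) If $d'=2d$, with $Z=p^m-p^{m-2d}-p^{m-3d}+p^s-p^{s-d}+1$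 and $Y=p^s+p^{s-d}+p^{s-2d}+1$: * $i=p^{s-1}(p-1)(p^s+1)$, $\mu=\frac{p^{s+3d-1}Z}{(p^d+1)(p^{2d}-1)}$; * $i=p^{s-1}(p^{s+1}-p^s-1)$, $\mu=\frac{p^{s+3d-1}(p^{s+1}-p^s-1)Z}{(p^d+1)(p^{2d}-1)(p^s+1)}$; * $i=p^{s+d-1}(p-1)(p^{s-d}-1)$, $\mu=\frac{p^{s-1}(p^{s-d}-1)Y}{(p^d+1)^2}$; * $i=p^{s+d-1}(p^{s-d+1}-p^{s-d}+1)$, $\mu=\frac{p^{s-1}(p^{s-d+1}-p^{s-d}+1)Y}{(p^d+1)^2}$; * $i=p^{s+2d-1}(p-1)(p^{s-2d}+1)$, $\mu=\frac{p^{s-2d-1}(p^{s-d}-1)(p^{s-2d}+1)}{(p^d+1)(p^{2d}-1)}$; * $i=p^{s+2d-1}(p^{s-2d+1}-p^{s-2d}-1)$, $\mu=\frac{p^{s-2d-1}(p^{s-2d+1}-p^{s-2d}-1)(p^{s-d}-1)}{(p^d+1)(p^{2d}-1)}$; * $i=p^{m-1}(p-1)$, $\lambda=(p^m-p^{m-1}-1)(p^{3s-d}-p^{3s-2d}+p^{3s-3d}-p^{3s-4d}+p^{3s-5d}+p^{m-d}-2p^{m-2d}+p^{m-3d}-p^{m-4d}+1)$.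 -/

import Mathlib

open Polynomial

/-! ### Linear codes over a field `F`, as subspaces of `F ^ n` -/

section Codes

variable {F : Type*} [Field F]

/-- The cyclic code of length `n` with generator polynomial `g` (a divisor of `X ^ n - 1`): the words
`(c_0, …, c_{n-1})` for which `g` divides `c_0 + c_1 X + ⋯ + c_{n-1} X ^ (n-1)`. -/
def cyclicCode (n : ℕ) (g : F[X]) : Submodule F (Fin n → F) where
  carrier := {c | g ∣ ∑ i : Fin n, C (c i) * X ^ (i : ℕ)}
  zero_mem' := by simp
  add_mem' := by
    intro a b ha hb
    have h := dvd_add ha hb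
    rw [← Finset.sum_add_distrib] at h
    simpa [add_mul] using h
  smul_mem' := by
    intro r a ha
    have h := Dvd.dvd.mul_left ha (C r)
    rw [Finset.mul_sum] at h
    simpa [mul_assoc] using h

/-- The cyclic code of length `n` with parity-check polynomial `h` (a monic divisor of `X ^ n - 1`),
that is, the one with generator polynomial `(X ^ n - 1) / h`. -/
noncomputable def cyclicCodeOfParityCheck (n : ℕ) (h : F[X]) : Submodule F (Fin n → F) :=
  cyclicCode n ((X ^ n - 1) /ₘ h)

/-- The dual code. -/
def dualCode {n : ℕ} (D : Submodule F (Fin n → F)) : Submodule F (Fin n → F) where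
  carrier := {c | ∀ u ∈ D, ∑ i, c i * u i = 0}
  zero_mem' := by simp
  add_mem' := by
    intro a b ha hb u hu
    simp [add_mul, Finset.sum_add_distrib, ha u hu, hb u hu]
  smul_mem' := by
    intro r a ha u hu
    simp [mul_assoc, ← Finset.mul_sum, ha u hu]

/-- The extended code: append a coordinate that makes the sum of all coordinates zero. -/
def extendedCode {n : ℕ} (D : Submodule F (Fin n → F)) : Submodule F (Fin (n + 1) → F) where
  carrier := {c | (fun i : Fin n => c i.castSucc) ∈ D ∧ ∑ i, c i = 0}
  zero_mem' := ⟨D.zero_mem, by simp⟩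
  add_mem' := by
    rintro a b ⟨ha, ha'⟩ ⟨hb, hb'⟩
    exact ⟨D.add_mem ha hb, by simp [Finset.sum_add_distrib, ha', hb']⟩
  smul_mem' := by
    rintro r a ⟨ha, ha'⟩
    exact ⟨D.smul_mem r ha, by simp [← Finset.mul_sum, ha']⟩

variable [DecidableEq F]

/-- The support of a word. -/
def wordSupport {n : ℕ} (c : Fin n → F) : Finset (Fin n) :=
  Finset.univ.filter fun i => c i ≠ 0

/-- The set of the supports of the codewords of Hamming weight `i`. -/
def supportBlocks {n : ℕ} (D : Submodule F (Fin n → F)) (i : ℕ) : Set (Finset (Fin n)) :=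
  {b | ∃ c ∈ D, hammingNorm c = i ∧ wordSupport c = b}

end Codes

/-! ### Designs -/

/-- `(P, B)` is a simple `t`-`(v, k, lam)` design. -/
structure IsDesign {P : Type*} [Fintype P] (t v k lam : ℕ) (B : Set (Finset P)) : Prop where
  one_le : 1 ≤ t
  t_le_k : t ≤ k
  k_le_v : k ≤ v
  card_points : Fintype.card P = v
  card_block : ∀ b ∈ B, b.card = k
  card_blocks_through : ∀ T : Finset P, T.card = t → {b | b ∈ B ∧ T ⊆ b}.ncard = lam

/-- The code `D` has codewords of weight `x.1`, and their supports form a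
`2`-`(v, x.1, x.2)` design. The pair is given by rational numbers, which are thus
claimed to be natural numbers. -/
def GivesTwoDesign {F : Type*} [Field F] [DecidableEq F] {n : ℕ}
    (D : Submodule F (Fin n → F)) (v : ℕ) (x : ℚ × ℚ) : Prop :=
  ∃ i lam : ℕ, (i : ℚ) = x.1 ∧ (lam : ℚ) = x.2 ∧
    (∃ c ∈ D, hammingNorm c = i) ∧ IsDesign 2 v i lam (supportBlocks D i)

/-! ### The Kasami code and the dual of its extended dual -/

section Kasami

variable (p : ℕ) [Fact p.Prime] {K : Type*} [Field K] [Algebra (ZMod p) K]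

/-- The non-binary Kasami cyclic code over `𝔽_p` of length `p ^ (2 s) - 1`, with parity-check
polynomial the product of the minimal polynomials of `α`, `α ^ (p ^ s + 1)`, `α ^ (p ^ l + 1)`,
where `α` is a primitive element of `K`, the field with `p ^ (2 s)` elements. -/
noncomputable def kasamiCyclicCode (s l : ℕ) (α : K) :
    Submodule (ZMod p) (Fin (p ^ (2 * s) - 1) → ZMod p) :=
  cyclicCodeOfParityCheck (p ^ (2 * s) - 1)
    (minpoly (ZMod p) α * minpoly (ZMod p) (α ^ (p ^ s + 1)) *
      minpoly (ZMod p) (α ^ (p ^ l + 1)))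

/-- The dual of the extended code of the dual of the Kasami code, of length `p ^ (2 s)`. -/
noncomputable def kasamiDualExtDual (s l : ℕ) (α : K) :
    Submodule (ZMod p) (Fin (p ^ (2 * s) - 1 + 1) → ZMod p) :=
  dualCode (extendedCode (dualCode (kasamiCyclicCode p s l α)))

/-- The trace `x + x ^ p + ⋯ + x ^ (p ^ (r - 1))`. -/
def absTrace (r : ℕ) (x : K) : K := ∑ i ∈ Finset.range r, x ^ p ^ i

/-- The words `(Tr_s (a x ^ (p ^ s + 1)) + Tr_m (b x ^ (p ^ l + 1) + c x) + h)` with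
`a ∈ 𝔽_{p ^ s}`, `b, c ∈ K`, `h ∈ 𝔽_p`, where `m = 2 s`, and where the coordinates are labelled by
the elements `x j` of `K`. -/
def traceWords (s l : ℕ) {n : ℕ} (x : Fin n → K) : Set (Fin n → ZMod p) :=
  {w | ∃ (a b c : K) (h : ZMod p), a ^ p ^ s = a ∧ ∀ j,
    algebraMap (ZMod p) K (w j) =
      absTrace p s (a * x j ^ (p ^ s + 1)) +
        absTrace p (2 * s) (b * x j ^ (p ^ l + 1) + c * x j) + algebraMap (ZMod p) K h}

end Kasami

/-- The labelling of the coordinates by the elements of `K`: coordinate `j < n` by `α ^ (-j)`,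
and the last coordinate, which the extension has added, by `0`. -/
def coordLabel {K : Type*} [Field K] {n : ℕ} (α : K) : Fin (n + 1) → K :=
  Fin.snoc (α := fun _ => K) (fun j : Fin n => (α ^ (j : ℕ))⁻¹) 0

/-! ### The parameters `(i, λ)` of the designs

Here `m = 2 s`. In the range in which each list is used no subtraction of natural numbers in an
exponent is truncated and every division of natural numbers in an exponent is exact: `2 d ≤ s` in
the first two cases, and `3 d ≤ s` in the third. -/

section Parameters

/-- Weight of the family with sign `ε` in the case `d' = d` odd. -/
def oddWeightSign (p : ℚ) (m s d : ℕ) (ε : ℚ) : ℚ :=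
  p ^ (m - 1) * (p - 1) + ε * p ^ (s + (d - 1) / 2)

/-- The contribution to `λ` of the family with sign `ε` in the case `d' = d` odd. -/
def oddLamSign (p : ℚ) (m s d : ℕ) (ε : ℚ) : ℚ :=
  1 / 2 * p ^ (m - (3 * d + 1) / 2) * (p ^ (s - (d - 1) / 2 - 1) * (p - 1) + ε) *
    (p ^ (m - 1) * (p - 1) + ε * p ^ (s + (d - 1) / 2) - 1)

/-- Weight of the seventh family in the case `d' = d` odd. -/
def oddWeightSeven (p : ℚ) (m s d : ℕ) : ℚ :=
  p ^ (m - 1) * (p - 1) - p ^ (s + d - 1)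

/-- The contribution to `λ` of the seventh family in the case `d' = d` odd. -/
def oddLamSeven (p : ℚ) (m s d : ℕ) : ℚ :=
  p ^ (s - d - 1) * (p ^ (s - d) * (p - 1) - 1) *
    (p ^ m - p ^ (m - 1) - p ^ (s + d - 1) - 1) * (p ^ (s - d) - 1) / (p ^ (2 * d) - 1)

/-- The pairs in the case `d' = d` odd. If `d = 1`, the weight `oddWeightSign p m s d (-1)` is
equal to `oddWeightSeven p m s d`, so that there is one design for the two families, and its `λ` is
the sum of the two contributions. -/
def oddPairs (p : ℚ) (m s d : ℕ) : List (ℚ × ℚ) :=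
  [ ( (p - 1) * (p ^ (m - 1) - p ^ (s - 1)),
      1 / 2 * p ^ (s + d - 1) * ((p - 1) * (p ^ (m - 1) - p ^ (s - 1)) - 1) *
        (p ^ m - 1) / (p ^ d + 1) ),
    ( p ^ (m - 1) * (p - 1) + p ^ (s - 1),
      1 / 2 * p ^ (s + d - 1) * (p ^ s * (p - 1) + 1) *
        (p ^ m - p ^ (m - 1) + p ^ (s - 1) - 1) * (p ^ s + 1) / (p ^ d + 1) ),
    ( (p - 1) * (p ^ (m - 1) + p ^ (s - 1)),
      1 / 2 * p ^ (s + d - 1) * ((p - 1) * (p ^ (m - 1) + p ^ (s - 1)) - 1) *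
        (p ^ m - 2 * p ^ (m - d) + 1) / (p ^ d - 1) ),
    ( p ^ (m - 1) * (p - 1) - p ^ (s - 1),
      p ^ (s + d - 1) * (p ^ s * (p - 1) - 1) * (p ^ m - 2 * p ^ (m - d) + 1) *
        (p ^ m - p ^ (m - 1) - p ^ (s - 1) - 1) / (2 * (p ^ d - 1) * (p ^ s + 1)) ),
    ( oddWeightSign p m s d 1, oddLamSign p m s d 1 ) ] ++
  (if d = 1 then
    [ ( oddWeightSeven p m s d, oddLamSign p m s d (-1) + oddLamSeven p m s d ) ]
  else
    [ ( oddWeightSign p m s d (-1), oddLamSign p m s d (-1) ),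
      ( oddWeightSeven p m s d, oddLamSeven p m s d ) ]) ++
  [ ( p ^ (s + d - 1) * (p - 1) * (p ^ (s - d) + 1),
      p ^ (s - d - 1) * (p ^ (s + d - 1) * (p - 1) * (p ^ (s - d) + 1) - 1) *
        (p ^ (s - d) + 1) * (p ^ (s - d) - 1) / (p ^ (2 * d) - 1) ),
    ( p ^ (m - 1) * (p - 1),
      (p ^ m - p ^ (m - 1) - 1) *
        (p ^ (3 * s - d) - p ^ (3 * s - 2 * d) + p ^ (3 * s - 2 * d - 1) + p ^ (3 * s - 3 * d)
          - p ^ (m - 2 * d) + 1) ) ]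

/-- The two families with sign `ε` in the case `d' = d` even. -/
def evenPairsSign (p : ℚ) (m s d : ℕ) (ε : ℚ) : List (ℚ × ℚ) :=
  [ ( p ^ (s + d / 2 - 1) * (p - 1) * (p ^ (s - d / 2) + ε),
      1 / 2 * p ^ (m - 3 * d / 2 - 1) * (p ^ (s - d / 2) + ε) *
        (p ^ (s + d / 2 - 1) * (p - 1) * (p ^ (s - d / 2) + ε) - 1) ),
    ( p ^ (s + d / 2 - 1) * (p ^ (s - d / 2 + 1) - p ^ (s - d / 2) + ε),
      1 / 2 * p ^ (m - 3 * d / 2 - 1) * (p ^ (s - d / 2 + 1) - p ^ (s - d / 2) + ε) *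
        (p ^ (s + d / 2 - 1) * (p ^ (s - d / 2 + 1) - p ^ (s - d / 2) + ε) - 1) ) ]

/-- The pairs in the case `d' = d` even. -/
def evenPairs (p : ℚ) (m s d : ℕ) : List (ℚ × ℚ) :=
  [ ( p ^ (s - 1) * (p - 1) * (p ^ s - 1),
      1 / 2 * p ^ (s + d - 1) * (p ^ (s - 1) * (p - 1) * (p ^ s - 1) - 1) *
        (p ^ m - 1) / (p ^ d + 1) ),
    ( p ^ (s - 1) * (p ^ (s + 1) - p ^ s + 1),
      1 / 2 * p ^ (s + d - 1) * (p ^ (s + 1) - p ^ s + 1) *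
        (p ^ (s - 1) * (p ^ (s + 1) - p ^ s + 1) - 1) * (p ^ s + 1) / (p ^ d + 1) ),
    ( p ^ (s - 1) * (p - 1) * (p ^ s + 1),
      1 / 2 * p ^ (s + d - 1) * (p ^ (s - 1) * (p - 1) * (p ^ s + 1) - 1) *
        (p ^ m - 2 * p ^ (m - d) + 1) / (p ^ d - 1) ),
    ( p ^ (s - 1) * (p ^ (s + 1) - p ^ s - 1),
      1 / 2 * p ^ (s + d - 1) * (p ^ (s + 1) - p ^ s - 1) *
        (p ^ (s - 1) * (p ^ (s + 1) - p ^ s - 1) - 1) *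
        (p ^ m - 2 * p ^ (m - d) + 1) / ((p ^ d - 1) * (p ^ s + 1)) ) ] ++
  evenPairsSign p m s d 1 ++ evenPairsSign p m s d (-1) ++
  [ ( p ^ (s + d - 1) * (p - 1) * (p ^ (s - d) + 1),
      p ^ (s - d - 1) * (p ^ (s + d - 1) * (p - 1) * (p ^ (s - d) + 1) - 1) *
        (p ^ (m - 2 * d) - 1) / (p ^ (2 * d) - 1) ),
    ( p ^ (s + d - 1) * (p ^ (s - d + 1) - p ^ (s - d) - 1),
      p ^ (s - d - 1) * (p ^ (s - d + 1) - p ^ (s - d) - 1) * (p ^ (s - d) - 1) *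
        (p ^ (s + d - 1) * (p ^ (s - d + 1) - p ^ (s - d) - 1) - 1) / (p ^ (2 * d) - 1) ),
    ( p ^ (m - 1) * (p - 1),
      (p ^ m - p ^ (m - 1) - 1) *
        (p ^ (3 * s - d) - p ^ (3 * s - 2 * d) + p ^ (3 * s - 3 * d) - p ^ (m - 2 * d) + 1) ) ]

/-- The pairs in the case `d' = 2 d`. -/
def doublePairs (p : ℚ) (m s d : ℕ) : List (ℚ × ℚ) :=
  [ ( p ^ (s - 1) * (p - 1) * (p ^ s + 1),
      p ^ (s + 3 * d - 1) * (p ^ (s - 1) * (p - 1) * (p ^ s + 1) - 1) *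
        (p ^ m - p ^ (m - 2 * d) - p ^ (m - 3 * d) + p ^ s - p ^ (s - d) + 1) /
        ((p ^ d + 1) * (p ^ (2 * d) - 1)) ),
    ( p ^ (s - 1) * (p ^ (s + 1) - p ^ s - 1),
      p ^ (s + 3 * d - 1) * (p ^ (s + 1) - p ^ s - 1) *
        (p ^ (s - 1) * (p ^ (s + 1) - p ^ s - 1) - 1) *
        (p ^ m - p ^ (m - 2 * d) - p ^ (m - 3 * d) + p ^ s - p ^ (s - d) + 1) /
        ((p ^ d + 1) * (p ^ (2 * d) - 1) * (p ^ s + 1)) ),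
    ( p ^ (s + d - 1) * (p - 1) * (p ^ (s - d) - 1),
      p ^ (s - 1) * (p ^ (s - d) - 1) * (p ^ (s + d - 1) * (p - 1) * (p ^ (s - d) - 1) - 1) *
        (p ^ s + p ^ (s - d) + p ^ (s - 2 * d) + 1) / (p ^ d + 1) ^ 2 ),
    ( p ^ (s + d - 1) * (p ^ (s - d + 1) - p ^ (s - d) + 1),
      p ^ (s - 1) * (p ^ (s - d + 1) - p ^ (s - d) + 1) *
        (p ^ (s + d - 1) * (p ^ (s - d + 1) - p ^ (s - d) + 1) - 1) *
        (p ^ s + p ^ (s - d) + p ^ (s - 2 * d) + 1) / (p ^ d + 1) ^ 2 ),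
    ( p ^ (s + 2 * d - 1) * (p - 1) * (p ^ (s - 2 * d) + 1),
      p ^ (s - 2 * d - 1) * (p ^ (s - d) - 1) * (p ^ (s - 2 * d) + 1) *
        (p ^ (s + 2 * d - 1) * (p - 1) * (p ^ (s - 2 * d) + 1) - 1) /
        ((p ^ d + 1) * (p ^ (2 * d) - 1)) ),
    ( p ^ (s + 2 * d - 1) * (p ^ (s - 2 * d + 1) - p ^ (s - 2 * d) - 1),
      p ^ (s - 2 * d - 1) * (p ^ (s - 2 * d + 1) - p ^ (s - 2 * d) - 1) *
        (p ^ (s + 2 * d - 1) * (p ^ (s - 2 * d + 1) - p ^ (s - 2 * d) - 1) - 1) *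
        (p ^ (s - d) - 1) / ((p ^ d + 1) * (p ^ (2 * d) - 1)) ),
    ( p ^ (m - 1) * (p - 1),
      (p ^ m - p ^ (m - 1) - 1) *
        (p ^ (3 * s - d) - p ^ (3 * s - 2 * d) + p ^ (3 * s - 3 * d) - p ^ (3 * s - 4 * d)
          + p ^ (3 * s - 5 * d) + p ^ (m - d) - 2 * p ^ (m - 2 * d) + p ^ (m - 3 * d)
          - p ^ (m - 4 * d) + 1) ) ]

end Parameters

/-! ### Representation of a prime power by `p S ^ 2 + D ^ 2` -/

/-! Write P = p^s, D = p^d, and let q = p^d' be the order of the fixed field of `τ`. The words of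
the code are the functions B(x, x) + Tr(cx) + r on K, where B(x, y) = Tr(E(x) y) and E is a
self-adjoint operator depending on two coefficients a, b (`kasamiOp`).

Designs. The maps x ↦ ux + v preserve the code and are doubly transitive, so the number of words of
weight i that are nonzero at two given points does not depend on the points. No nonzero word is
light, and averaging the weight of f - tg over t ≠ 0 shows that two words of equal weight and
support are proportional. Hence each block comes from exactly p - 1 words, and λ v (v - 1)(p - 1) =
A_i i (i - 1), with A_i the number of words of weight i (`exists_isDesign`,
`KasamiSetting.givesTwoDesign`). What remains is the weight distribution.

From words to forms. If c lies in the range of E, a translation completes the square; otherwise the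
word takes all values equally often (`KasamiSetting.sum_zeroCount`). So only the level sizes of x ↦
B(x, x) matter. They depend on two integers S, T with p S² + T² equal to a power of p
(`exists_levelCard_eq`), and descent forces one of these to vanish. The order of ker E therefore
determines the level sizes up to a sign.

Kernels. A nonzero u in ker E can be moved to 1 by the substitution x ↦ ux. When E(1) = 0 the
operator factors through z = τκ(x) - κ(x), and the remaining equation τ(bz) = κ(b)z has a solution
set that is zero or a line over the fixed field of `τ`. Thus |ker E| is 1, q or q²
(`card_kasamiKer_eq_or`). Double counting pairs of a form and a nonzero kernel element gives
frequencies (`sum_card_kasamiKer_sub_one`).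

Case d' = d. The fixed field k of `τ` is fixed by `κ`; then E(1) = 0 forces κ(b) = b, and by Hilbert
90 the kernel has order q² exactly if Tr(1/b) = 0 over k. The form becomes -Tr(b N(z)) for the norm
N(z) = zκ(z) on the image of τ - 1, so counting norms gives the sign in corank two
(`levelCard_zero_of_corank_two`). In corank one, multiplying the form by a nonsquare of k reflects
its number of zeros about the mean, so for even d both signs are equally frequent. The two
nondegenerate frequencies follow from the number of forms and the sum of their zero counts.

Case d' = 2d. The (p^d + 1)-th roots of unity preserve every form, so p^d + 1 divides every level
size off zero; this fixes all signs (`KasamiSetting.formCount_of_hermitian`). The three frequencies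
follow from the number of forms, the sum of the orders of the kernels and the sum of the zero
counts.

The code. Trace words lie in the cyclic code, there are p^(5s) of them, and the parity-check
polynomial has degree at most 5s, so they exhaust it. Dualising, extending and dualising again adds
the constants. -/

theorem prime_mul_sq_add_sq_eq_pow {p : ℕ} (hp : p.Prime) (hp2 : p ≠ 2) (M : ℕ) :
    ∀ S D : ℤ, p * S ^ 2 + D ^ 2 = (p : ℤ) ^ M →
      (∃ j, M = 2 * j ∧ S = 0 ∧ D.natAbs = p ^ j) ∨
        (∃ j, M = 2 * j + 1 ∧ D = 0 ∧ S.natAbs = p ^ j) := by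
  induction M with
  | zero =>
    intro S D h
    have hp3 : (3 : ℤ) ≤ p := by
      have := hp.two_le
      exact_mod_cast (by omega : 3 ≤ p)
    have hS : S = 0 := by
      by_contra hS
      have : 0 < S ^ 2 := by positivity
      nlinarith [sq_nonneg D]
    subst hS
    refine Or.inl ⟨0, rfl, rfl, ?_⟩
    have h1 : D ^ 2 = 1 := by simpa using h
    rw [pow_zero, ← Int.isUnit_iff_natAbs_eq]
    exact IsUnit.of_mul_eq_one D (by rw [← sq]; exact h1)
  | succ M ih =>
    intro S D h
    -- Descent: p divides D, and after cancelling one factor p the equation holds for the pair (D/p,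
    -- S) with exponent M, so the two alternatives exchange roles.
    have hpD : (p : ℤ) ∣ D := by
      refine Int.Prime.dvd_pow' hp (k := 2) ?_
      have : D ^ 2 = p * ((p : ℤ) ^ M - S ^ 2) := by rw [pow_succ (p : ℤ)] at h; linarith
      exact ⟨_, this⟩
    obtain ⟨D', rfl⟩ := hpD
    have hp0 : (p : ℤ) ≠ 0 := by exact_mod_cast hp.ne_zero
    have h' : (p : ℤ) * D' ^ 2 + S ^ 2 = p ^ M := by
      apply mul_left_cancel₀ hp0
      rw [pow_succ (p : ℤ)] at h
      linarith
    rcases ih D' S h' with ⟨j, rfl, hD, hS⟩ | ⟨j, rfl, hS, hD⟩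
    · exact Or.inr ⟨j, rfl, by simp [hD], hS⟩
    · refine Or.inl ⟨j + 1, by ring, hS, ?_⟩
      rw [Int.natAbs_mul, hD, pow_succ, mul_comm]
      simp

/-! ### Level sets of linear and quadratic functions -/

/-- The number of solutions of `f x = t`. -/
def levelCard {V k : Type*} [Fintype V] [DecidableEq k] (f : V → k) (t : k) : ℕ :=
  (Finset.univ.filter fun x => f x = t).card

section Level

variable {V k : Type*} [Fintype V] [DecidableEq k]

theorem sum_levelCard [Fintype k] (f : V → k) : ∑ t, levelCard f t = Fintype.card V := by
  unfold levelCard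
  rw [← Finset.card_eq_sum_card_fiberwise (fun _ _ => Finset.mem_univ _)]
  rfl

theorem levelCard_comp_equiv {W : Type*} [Fintype W] (e : W ≃ V) (f : V → k) (t : k) :
    levelCard (fun w => f (e w)) t = levelCard f t := by
  unfold levelCard
  refine Finset.card_bij (fun w _ => e w) ?_ ?_ ?_
  · simp
  · intro a _ b _ h; exact e.injective h
  · intro b hb; exact ⟨e.symm b, by simpa using hb, by simp⟩

theorem levelCard_addHom [AddCommGroup V] [AddCommGroup k] (f : V →+ k) {v : V} :
    levelCard f (f v) = levelCard f 0 := by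
  unfold levelCard
  refine Finset.card_bij (fun w _ => w - v) ?_ ?_ ?_
  · simp [sub_eq_zero]
  · intro a _ b _ h; simpa using h
  · intro b hb; exact ⟨b + v, by simpa using hb, by simp⟩

theorem card_mul_levelCard_of_surjective [AddCommGroup V] [AddCommGroup k] [Fintype k]
    (f : V →+ k) (hf : Function.Surjective f) (t : k) :
    Fintype.card k * levelCard f t = Fintype.card V := by
  rw [← sum_levelCard f]
  have h : ∀ u, levelCard f u = levelCard f 0 := fun u => by
    obtain ⟨v, rfl⟩ := hf u
    exact levelCard_addHom f
  simp [h]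

theorem card_mul_levelCard_of_ne_zero [Field k] [Fintype k] [AddCommGroup V] [Module k V]
    (f : V →ₗ[k] k) (hf : f ≠ 0) (t : k) :
    Fintype.card k * levelCard f t = Fintype.card V :=
  card_mul_levelCard_of_surjective f.toAddMonoidHom (LinearMap.surjective hf) t

end Level

section Radical

variable {V k : Type*} [Field k] [AddCommGroup V] [Module k V] [Fintype V]

open Classical in
/-- The radical of a bilinear form, as a finite set. -/
noncomputable def radical (B : LinearMap.BilinForm k V) : Finset V :=
  Finset.univ.filter fun z => B z = 0

theorem mem_radical {B : LinearMap.BilinForm k V} {z : V} : z ∈ radical B ↔ B z = 0 := by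
  simp [radical]

end Radical

section Quadratic

variable {V k : Type*} [Field k] [Fintype k] [DecidableEq k] [AddCommGroup V] [Module k V]
  [Fintype V]

/-- Scaling the argument by u; hence the level sizes off zero depend only on the square class. -/
theorem levelCard_mul_sq (B : LinearMap.BilinForm k V) {u : k} (hu : u ≠ 0) (t : k) :
    levelCard (fun x => B x x) (t * u ^ 2) = levelCard (fun x => B x x) t := by
  unfold levelCard
  refine Finset.card_bij (fun w _ => u⁻¹ • w) ?_ ?_ ?_
  · intro a ha
    simp only [Finset.mem_filter, Finset.mem_univ, true_and] at ha ⊢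
    simp only [map_smul, LinearMap.smul_apply, smul_eq_mul, ha]
    field_simp
  · intro a _ b _ h
    exact smul_right_injective _ (inv_ne_zero hu) h
  · intro b hb
    refine ⟨u • b, ?_, by simp [smul_smul, hu]⟩
    simp only [Finset.mem_filter, Finset.mem_univ, true_and] at hb ⊢
    simp only [map_smul, LinearMap.smul_apply, smul_eq_mul, hb]
    ring

/-- The involution x ↦ -x has no fixed point on a level t ≠ 0. Evenness makes the half-sum and
half-difference of the two level sizes in `exists_levelCard_eq` integers. -/
theorem even_levelCard (hk : ringChar k ≠ 2) (B : LinearMap.BilinForm k V) {t : k} (ht : t ≠ 0) :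
    Even (levelCard (fun x => B x x) t) := by
  rw [← ZMod.natCast_eq_zero_iff_even]
  have : ∑ x ∈ Finset.univ.filter (fun x => B x x = t), (1 : ZMod 2) = 0 := by
    refine Finset.sum_involution (fun x _ => -x) (fun _ _ => by decide) ?_ ?_ ?_
    · intro x hx _ h
      simp only [Finset.mem_filter, Finset.mem_univ, true_and] at hx
      have h2 : (2 : k) • x = 0 := by
        rw [two_smul]; nth_rewrite 1 [← h]; simp
      have hx0 : x = 0 := by
        rcases smul_eq_zero.mp h2 with h | h
        · exact absurd h (Ring.two_ne_zero hk)
        · exact h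
      exact ht (by rw [← hx, hx0]; simp)
    · intro x hx; simpa using hx
    · intro x _; simp
  simpa [levelCard] using this

/-- The left side counts pairs with B(x, x) = B(y, y). With z = x - y the condition reads B(z, z) +
2B(z, y) = 0, which is affine in y: `V0` solutions if z is outside the radical, all y if it is
inside. This second moment replaces the modulus of a Gauss sum. -/
theorem sum_levelCard_sq (hk : ringChar k ≠ 2) (B : LinearMap.BilinForm k V)
    (hB : ∀ x y, B x y = B y x) {V0 : ℕ} (hV : Fintype.card V = Fintype.card k * V0) :
    ∑ t, levelCard (fun x => B x x) t ^ 2 =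
      V0 * Fintype.card V + (Fintype.card V - V0) * (radical B).card := by
  classical
  have hq : 0 < Fintype.card k := Fintype.card_pos
  have h1 : ∑ t, levelCard (fun x => B x x) t ^ 2 =
      ∑ y : V, levelCard (fun x => B x x) (B y y) := by
    have : ∀ t, levelCard (fun x => B x x) t ^ 2 =
        ∑ y ∈ Finset.univ.filter (fun y => B y y = t), levelCard (fun x => B x x) (B y y) := by
      intro t
      rw [Finset.sum_congr rfl (g := fun _ => levelCard (fun x => B x x) t)]
      · simp [levelCard, sq]
      · intro y hy
        rw [(Finset.mem_filter.mp hy).2]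
    rw [Finset.sum_congr rfl fun t _ => this t]
    exact Finset.sum_fiberwise _ _ _
  have h2 : ∀ y, levelCard (fun x => B x x) (B y y) =
      ∑ z : V, if B z z + 2 * B z y = 0 then 1 else 0 := by
    intro y
    unfold levelCard
    rw [← Finset.card_filter]
    refine Finset.card_bij (fun x _ => x - y) ?_ ?_ ?_
    · intro x hx
      simp only [Finset.mem_filter, Finset.mem_univ, true_and] at hx ⊢
      simp only [map_sub, LinearMap.sub_apply, hx, hB y x]
      ring
    · intro a _ b _ h; simpa using h
    · intro z hz
      refine ⟨z + y, ?_, by simp⟩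
      simp only [Finset.mem_filter, Finset.mem_univ, true_and] at hz ⊢
      simp only [map_add, LinearMap.add_apply, hB y z]
      linear_combination hz
  have h3 : ∀ z : V, (∑ y : V, if B z z + 2 * B z y = 0 then 1 else 0) =
      if z ∈ radical B then Fintype.card V else V0 := by
    intro z
    split_ifs with hz
    · rw [mem_radical] at hz
      simp [hz]
    · rw [mem_radical] at hz
      apply Nat.eq_of_mul_eq_mul_left hq
      rw [← hV, ← card_mul_levelCard_of_ne_zero (B z) hz (-(B z z) / 2), levelCard,
        Finset.card_filter]
      congr 1
      refine Finset.sum_congr rfl fun y _ => ?_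
      have h2 : (2 : k) ≠ 0 := Ring.two_ne_zero hk
      congr 1
      rw [eq_div_iff h2, eq_neg_iff_add_eq_zero]
      exact propext ⟨fun h => by linear_combination h, fun h => by linear_combination h⟩
  rw [h1, Finset.sum_congr rfl fun y _ => h2 y, Finset.sum_comm,
    Finset.sum_congr rfl fun z _ => h3 z, Finset.sum_ite]
  have h4 : V0 ≤ Fintype.card V := by rw [hV]; exact Nat.le_mul_of_pos_left _ hq
  have h5 := Finset.card_filter_add_card_filter_not (s := (Finset.univ : Finset V))
    (fun z => z ∈ radical B)
  simp only [Finset.sum_const, smul_eq_mul]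
  rw [Finset.card_univ] at h5
  have h6 : (Finset.univ.filter fun z => z ∈ radical B).card = (radical B).card := by
    congr 1; ext; simp
  rw [h6] at h5 ⊢
  zify [h4]
  zify at h5
  linear_combination (V0 : ℤ) * h5

/-- The numbers of solutions of `B x x = t` for a symmetric bilinear form `B` over a finite field
of odd order: two integers, subject to one equation, determine all of them. -/
theorem exists_levelCard_eq (hk : ringChar k ≠ 2) (B : LinearMap.BilinForm k V)
    (hB : ∀ x y, B x y = B y x) {V0 : ℕ} (hV : Fintype.card V = Fintype.card k * V0) :
    ∃ S D : ℤ, (levelCard (fun x => B x x) 0 : ℤ) = V0 - (Fintype.card k - 1) * S ∧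
      (∀ t ≠ 0, (levelCard (fun x => B x x) t : ℤ) = V0 + S + quadraticChar k t * D) ∧
      Fintype.card k * S ^ 2 + D ^ 2 = V0 * (radical B).card := by
  -- Two representatives suffice: N(1) = 2a for the squares and N(ν) = 2b for the nonsquares.
  obtain ⟨ν, hν⟩ := quadraticChar_exists_neg_one hk
  have hν0 : ν ≠ 0 := by rintro rfl; simp at hν
  set N := levelCard (fun x => B x x) with hN
  obtain ⟨a, ha⟩ := even_levelCard hk B (one_ne_zero (α := k))
  obtain ⟨b, hb⟩ := even_levelCard hk B hν0
  rw [← hN] at ha hb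
  have hval : ∀ t ≠ 0, (N t : ℤ) = (a + b) + quadraticChar k t * (a - b) := by
    intro t ht
    rcases quadraticChar_dichotomy ht with h | h
    · obtain ⟨u, rfl⟩ := (quadraticChar_one_iff_isSquare ht).mp h
      have hu : u ≠ 0 := by rintro rfl; simp at ht
      have := levelCard_mul_sq B hu 1
      rw [one_mul, sq] at this
      rw [h, hN, this, ← hN, ha]
      push_cast; ring
    · have h1 : quadraticChar k (t / ν) = 1 := by
        rw [div_eq_mul_inv, map_mul, h]
        have : quadraticChar k ν⁻¹ * quadraticChar k ν = 1 := by
          rw [← map_mul, inv_mul_cancel₀ hν0, map_one]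
        rw [hν] at this
        linarith
      obtain ⟨u, hu⟩ := (quadraticChar_one_iff_isSquare (div_ne_zero ht hν0)).mp h1
      have hu0 : u ≠ 0 := by
        rintro rfl
        simp [ht, hν0] at hu
      have := levelCard_mul_sq B hu0 ν
      rw [sq, ← hu, mul_div_cancel₀ _ hν0] at this
      rw [h, hN, this, ← hN, hb]
      push_cast; ring
  have hq1 : ((Finset.univ.erase (0 : k)).card : ℤ) = Fintype.card k - 1 := by
    rw [Finset.card_erase_of_mem (Finset.mem_univ _), Finset.card_univ,
      Nat.cast_sub Fintype.card_pos]
    simp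
  have hχ : ∑ t ∈ Finset.univ.erase (0 : k), quadraticChar k t = 0 := by
    have := quadraticChar_sum_zero hk
    rw [← Finset.add_sum_erase _ _ (Finset.mem_univ (0 : k))] at this
    simpa using this
  have hs1 : (N 0 : ℤ) + (Fintype.card k - 1) * (a + b) = Fintype.card V := by
    rw [← sum_levelCard (fun x => B x x), ← hN, Nat.cast_sum,
      ← Finset.add_sum_erase _ _ (Finset.mem_univ (0 : k)),
      Finset.sum_congr rfl fun t ht => hval t (Finset.ne_of_mem_erase ht),
      Finset.sum_add_distrib, ← Finset.sum_mul, hχ, Finset.sum_const, nsmul_eq_mul, hq1]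
    ring
  have hs2 : (N 0 : ℤ) ^ 2 + (Fintype.card k - 1) * ((a + b) ^ 2 + (a - b) ^ 2) =
      ∑ t, (N t : ℤ) ^ 2 := by
    have h : ∀ t ∈ Finset.univ.erase (0 : k), (N t : ℤ) ^ 2 =
        ((a + b) ^ 2 + (a - b) ^ 2) + quadraticChar k t * (2 * (a + b) * (a - b)) := by
      intro t ht
      have ht0 := Finset.ne_of_mem_erase ht
      rw [hval t ht0]
      linear_combination ((a : ℤ) - b) ^ 2 * quadraticChar_sq_one ht0
    rw [← Finset.add_sum_erase _ _ (Finset.mem_univ (0 : k)), Finset.sum_congr rfl h,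
      Finset.sum_add_distrib, ← Finset.sum_mul, hχ, Finset.sum_const, nsmul_eq_mul, hq1]
    ring
  have hs3 := sum_levelCard_sq hk B hB hV
  have hle : V0 ≤ Fintype.card V := by
    rw [hV]; exact Nat.le_mul_of_pos_left _ Fintype.card_pos
  zify [hle] at hs3
  rw [← hN, ← hs2] at hs3
  have hVz : (Fintype.card V : ℤ) = Fintype.card k * V0 := by exact_mod_cast hV
  have hq : (2 : ℤ) ≤ Fintype.card k := by exact_mod_cast Fintype.one_lt_card (α := k)
  -- S is the excess of the average nonzero level over the mean, D half the difference between
  -- square and nonsquare levels.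
  refine ⟨a + b - V0, a - b, ?_, ?_, ?_⟩
  · linear_combination hs1 + hVz
  · intro t ht
    rw [hval t ht]; ring
  · have h0 : (N 0 : ℤ) = Fintype.card k * V0 - (Fintype.card k - 1) * (a + b) := by
      linear_combination hs1 + hVz
    rw [h0, hVz] at hs3
    have : ((Fintype.card k : ℤ) - 1) ≠ 0 := by linarith
    apply mul_left_cancel₀ this
    linear_combination hs3

end Quadratic

/-! ### The self-adjoint operators of the quadratic forms of the code -/

/-- The preimage of a set under a homomorphism of finite groups, counted by fibres. -/
theorem card_filter_addHom {G H : Type*} [AddCommGroup G] [AddCommGroup H] [Fintype G] [Fintype H]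
    [DecidableEq G] [DecidableEq H] (g : G →+ H) (S : H → Prop) [DecidablePred S] :
    (Finset.univ.filter fun x => S (g x)).card =
      levelCard g 0 * (Finset.univ.filter fun z => S z ∧ z ∈ Finset.univ.image g).card := by
  rw [Finset.card_eq_sum_card_fiberwise (f := g)
    (t := Finset.univ.filter fun z => S z ∧ z ∈ Finset.univ.image g)]
  · rw [mul_comm, ← smul_eq_mul, ← Finset.sum_const]
    refine Finset.sum_congr rfl fun z hz => ?_
    simp only [Finset.mem_filter, Finset.mem_univ, true_and, Finset.mem_image] at hz
    obtain ⟨hz, v, rfl⟩ := hz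
    rw [← levelCard_addHom g (v := v), levelCard]
    congr 1
    ext x
    simp only [Finset.mem_filter, Finset.mem_univ, true_and, and_iff_right_iff_imp]
    intro h; rwa [h]
  · intro x hx
    simpa using hx

section Operator

variable {K : Type*} [Field K] (τ κ : K ≃+* K)

/-- The operator `x ↦ a κ(x) + b τκ(x) + (τκ)⁻¹(b x)`, for commuting automorphisms `τ` and `κ`,
where `κ` is an involution. -/
def kasamiOp (a b x : K) : K := a * κ x + b * τ (κ x) + κ (τ.symm (b * x))

@[simp] theorem kasamiOp_zero (a b : K) : kasamiOp τ κ a b 0 = 0 := by simp [kasamiOp]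

theorem kasamiOp_add (a b x y : K) :
    kasamiOp τ κ a b (x + y) = kasamiOp τ κ a b x + kasamiOp τ κ a b y := by
  simp only [kasamiOp, map_add, mul_add]; ring

theorem kasamiOp_add_coeff (a b a' b' x : K) :
    kasamiOp τ κ (a + a') (b + b') x = kasamiOp τ κ a b x + kasamiOp τ κ a' b' x := by
  simp only [kasamiOp, map_add, add_mul]; ring

theorem kasamiOp_zero_coeff (x : K) : kasamiOp τ κ 0 0 x = 0 := by simp [kasamiOp]

theorem kasamiOp_smul {r : K} (hτ : τ r = r) (hκ : κ r = r) (a b x : K) :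
    kasamiOp τ κ a b (r * x) = r * kasamiOp τ κ a b x := by
  have h : τ.symm r = r := by rw [RingEquiv.symm_apply_eq, hτ]
  simp only [kasamiOp, map_mul, hτ, hκ, h]; ring

theorem kasamiOp_smul_coeff {r : K} (hτ : τ r = r) (hκ : κ r = r) (a b x : K) :
    kasamiOp τ κ (r * a) (r * b) x = r * kasamiOp τ κ a b x := by
  have h : τ.symm r = r := by rw [RingEquiv.symm_apply_eq, hτ]
  simp only [kasamiOp, map_mul, hκ, h]; ring

variable {τ κ}

/-- The monomials xκ(x) and xτκ(x) are multiplicative, so x ↦ ux acts diagonally on the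
coefficients. This is what moves a nonzero kernel element to 1. -/
theorem kasamiOp_subst (hκ : ∀ x, κ (κ x) = x) (hc : ∀ x, τ (κ x) = κ (τ x)) (a b u x : K) :
    kasamiOp τ κ (a * (u * κ u)) (b * (u * τ (κ u))) x = u * kasamiOp τ κ a b (u * x) := by
  simp only [kasamiOp, map_mul, hc, hκ, RingEquiv.symm_apply_apply]
  have h : τ.symm (κ (τ u)) = κ u := by rw [RingEquiv.symm_apply_eq, hc]
  rw [h, hκ]
  ring

section One

variable (hκ : ∀ x, κ (κ x) = x) (hc : ∀ x, τ (κ x) = κ (τ x))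
include hκ hc

theorem symm_comm (x : K) : τ.symm (κ x) = κ (τ.symm x) := by
  rw [RingEquiv.symm_apply_eq, hc, RingEquiv.apply_symm_apply]

omit hκ hc in
theorem kasamiOp_one_eq_zero_iff {a b : K} :
    kasamiOp τ κ a b 1 = 0 ↔ a = -b - κ (τ.symm b) := by
  simp only [kasamiOp, map_one, mul_one]
  constructor <;> intro h
  · linear_combination h
  · rw [h]; ring

/-- The normalisation expresses a through b, so the symmetry condition on a turns into a condition
on b alone. -/
theorem conj_sub_fixed_iff {a b : K} (h : kasamiOp τ κ a b 1 = 0) :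
    κ a = a ↔ τ (κ b - b) = κ b - b := by
  rw [kasamiOp_one_eq_zero_iff] at h
  rw [h, map_sub, map_neg, hκ, ← τ.symm.injective.eq_iff (a := τ (κ b - b)),
    RingEquiv.symm_apply_apply, map_sub, symm_comm hκ hc]
  constructor <;> intro h <;> linear_combination -h

/-- Once 1 is in the kernel, the operator factors through x ↦ τκ(x) - κ(x), and a first-order
twisted equation in that difference is left. -/
theorem kasamiOp_of_one {a b : K} (h : kasamiOp τ κ a b 1 = 0) (x : K) :
    kasamiOp τ κ a b x =
      b * (τ (κ x) - κ x) - τ.symm (κ b * (τ (κ x) - κ x)) := by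
  rw [kasamiOp_one_eq_zero_iff] at h
  simp only [kasamiOp, h, map_mul, map_sub, RingEquiv.symm_apply_apply, symm_comm hκ hc]
  ring

theorem kasamiOp_of_one_eq_zero_iff {a b : K} (h : kasamiOp τ κ a b 1 = 0) (x : K) :
    kasamiOp τ κ a b x = 0 ↔
      τ (b * (τ (κ x) - κ x)) = κ b * (τ (κ x) - κ x) := by
  rw [kasamiOp_of_one hκ hc h, sub_eq_zero, RingEquiv.eq_symm_apply]

end One

variable [Fintype K] [DecidableEq K]

variable (τ κ) in
/-- The kernel of `kasamiOp`. -/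
def kasamiKer (a b : K) : Finset K := Finset.univ.filter fun x => kasamiOp τ κ a b x = 0

theorem mem_kasamiKer {a b x : K} : x ∈ kasamiKer τ κ a b ↔ kasamiOp τ κ a b x = 0 := by
  simp [kasamiKer]

theorem card_kasamiKer_subst (hκ : ∀ x, κ (κ x) = x) (hc : ∀ x, τ (κ x) = κ (τ x)) (a b : K)
    {u : K} (hu : u ≠ 0) :
    (kasamiKer τ κ (a * (u * κ u)) (b * (u * τ (κ u)))).card = (kasamiKer τ κ a b).card := by
  refine Finset.card_bij (fun x _ => u * x) ?_ ?_ ?_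
  · intro x hx
    rw [mem_kasamiKer, kasamiOp_subst hκ hc] at hx
    rw [mem_kasamiKer]
    exact (mul_eq_zero.mp hx).resolve_left hu
  · intro x _ y _ h
    exact mul_left_cancel₀ hu h
  · intro y hy
    refine ⟨u⁻¹ * y, ?_, by field_simp⟩
    rw [mem_kasamiKer] at hy
    rw [mem_kasamiKer, kasamiOp_subst hκ hc, mul_inv_cancel_left₀ hu, hy, mul_zero]

variable (τ κ) in
/-- The homomorphism `x ↦ τ(κ x) - κ x`. -/
def twistedDiff : K →+ K where
  toFun x := τ (κ x) - κ x
  map_zero' := by simp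
  map_add' x y := by simp only [map_add]; ring

theorem levelCard_twistedDiff :
    levelCard (twistedDiff τ κ) 0 = (Finset.univ.filter fun x => τ x = x).card := by
  unfold levelCard
  refine Finset.card_bij (fun x _ => κ x) ?_ ?_ ?_
  · intro x hx
    simpa [twistedDiff, sub_eq_zero] using hx
  · intro x _ y _ h; exact κ.injective h
  · intro y hy
    exact ⟨κ.symm y, by simpa [twistedDiff, sub_eq_zero] using hy, by simp⟩

theorem card_kasamiKer_of_one (hκ : ∀ x, κ (κ x) = x) (hc : ∀ x, τ (κ x) = κ (τ x)) {a b : K}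
    (h : kasamiOp τ κ a b 1 = 0) :
    (kasamiKer τ κ a b).card = (Finset.univ.filter fun x => τ x = x).card *
      (Finset.univ.filter fun z => τ (b * z) = κ b * z ∧
        z ∈ Finset.univ.image (twistedDiff τ κ)).card := by
  rw [← levelCard_twistedDiff (κ := κ), ← card_filter_addHom]
  unfold kasamiKer
  congr 1
  ext x
  simp only [Finset.mem_filter, Finset.mem_univ, true_and]
  exact kasamiOp_of_one_eq_zero_iff hκ hc h x

theorem image_twistedDiff_smul (hc : ∀ x, τ (κ x) = κ (τ x))
    {z t : K} (ht : τ t = t) (hz : z ∈ Finset.univ.image (twistedDiff τ κ)) :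
    t * z ∈ Finset.univ.image (twistedDiff τ κ) := by
  simp only [Finset.mem_image, Finset.mem_univ, true_and] at hz ⊢
  obtain ⟨x, rfl⟩ := hz
  refine ⟨κ.symm t * x, ?_⟩
  simp only [twistedDiff, AddMonoidHom.coe_mk, ZeroHom.coe_mk, map_mul, RingEquiv.apply_symm_apply,
    ht]
  ring

/-- The quotient of two nonzero solutions of τ(bz) = κ(b)z is fixed by `τ`, and the image of
`twistedDiff` is stable under fixed scalars. So the admissible z form zero or one line over the
fixed field. -/
theorem card_kasamiKer_of_one_eq_or (hκ : ∀ x, κ (κ x) = x) (hc : ∀ x, τ (κ x) = κ (τ x)) {a b : K}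
    (h : kasamiOp τ κ a b 1 = 0) (hb : b ≠ 0) :
    (kasamiKer τ κ a b).card = (Finset.univ.filter fun x => τ x = x).card ∨
      (kasamiKer τ κ a b).card = (Finset.univ.filter fun x => τ x = x).card ^ 2 := by
  rw [card_kasamiKer_of_one hκ hc h]
  set Z := Finset.univ.filter fun z => τ (b * z) = κ b * z ∧
        z ∈ Finset.univ.image (twistedDiff τ κ) with hZ
  by_cases hz : ∃ z0 ∈ Z, z0 ≠ 0
  · right
    obtain ⟨z0, hz0, hne⟩ := hz
    rw [sq]
    congr 1
    symm
    have hτb : τ b ≠ 0 := by simpa using hb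
    have hκb : κ b ≠ 0 := by simpa using hb
    rw [hZ, Finset.mem_filter] at hz0
    have hz1 := hz0.2.1
    rw [map_mul] at hz1
    have hτz : τ z0 ≠ 0 := by simpa using hne
    refine Finset.card_bij (fun t _ => t * z0) ?_ ?_ ?_
    · intro t ht
      simp only [Finset.mem_filter, Finset.mem_univ, true_and] at ht
      rw [hZ, Finset.mem_filter]
      refine ⟨Finset.mem_univ _, ?_, image_twistedDiff_smul hc ht hz0.2.2⟩
      simp only [map_mul, ht]
      linear_combination t * hz1
    · intro x _ y _ h
      exact mul_right_cancel₀ hne h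
    · intro z hz
      rw [hZ, Finset.mem_filter, map_mul] at hz
      refine ⟨z / z0, ?_, by field_simp⟩
      simp only [Finset.mem_filter, Finset.mem_univ, true_and, map_div₀]
      rw [div_eq_div_iff hτz hne]
      apply mul_left_cancel₀ hτb
      linear_combination z0 * hz.2.1 - z * hz1
  · left
    push Not at hz
    have : Z = {0} := by
      refine Finset.eq_singleton_iff_unique_mem.mpr ⟨?_, hz⟩
      rw [hZ, Finset.mem_filter]
      refine ⟨Finset.mem_univ _, by simp, ?_⟩
      exact Finset.mem_image.mpr ⟨0, Finset.mem_univ _, map_zero _⟩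
    rw [this]; simp

/-- A nonzero kernel element is moved to 1. There b = 0 would force a = 0, so the normalised
dichotomy applies. -/
theorem card_kasamiKer_eq_or (hκ : ∀ x, κ (κ x) = x) (hc : ∀ x, τ (κ x) = κ (τ x)) {a b : K}
    (hab : ¬(a = 0 ∧ b = 0)) :
    (kasamiKer τ κ a b).card = 1 ∨
    (kasamiKer τ κ a b).card = (Finset.univ.filter fun x => τ x = x).card ∨
      (kasamiKer τ κ a b).card = (Finset.univ.filter fun x => τ x = x).card ^ 2 := by
  by_cases h : ∃ u ∈ kasamiKer τ κ a b, u ≠ 0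
  · obtain ⟨u, hu, hu0⟩ := h
    right
    rw [← card_kasamiKer_subst hκ hc a b hu0]
    have h1 : kasamiOp τ κ (a * (u * κ u)) (b * (u * τ (κ u))) 1 = 0 := by
      rw [kasamiOp_subst hκ hc, mul_one, mem_kasamiKer.mp hu, mul_zero]
    refine card_kasamiKer_of_one_eq_or hκ hc h1 ?_
    intro hb
    have hu1 : τ (κ u) ≠ 0 := by simpa using hu0
    have hu2 : κ u ≠ 0 := by simpa using hu0
    have hb0 : b = 0 := by simpa [hu0, hu1] using hb
    rw [kasamiOp_one_eq_zero_iff, hb0] at h1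
    exact hab ⟨by simpa [hu0, hu2] using h1, hb0⟩
  · left
    push Not at h
    rw [Finset.card_eq_one]
    exact ⟨0, Finset.eq_singleton_iff_unique_mem.mpr ⟨mem_kasamiKer.mpr (by simp), h⟩⟩

variable (τ κ) in
/-- The pairs of coefficients `(a, b)` with `κ a = a`. -/
def coeffPairs : Finset (K × K) := Finset.univ.filter fun θ => κ θ.1 = θ.1

/-- Double counting of the pairs of a form of a class that is invariant under substitutions
and a nonzero element of its radical. -/
theorem sum_card_kasamiKer_sub_one (hκ : ∀ x, κ (κ x) = x) (hc : ∀ x, τ (κ x) = κ (τ x))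
    (C : K × K → Prop) [DecidablePred C]
    (hC : ∀ a b u : K, u ≠ 0 → (C (a * (u * κ u), b * (u * τ (κ u))) ↔ C (a, b))) :
    ∑ θ ∈ (coeffPairs κ).filter C, ((kasamiKer τ κ θ.1 θ.2).card - 1) =
      (Fintype.card K - 1) *
        (((coeffPairs κ).filter C).filter fun θ => kasamiOp τ κ θ.1 θ.2 1 = 0).card := by
  have h1 : ∀ θ : K × K, (kasamiKer τ κ θ.1 θ.2).card - 1 =
      ∑ u ∈ Finset.univ.erase (0 : K), if kasamiOp τ κ θ.1 θ.2 u = 0 then 1 else 0 := by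
    intro θ
    rw [← Finset.card_filter, ← Finset.card_erase_of_mem (a := 0) (mem_kasamiKer.mpr (by simp))]
    congr 1
    ext x
    simp [mem_kasamiKer]
  rw [Finset.sum_congr rfl fun θ _ => h1 θ, Finset.sum_comm]
  have h2 : ∀ u ∈ Finset.univ.erase (0 : K),
      (∑ θ ∈ (coeffPairs κ).filter C, if kasamiOp τ κ θ.1 θ.2 u = 0 then 1 else 0) =
      (((coeffPairs κ).filter C).filter fun θ => kasamiOp τ κ θ.1 θ.2 1 = 0).card := by
    intro u hu
    have hu0 := Finset.ne_of_mem_erase hu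
    have hu1 : τ (κ u) ≠ 0 := by simpa using hu0
    have hu2 : κ u ≠ 0 := by simpa using hu0
    have hfix : κ (u * κ u) = u * κ u := by rw [map_mul, hκ, mul_comm]
    rw [← Finset.card_filter]
    -- Substitution by u carries the forms of the class with u in the kernel bijectively to those
    -- with 1 in the kernel, so every nonzero u contributes the same number.
    refine Finset.card_bij (fun θ _ => (θ.1 * (u * κ u), θ.2 * (u * τ (κ u)))) ?_ ?_ ?_
    · intro θ hθ
      simp only [coeffPairs, Finset.mem_filter, Finset.mem_univ, true_and] at hθ ⊢
      refine ⟨⟨?_, (hC _ _ u hu0).mpr hθ.1.2⟩, ?_⟩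
      · rw [map_mul, hθ.1.1, hfix]
      · rw [kasamiOp_subst hκ hc, mul_one, hθ.2, mul_zero]
    · intro θ _ θ' _ h
      simp only [Prod.mk.injEq] at h
      exact Prod.ext (mul_right_cancel₀ (mul_ne_zero hu0 hu2) h.1)
        (mul_right_cancel₀ (mul_ne_zero hu0 hu1) h.2)
    · intro θ hθ
      have e : θ = (θ.1 / (u * κ u) * (u * κ u), θ.2 / (u * τ (κ u)) * (u * τ (κ u))) := by
        ext <;> field_simp
      simp only [coeffPairs, Finset.mem_filter, Finset.mem_univ, true_and] at hθ
      refine ⟨(θ.1 / (u * κ u), θ.2 / (u * τ (κ u))), ?_, e.symm⟩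
      simp only [coeffPairs, Finset.mem_filter, Finset.mem_univ, true_and]
      refine ⟨⟨?_, ?_⟩, ?_⟩
      · rw [map_div₀, hθ.1.1, hfix]
      · rw [← hC _ _ u hu0, ← e]; exact hθ.1.2
      · have h := kasamiOp_subst hκ hc (θ.1 / (u * κ u)) (θ.2 / (u * τ (κ u))) u 1
        rw [mul_one, div_mul_cancel₀ _ (mul_ne_zero hu0 hu2),
          div_mul_cancel₀ _ (mul_ne_zero hu0 hu1), hθ.2] at h
        exact (mul_eq_zero.mp h.symm).resolve_left hu0
  rw [Finset.sum_congr rfl h2, Finset.sum_const, smul_eq_mul,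
    Finset.card_erase_of_mem (Finset.mem_univ _), Finset.card_univ]

end Operator

/-! ### The quadratic forms of the code -/

section Form

variable {k K : Type*} [Field k] [Field K] [Algebra k K] {τ κ : K ≃+* K}

theorem trace_ringEquiv (hτ : ∀ r : k, τ (algebraMap k K r) = algebraMap k K r) (x : K) :
    Algebra.trace k K (τ x) = Algebra.trace k K x :=
  Algebra.trace_eq_of_algEquiv (AlgEquiv.ofRingEquiv (f := τ) hτ) x

variable (τ κ) in
/-- The bilinear form `(x, y) ↦ Tr(E(x) y)`, with `E` the operator `kasamiOp`. -/
noncomputable def kasamiForm (hτ : ∀ r : k, τ (algebraMap k K r) = algebraMap k K r)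
    (hκ : ∀ r : k, κ (algebraMap k K r) = algebraMap k K r) (a b : K) : LinearMap.BilinForm k K :=
  LinearMap.mk₂ k (fun x y => Algebra.trace k K (kasamiOp τ κ a b x * y))
    (fun x y z => by rw [kasamiOp_add, add_mul, map_add])
    (fun r x y => by
      rw [Algebra.smul_def, kasamiOp_smul τ κ (hτ r) (hκ r), mul_assoc, ← Algebra.smul_def,
        map_smul])
    (fun x y z => by rw [mul_add, map_add])
    (fun r x y => by rw [mul_smul_comm, map_smul])

variable (hτ : ∀ r : k, τ (algebraMap k K r) = algebraMap k K r)
    (hκ : ∀ r : k, κ (algebraMap k K r) = algebraMap k K r)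

theorem kasamiForm_apply (a b x y : K) :
    kasamiForm τ κ hτ hκ a b x y = Algebra.trace k K (kasamiOp τ κ a b x * y) := rfl

include hτ hκ in
-- The third term of the operator is the adjoint of the second for the trace form; only the term in
-- a can break the symmetry in x and y.
theorem trace_kasamiOp_mul (hκκ : ∀ x, κ (κ x) = x) (a b x y : K) :
    Algebra.trace k K (kasamiOp τ κ a b x * y) =
      Algebra.trace k K (a * κ x * y + b * (τ (κ x) * y + x * τ (κ y))) := by
  have h : Algebra.trace k K (κ (τ.symm (b * x)) * y) = Algebra.trace k K (b * x * τ (κ y)) := by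
    rw [← trace_ringEquiv hκ, map_mul, hκκ, ← trace_ringEquiv hτ, map_mul,
      RingEquiv.apply_symm_apply]
  simp only [kasamiOp, add_mul, mul_add, map_add, h]
  ring_nf

theorem kasamiForm_symm (hκκ : ∀ x, κ (κ x) = x) {a : K} (ha : κ a = a) (b x y : K) :
    kasamiForm τ κ hτ hκ a b x y = kasamiForm τ κ hτ hκ a b y x := by
  have h : Algebra.trace k K (a * κ x * y) = Algebra.trace k K (a * κ y * x) := by
    rw [← trace_ringEquiv hκ]
    simp only [map_mul, hκκ, ha]
    ring_nf
  simp only [kasamiForm_apply, trace_kasamiOp_mul hτ hκ hκκ, map_add, h]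
  congr 2
  ring

theorem kasamiForm_self (hκκ : ∀ x, κ (κ x) = x) (a b x : K) :
    kasamiForm τ κ hτ hκ a b x x = Algebra.trace k K (a * (x * κ x) + 2 * b * (x * τ (κ x))) := by
  rw [kasamiForm_apply, trace_kasamiOp_mul hτ hκ hκκ]
  ring_nf

theorem kasamiForm_subst (hκκ : ∀ x, κ (κ x) = x) (hc : ∀ x, τ (κ x) = κ (τ x)) (a b u x y : K) :
    kasamiForm τ κ hτ hκ (a * (u * κ u)) (b * (u * τ (κ u))) x y =
      kasamiForm τ κ hτ hκ a b (u * x) (u * y) := by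
  rw [kasamiForm_apply, kasamiForm_apply, kasamiOp_subst hκκ hc]
  ring_nf

theorem kasamiForm_smul_coeff (u : k) (a b x y : K) :
    kasamiForm τ κ hτ hκ (algebraMap k K u * a) (algebraMap k K u * b) x y =
      u * kasamiForm τ κ hτ hκ a b x y := by
  rw [kasamiForm_apply, kasamiForm_apply, kasamiOp_smul_coeff τ κ (hτ u) (hκ u), mul_assoc,
    ← Algebra.smul_def, map_smul, smul_eq_mul]

/-- Normalised forms with κ(b) = b are norm forms in z = τ(x) - x; their zeros are counted below by
counting norms. -/
theorem kasamiForm_self_of_one (hκκ : ∀ x, κ (κ x) = x) (hc : ∀ x, τ (κ x) = κ (τ x)) {a b : K}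
    (h : kasamiOp τ κ a b 1 = 0) (hb : κ b = b) (x : K) :
    kasamiForm τ κ hτ hκ a b x x = -Algebra.trace k K (b * ((τ x - x) * κ (τ x - x))) := by
  have h1 : Algebra.trace k K (τ.symm (b * (τ (κ x) - κ x)) * x) =
      Algebra.trace k K (b * (τ (κ x) - κ x) * τ x) := by
    rw [← trace_ringEquiv hτ, map_mul, RingEquiv.apply_symm_apply]
  rw [kasamiForm_apply, kasamiOp_of_one hκκ hc h, sub_mul, map_sub, hb, h1, ← map_sub, ← map_neg,
    map_sub κ, hc]
  ring_nf

variable [Fintype K] [DecidableEq K]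

theorem kasamiForm_eq_zero_iff [Algebra.IsSeparable k K] [FiniteDimensional k K] (a b x : K) :
    kasamiForm τ κ hτ hκ a b x = 0 ↔ kasamiOp τ κ a b x = 0 := by
  constructor
  · intro h
    refine (traceForm_nondegenerate k K).1 _ fun y => ?_
    rw [Algebra.traceForm_apply, ← kasamiForm_apply hτ hκ, h, LinearMap.zero_apply]
  · intro h
    ext y
    rw [kasamiForm_apply, h, zero_mul, map_zero, LinearMap.zero_apply]

theorem card_radical_kasamiForm [Algebra.IsSeparable k K] [FiniteDimensional k K] (a b : K) :
    (radical (kasamiForm τ κ hτ hκ a b)).card = (kasamiKer τ κ a b).card := by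
  congr 1
  ext x
  rw [mem_radical, mem_kasamiKer, kasamiForm_eq_zero_iff]

include hκ in
-- Symmetrising x to x + κ(x) doubles the trace, whence the division of r by 2.
theorem exists_fixed_trace_mul_eq [Algebra.IsSeparable k K] [FiniteDimensional k K]
    (h2 : (2 : k) ≠ 0) (hκκ : ∀ x, κ (κ x) = x) {b : K} (hb : b ≠ 0) (hκb : κ b = b) (r : k) :
    ∃ y, κ y = y ∧ Algebra.trace k K (b * y) = r := by
  obtain ⟨x, hx⟩ := Algebra.trace_surjective k K (r / 2)
  refine ⟨(x + κ x) / b, ?_, ?_⟩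
  · rw [map_div₀, map_add, hκκ, hκb, add_comm]
  · rw [mul_div_cancel₀ _ hb, map_add, trace_ringEquiv hκ, hx, ← two_mul, mul_div_cancel₀ _ h2]

end Form

/-! ### Counting norms -/

section Norm

variable {K : Type*} [Field K] [Fintype K] [DecidableEq K] {κ : K ≃+* K} {P : ℕ}

/-- As zκ(z) = z^(P+1), a fibre has at most P + 1 elements. The P² - 1 nonzero z fall into P - 1
fibres, so every bound is attained. -/
theorem card_norm_eq (hκκ : ∀ x, κ (κ x) = x) (hκP : ∀ x, κ x = x ^ P)
    (hK : Fintype.card K = P ^ 2) (hK0 : (Finset.univ.filter fun x => κ x = x).card = P)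
    {y : K} (hy : κ y = y) (hy0 : y ≠ 0) :
    (Finset.univ.filter fun z => z * κ z = y).card = P + 1 := by
  have hP : 0 < P := by
    rw [← hK0]
    exact Finset.card_pos.mpr ⟨0, by simp⟩
  set S := (Finset.univ.filter fun x => κ x = x).erase 0 with hS
  have hScard : S.card = P - 1 := by rw [hS, Finset.card_erase_of_mem (by simp), hK0]
  have hle : ∀ y ∈ S, (Finset.univ.filter fun z => z * κ z = y).card ≤ P + 1 := by
    intro y _
    refine le_trans (Finset.card_le_card (t := (nthRoots (P + 1) y).toFinset) ?_)
      ((Multiset.toFinset_card_le _).trans (card_nthRoots _ _))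
    intro z hz
    simp only [Finset.mem_filter, Finset.mem_univ, true_and] at hz
    rw [Multiset.mem_toFinset, mem_nthRoots (Nat.succ_pos P), ← hz, hκP]
    exact (pow_succ' z P).symm ▸ rfl
  have hsum : ∑ y ∈ S, (Finset.univ.filter fun z => z * κ z = y).card = ∑ y ∈ S, (P + 1) := by
    have h : ∀ y ∈ S, (Finset.univ.filter fun z => z * κ z = y) =
        (Finset.univ.erase (0 : K)).filter fun z => z * κ z = y := by
      intro y hy
      ext z
      simp only [Finset.mem_filter, Finset.mem_univ, true_and, Finset.mem_erase, and_true]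
      constructor
      · rintro rfl
        refine ⟨?_, rfl⟩
        rintro rfl
        simp [hS] at hy
      · exact fun h => h.2
    rw [Finset.sum_congr rfl fun y hy => congrArg Finset.card (h y hy),
      ← Finset.card_eq_sum_card_fiberwise, Finset.card_erase_of_mem (Finset.mem_univ _),
      Finset.card_univ, hK, Finset.sum_const, hScard, smul_eq_mul]
    · obtain ⟨n, rfl⟩ : ∃ n, P = n + 1 := ⟨P - 1, by omega⟩
      simp only [Nat.add_sub_cancel]
      have : (n + 1) ^ 2 = n * (n + 1 + 1) + 1 := by ring
      omega
    · intro z hz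
      have hz0 : z ≠ 0 := by simpa using hz
      have hz1 : κ z ≠ 0 := by simpa using hz0
      simp [hS, hκκ, hz0, mul_comm]
  exact (Finset.sum_eq_sum_iff_of_le hle).mp hsum y (by simp [hS, hy, hy0])

theorem card_fixed_filter (hK0 : (Finset.univ.filter fun x => κ x = x).card = P)
    {F : Type*} [AddCommGroup F] [Fintype F] [DecidableEq F] (L : K →+ F)
    (hL : ∀ r, ∃ y, κ y = y ∧ L y = r) :
    Fintype.card F * (Finset.univ.filter fun y => κ y = y ∧ L y = 0).card = P := by
  let H : AddSubgroup K := (κ.toAddEquiv.toAddMonoidHom - AddMonoidHom.id K).ker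
  have hH : ∀ y, y ∈ H ↔ κ y = y := fun y => by
    simp [H, AddMonoidHom.mem_ker, sub_eq_zero]
  classical
  have h := card_mul_levelCard_of_surjective (L.comp H.subtype) (fun r => by
    obtain ⟨y, hy, hr⟩ := hL r
    exact ⟨⟨y, (hH y).mpr hy⟩, hr⟩) 0
  have hcard : Fintype.card H = P := by
    rw [← hK0]
    exact Fintype.card_of_subtype _ (by simp [hH])
  rw [← hcard, ← h]
  congr 1
  unfold levelCard
  symm
  refine Finset.card_bij (fun y _ => (y : K)) ?_ ?_ ?_
  · intro y hy
    simp only [Finset.mem_filter, Finset.mem_univ, true_and] at hy ⊢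
    exact ⟨(hH _).mp y.2, hy⟩
  · intro a _ b _ h; exact Subtype.ext h
  · intro y hy
    simp only [Finset.mem_filter, Finset.mem_univ, true_and] at hy
    exact ⟨⟨y, (hH y).mpr hy.1⟩, Finset.mem_filter.mpr ⟨Finset.mem_univ _, hy.2⟩, rfl⟩

/-- The number of zeros of `z ↦ L(z κ(z))`, for a homomorphism `L` on the fixed field of the
involution `κ`. -/
theorem card_norm_zeros (hκκ : ∀ x, κ (κ x) = x) (hκP : ∀ x, κ x = x ^ P)
    (hK : Fintype.card K = P ^ 2) (hK0 : (Finset.univ.filter fun x => κ x = x).card = P)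
    {F : Type*} [AddCommGroup F] [Fintype F] [DecidableEq F] (L : K →+ F)
    (hL : ∀ r, ∃ y, κ y = y ∧ L y = r) :
    Fintype.card F * ((Finset.univ.filter fun z => L (z * κ z) = 0).card + P) = (P + 1) * P := by
  have h0 := card_fixed_filter hK0 L hL
  set S := Finset.univ.filter fun y => κ y = y ∧ L y = 0 with hS
  have hmem : (0 : K) ∈ S := by simp [hS]
  -- Zero is the norm of zero only; each other fixed element killed by L is the norm of P + 1
  -- elements.
  have h1 : (Finset.univ.filter fun z => L (z * κ z) = 0).card = 1 + (S.card - 1) * (P + 1) := by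
    rw [Finset.card_eq_sum_card_fiberwise (f := fun z => z * κ z) (t := S)]
    · rw [← Finset.add_sum_erase _ _ hmem]
      congr 1
      · rw [Finset.card_eq_one]
        refine ⟨0, ?_⟩
        ext z
        simp only [Finset.mem_filter, Finset.mem_univ, true_and, Finset.mem_singleton]
        constructor
        · rintro ⟨-, h⟩; simpa using h
        · rintro rfl; simp
      · rw [Finset.sum_congr rfl (g := fun _ => P + 1), Finset.sum_const, smul_eq_mul,
          Finset.card_erase_of_mem hmem]
        intro y hy
        rw [hS, Finset.mem_erase, Finset.mem_filter] at hy
        rw [← card_norm_eq hκκ hκP hK hK0 hy.2.2.1 hy.1]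
        congr 1
        ext z
        simp only [Finset.mem_filter, Finset.mem_univ, true_and, and_iff_right_iff_imp]
        rintro h; rw [h]; exact hy.2.2.2
    · intro z hz
      simp only [Finset.coe_filter, Finset.mem_univ, true_and, Set.mem_ofPred_eq] at hz
      simp [hS, hz, hκκ, mul_comm]
  have hpos : 0 < S.card := Finset.card_pos.mpr ⟨0, hmem⟩
  rw [h1]
  obtain ⟨n, hn⟩ : ∃ n, S.card = n + 1 := ⟨S.card - 1, by omega⟩
  rw [hn] at h0 ⊢
  simp only [Nat.add_sub_cancel]
  linear_combination (P + 1) * h0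

end Norm

/-! ### Forms with nontrivial radical, when the involution fixes the fixed field of `τ` -/

theorem levelCard_comp {V k F : Type*} [Fintype V] [Fintype k] [DecidableEq k] [DecidableEq F]
    (f : V → k) (L : k → F) (t : F) :
    levelCard (fun x => L (f x)) t = ∑ v ∈ Finset.univ.filter (fun v => L v = t), levelCard f v := by
  unfold levelCard
  rw [Finset.card_eq_sum_card_fiberwise (f := f) (t := Finset.univ.filter fun v => L v = t)]
  · refine Finset.sum_congr rfl fun v hv => ?_
    congr 1
    ext x
    simp only [Finset.mem_filter, Finset.mem_univ, true_and] at hv ⊢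
    constructor
    · exact fun h => h.2
    · rintro rfl; exact ⟨hv, rfl⟩
  · intro x hx
    simpa using hx

theorem quadraticChar_inv_eq_neg_one {k : Type*} [Field k] [Fintype k] [DecidableEq k] {u : k}
    (hu : quadraticChar k u = -1) : quadraticChar k u⁻¹ = -1 := by
  have hu0 : u ≠ 0 := by rintro rfl; simp at hu
  have : quadraticChar k u⁻¹ * quadraticChar k u = 1 := by
    rw [← map_mul, inv_mul_cancel₀ hu0, map_one]
  rw [hu] at this
  linarith

section Degenerate

variable {k K : Type*} [Field k] [Field K] [Algebra k K] {τ κ : K ≃+* K} [Fintype k] [DecidableEq k]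
  [Fintype K] [DecidableEq K]

theorem card_fixed_eq (hfix : ∀ x : K, τ x = x ↔ ∃ r : k, algebraMap k K r = x) :
    (Finset.univ.filter fun x => τ x = x).card = Fintype.card k := by
  rw [← Finset.card_univ]
  symm
  refine Finset.card_bij (fun r _ => algebraMap k K r) ?_ ?_ ?_
  · intro r _
    simpa using (hfix _).mpr ⟨r, rfl⟩
  · intro a _ b _ h; exact (algebraMap k K).injective h
  · intro x hx
    obtain ⟨r, hr⟩ := (hfix x).mp (by simpa using hx)
    exact ⟨r, Finset.mem_univ _, hr⟩

theorem card_trace_eq_zero :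
    Fintype.card k * (Finset.univ.filter fun y => Algebra.trace k K y = 0).card =
      Fintype.card K :=
  card_mul_levelCard_of_surjective (Algebra.trace k K).toAddMonoidHom
    (Algebra.trace_surjective k K) 0

/-- The additive form of Hilbert's theorem 90. -/
theorem mem_image_twistedDiff_iff
    (hfix : ∀ x : K, τ x = x ↔ ∃ r : k, algebraMap k K r = x) (y : K) :
    y ∈ Finset.univ.image (twistedDiff τ κ) ↔ Algebra.trace k K y = 0 := by
  have hτ : ∀ r : k, τ (algebraMap k K r) = algebraMap k K r := fun r => (hfix _).mpr ⟨r, rfl⟩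
  have hsub : Finset.univ.image (twistedDiff τ κ) ⊆
      Finset.univ.filter fun y => Algebra.trace k K y = 0 := by
    intro z hz
    obtain ⟨x, -, rfl⟩ := Finset.mem_image.mp hz
    simp [twistedDiff, trace_ringEquiv hτ]
  -- The image lies in the elements of trace zero, and both sets have |K| / |k| elements.
  have hcard := card_filter_addHom (twistedDiff τ κ) (fun _ => True)
  rw [levelCard_twistedDiff, card_fixed_eq hfix] at hcard
  simp only [Finset.filter_true, true_and, Finset.card_univ] at hcard
  rw [← card_trace_eq_zero (k := k)] at hcard
  have h := Nat.eq_of_mul_eq_mul_left Fintype.card_pos hcard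
  have heq := Finset.eq_of_subset_of_card_le hsub (h.trans_le (Finset.card_le_card (by
    intro z hz; simpa using hz)))
  rw [heq]; simp

/-- With κ(b) = b the twisted equation says that bz is fixed by `τ`, so z = r/b with r in k. By
Hilbert 90 such a z is admissible exactly if r Tr(1/b) = 0. -/
theorem card_kasamiKer_of_trace (hκκ : ∀ x, κ (κ x) = x) (hc : ∀ x, τ (κ x) = κ (τ x))
    (hfix : ∀ x : K, τ x = x ↔ ∃ r : k, algebraMap k K r = x)
    {a b : K} (h : kasamiOp τ κ a b 1 = 0) (hκb : κ b = b) (hb : b ≠ 0) :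
    (kasamiKer τ κ a b).card =
      if Algebra.trace k K b⁻¹ = 0 then Fintype.card k ^ 2 else Fintype.card k := by
  rw [card_kasamiKer_of_one hκκ hc h, card_fixed_eq hfix]
  have hset : ∀ z, (τ (b * z) = κ b * z ∧ z ∈ Finset.univ.image (twistedDiff τ κ)) ↔
      ∃ r : k, z = algebraMap k K r * b⁻¹ ∧ r * Algebra.trace k K b⁻¹ = 0 := by
    intro z
    rw [hκb, hfix, mem_image_twistedDiff_iff hfix]
    constructor
    · rintro ⟨⟨r, hr⟩, hz⟩
      have hz' : z = algebraMap k K r * b⁻¹ := by rw [hr]; field_simp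
      refine ⟨r, hz', ?_⟩
      rwa [hz', ← Algebra.smul_def, map_smul, smul_eq_mul] at hz
    · rintro ⟨r, rfl, hr⟩
      refine ⟨⟨r, by field_simp⟩, ?_⟩
      rwa [← Algebra.smul_def, map_smul, smul_eq_mul]
  simp only [hset]
  split_ifs with ht
  · rw [sq]
    congr 1
    rw [← Finset.card_univ]
    symm
    refine Finset.card_bij (fun r _ => algebraMap k K r * b⁻¹) ?_ ?_ ?_
    · intro r _; simp [ht]
    · intro r _ r' _ h
      exact (algebraMap k K).injective (mul_right_cancel₀ (inv_ne_zero hb) h)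
    · intro z hz
      simp only [Finset.mem_filter, Finset.mem_univ, true_and] at hz
      obtain ⟨r, hr, -⟩ := hz
      exact ⟨r, Finset.mem_univ _, hr.symm⟩
  · have : (Finset.univ.filter fun z : K =>
        ∃ r : k, z = algebraMap k K r * b⁻¹ ∧ r * Algebra.trace k K b⁻¹ = 0) = {0} := by
      ext z
      simp [ht]
    rw [this]; simp

variable {P : ℕ}

/-! ### Radical of dimension one over the fixed field `k` of `τ`. -/

section Corank

variable (hκκ : ∀ x, κ (κ x) = x) (hc : ∀ x, τ (κ x) = κ (τ x))
  (hfix : ∀ x : K, τ x = x ↔ ∃ r : k, algebraMap k K r = x)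
  (hκk : ∀ r : k, κ (algebraMap k K r) = algebraMap k K r)
  (hκP : ∀ x, κ x = x ^ P) (hK : Fintype.card K = P ^ 2)
  (hK0 : (Finset.univ.filter fun x => κ x = x).card = P)
  (h2 : ringChar k ≠ 2)

include hκκ hκk in
-- The two cross terms have equal traces because the trace is invariant under `κ`. Adding t/b
-- supplies the direction missing from the image of τ - 1 in corank one, and translates along the
-- trace-zero hyperplane in corank two.
theorem trace_shift {b : K} (hb : b ≠ 0) (hκb : κ b = b) (z : K) (t : k) :
    Algebra.trace k K (b * ((z + algebraMap k K t * b⁻¹) * κ (z + algebraMap k K t * b⁻¹))) =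
      Algebra.trace k K (b * (z * κ z)) + 2 * t * Algebra.trace k K z +
        t ^ 2 * Algebra.trace k K b⁻¹ := by
  have h : b * ((z + algebraMap k K t * b⁻¹) * κ (z + algebraMap k K t * b⁻¹)) =
      b * (z * κ z) + (t • z + t • κ z) + (t ^ 2) • b⁻¹ := by
    simp only [map_add, map_mul, hκk, map_inv₀, hκb, Algebra.smul_def, map_pow]
    field_simp
    ring
  rw [h, map_add, map_add, map_add, map_smul, map_smul, map_smul, trace_ringEquiv hκk]
  simp only [smul_eq_mul]
  ring

include hκκ hc hfix hκk hκP hK hK0 h2 in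
/-- A form with radical of dimension one over `k` takes the value `0` as often as on average. -/
theorem levelCard_of_corank_one {a b : K}
    (h : kasamiOp τ κ a b 1 = 0) (hκb : κ b = b) (hb : b ≠ 0) (htr : Algebra.trace k K b⁻¹ ≠ 0)
    (hτk : ∀ r : k, τ (algebraMap k K r) = algebraMap k K r) {V0 : ℕ}
    (hV0 : Fintype.card K = Fintype.card k * V0) :
    (levelCard (fun x => kasamiForm τ κ hτk hκk a b x x) 0 = V0) ∧
    ∀ u v : k, quadraticChar k u = -1 →
      levelCard (fun x => kasamiForm τ κ hτk hκk a b x x) v +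
        levelCard (fun x => kasamiForm τ κ hτk hκk a b x x) (v * u) = 2 * V0 := by
  have hκa : κ a = a := by
    rw [conj_sub_fixed_iff hκκ hc h, hκb, sub_self, map_zero]
  obtain ⟨S, D, hN0, hN, hSD⟩ := exists_levelCard_eq h2 (kasamiForm τ κ hτk hκk a b)
    (kasamiForm_symm hτk hκk hκκ hκa b) hV0
  rw [card_radical_kasamiForm, card_kasamiKer_of_trace hκκ hc hfix h hκb hb, if_neg htr] at hSD
  have h20 : (2 : k) ≠ 0 := Ring.two_ne_zero h2
  set c := Algebra.trace k K b⁻¹ with hcdef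
  set N := levelCard (fun x => kasamiForm τ κ hτk hκk a b x x) with hNdef
  -- the map `(x, t) ↦ τ x - x + t / b`
  let g : K × k →+ K :=
    { toFun := fun w => τ w.1 - w.1 + algebraMap k K w.2 * b⁻¹
      map_zero' := by simp
      map_add' := fun v w => by simp only [Prod.fst_add, Prod.snd_add, map_add]; ring }
  -- The image of τ - 1 is the hyperplane of trace zero, and 1/b lies outside it.
  have hg : Function.Surjective g := by
    intro z
    have hz := (mem_image_twistedDiff_iff (κ := RingEquiv.refl K) hfix
      (z - algebraMap k K (Algebra.trace k K z / c) * b⁻¹)).mpr (by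
        rw [map_sub, ← Algebra.smul_def, map_smul, smul_eq_mul, ← hcdef, div_mul_cancel₀ _ htr,
          sub_self])
    obtain ⟨x, -, hx⟩ := Finset.mem_image.mp hz
    refine ⟨(x, Algebra.trace k K z / c), ?_⟩
    change τ x - x = _ at hx
    change τ x - x + _ = _
    rw [hx]; ring
  have hgker : levelCard g 0 = Fintype.card k := by
    have := card_mul_levelCard_of_surjective g hg 0
    rw [Fintype.card_prod] at this
    exact Nat.eq_of_mul_eq_mul_left Fintype.card_pos this
  have hcount := card_filter_addHom g
    (fun z => Algebra.trace k K (b * (z * κ z)) = 0)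
  have himg : ∀ z, z ∈ Finset.univ.image g := fun z => by
    obtain ⟨w, hw⟩ := hg z
    exact Finset.mem_image.mpr ⟨w, Finset.mem_univ _, hw⟩
  -- The cross term vanishes as Tr(τ(x) - x) = 0, so zeros of the norm form pull back to B(x, x) =
  -- t²c. For t ≠ 0 this level has the size of the level c.
  have hzero : ∀ z : K × k, Algebra.trace k K (b * (g z * κ (g z))) = 0 ↔
      kasamiForm τ κ hτk hκk a b z.1 z.1 = z.2 ^ 2 * c := by
    rintro ⟨x, t⟩
    change Algebra.trace k K (b * ((τ x - x + algebraMap k K t * b⁻¹) *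
      κ (τ x - x + algebraMap k K t * b⁻¹))) = 0 ↔ _
    have hx : Algebra.trace k K (τ x - x) = 0 := by rw [map_sub, trace_ringEquiv hτk, sub_self]
    rw [trace_shift hκκ hκk hb hκb, kasamiForm_self_of_one hτk hκk hκκ hc h hκb, hx, ← hcdef]
    constructor <;> intro h <;> linear_combination -h
  simp only [himg, and_true, hzero, hgker] at hcount
  have hsum : (Finset.univ.filter fun z : K × k =>
      kasamiForm τ κ hτk hκk a b z.1 z.1 = z.2 ^ 2 * c).card =
      N 0 + (Fintype.card k - 1) * N c := by
    have : ∀ t : k, (Finset.univ.filter fun x : K =>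
        kasamiForm τ κ hτk hκk a b x x = t ^ 2 * c).card = if t = 0 then N 0 else N c := by
      intro t
      split_ifs with ht
      · simp [ht, hNdef, levelCard]
      · rw [hNdef, ← levelCard_mul_sq _ ht c, levelCard, mul_comm]
    rw [Finset.card_filter, Fintype.sum_prod_type_right]
    simp only [← Finset.card_filter, this]
    rw [← Finset.add_sum_erase _ _ (Finset.mem_univ (0 : k)), if_pos rfl,
      Finset.sum_congr rfl (g := fun _ => N c) (fun t ht => if_neg (Finset.ne_of_mem_erase ht)),
      Finset.sum_const, Finset.card_erase_of_mem (Finset.mem_univ _), Finset.card_univ, smul_eq_mul]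
  have hnz := card_norm_zeros hκκ hκP hK hK0
    ((Algebra.trace k K).toAddMonoidHom.comp (AddMonoidHom.mulLeft b))
    (fun r => exists_fixed_trace_mul_eq hκk h20 hκκ hb hκb r)
  change Fintype.card k * ((Finset.univ.filter fun z =>
    Algebra.trace k K (b * (z * κ z)) = 0).card + P) = _ at hnz
  rw [hsum] at hcount
  set Z := (Finset.univ.filter fun z => Algebra.trace k K (b * (z * κ z)) = 0).card
  have hq : (1 : ℕ) < Fintype.card k := Fintype.one_lt_card
  zify [hq.le] at hcount hnz
  rw [hN0, hN c htr] at hcount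
  have hV0' : (P : ℤ) ^ 2 = Fintype.card k * V0 := by
    rw [← Nat.cast_pow, ← hK]; exact_mod_cast hV0
  have hqz : (1 : ℤ) < Fintype.card k := by exact_mod_cast hq
  -- In N(0) + (|k| - 1) N(c) the integer S cancels, so the norm count isolates χ(c)D. Then D² = P²
  -- leaves no room for S in |k| S² + D² = P².
  have hD : quadraticChar k c * D = -P := by
    apply mul_left_cancel₀ (by linarith : (Fintype.card k : ℤ) - 1 ≠ 0)
    linear_combination hcount + hnz + hV0'
  have hD2 : D ^ 2 = P ^ 2 := by
    have h1 := quadraticChar_sq_one htr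
    have h3 : (quadraticChar k c * D) ^ 2 = (-(P : ℤ)) ^ 2 := by rw [hD]
    rwa [mul_pow, h1, one_mul, neg_sq] at h3
  have hS : S = 0 := by
    have : (Fintype.card k : ℤ) * S ^ 2 = 0 := by linear_combination hSD - hD2 - hV0'
    rcases mul_eq_zero.mp this with h | h
    · linarith
    · exact pow_eq_zero_iff (two_ne_zero) |>.mp h
  rw [hS] at hN0 hN
  have hN0' : N 0 = V0 := by zify; linear_combination hN0
  refine ⟨hN0', fun u v hu => ?_⟩
  by_cases hv : v = 0
  · rw [hv, zero_mul, hN0', two_mul]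
  · have hu0 : u ≠ 0 := by rintro rfl; simp at hu
    zify
    rw [hN v hv, hN _ (mul_ne_zero hv hu0), map_mul, hu]
    ring

end Corank

/-! ### Descent of the corank counts from `k` to a subfield `F`. -/

section Tower

variable {F : Type*} [Field F] [Fintype F] [DecidableEq F] [Algebra F k] [Algebra F K]
  [IsScalarTower F k K]
variable (hκκ : ∀ x, κ (κ x) = x) (hc : ∀ x, τ (κ x) = κ (τ x))
  (hfix : ∀ x : K, τ x = x ↔ ∃ r : k, algebraMap k K r = x)
  (hκk : ∀ r : k, κ (algebraMap k K r) = algebraMap k K r)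
  (hκP : ∀ x, κ x = x ^ P) (hK : Fintype.card K = P ^ 2)
  (hK0 : (Finset.univ.filter fun x => κ x = x).card = P)
  (h2 : ringChar k ≠ 2)
  (hτF : ∀ r : F, τ (algebraMap F K r) = algebraMap F K r)
  (hκF : ∀ r : F, κ (algebraMap F K r) = algebraMap F K r)

include hκκ hc hfix hκk hκP hK hK0 h2 in
-- The form over F is the trace of the form over k. Multiplication by a nonsquare u of k reflects
-- each level size over k about its mean, so the zero counts over F average to the mean as well.
theorem levelCard_zero_add_of_corank_one {a b : K}
    (h : kasamiOp τ κ a b 1 = 0) (hκb : κ b = b) (hb : b ≠ 0) (htr : Algebra.trace k K b⁻¹ ≠ 0)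
    {u : k} (hu : quadraticChar k u = -1) :
    Fintype.card F * (levelCard (fun x => kasamiForm τ κ hτF hκF a b x x) 0 +
      levelCard (fun x => kasamiForm τ κ hτF hκF
        (algebraMap k K u * a) (algebraMap k K u * b) x x) 0) = 2 * Fintype.card K := by
  have hτk : ∀ r : k, τ (algebraMap k K r) = algebraMap k K r := fun r => (hfix _).mpr ⟨r, rfl⟩
  have hu0 : u ≠ 0 := by rintro rfl; simp at hu
  have hV0 : Fintype.card K = Fintype.card k * levelCard (Algebra.trace k K) 0 :=
    (card_trace_eq_zero (k := k)).symm
  obtain ⟨-, hN⟩ := levelCard_of_corank_one hκκ hc hfix hκk hκP hK hK0 h2 h hκb hb htr hτk hV0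
  set V0 := levelCard (Algebra.trace k K) 0
  have hform : ∀ a b x, kasamiForm τ κ hτF hκF a b x x =
      Algebra.trace F k (kasamiForm τ κ hτk hκk a b x x) := by
    intro a b x
    rw [kasamiForm_apply, kasamiForm_apply, Algebra.trace_trace]
  have hker : Fintype.card F * (Finset.univ.filter fun v : k => Algebra.trace F k v = 0).card =
      Fintype.card k := card_trace_eq_zero
  have hadd : levelCard (fun x => kasamiForm τ κ hτF hκF a b x x) 0 +
      levelCard (fun x => kasamiForm τ κ hτF hκF
        (algebraMap k K u * a) (algebraMap k K u * b) x x) 0 =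
      (Finset.univ.filter fun v : k => Algebra.trace F k v = 0).card * (2 * V0) := by
    simp only [hform, kasamiForm_smul_coeff]
    rw [levelCard_comp (fun x => kasamiForm τ κ hτk hκk a b x x) (Algebra.trace F k),
      levelCard_comp (fun x => u * kasamiForm τ κ hτk hκk a b x x) (Algebra.trace F k),
      ← Finset.sum_add_distrib, ← smul_eq_mul, ← Finset.sum_const]
    refine Finset.sum_congr rfl fun v _ => ?_
    rw [← hN u⁻¹ v (quadraticChar_inv_eq_neg_one hu)]
    congr 1
    unfold levelCard
    congr 1
    ext x
    simp only [Finset.mem_filter, Finset.mem_univ, true_and]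
    rw [eq_mul_inv_iff_mul_eq₀ hu0, mul_comm]
  rw [hadd, ← mul_assoc, hker, hV0]
  ring

include hκκ hc hfix hκk hκP hK hK0 h2 in
-- The zeros are |k| times those of the norm form on the hyperplane Tr(z) = 0. Its zeros on all of K
-- are known; off the hyperplane, translation by t/b preserves Tr(z), because Tr(1/b) = 0, and
-- changes the value by a surjective linear function of t. The values there are thus
-- equidistributed, and subtraction gives the result.
theorem levelCard_zero_of_corank_two {a b : K}
    (h : kasamiOp τ κ a b 1 = 0) (hκb : κ b = b) (hb : b ≠ 0) (htr : Algebra.trace k K b⁻¹ = 0) :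
    (Fintype.card F : ℤ) * levelCard (fun x => kasamiForm τ κ hτF hκF a b x x) 0 =
      P ^ 2 - (Fintype.card F - 1) * Fintype.card k * P := by
  have h20 : (2 : k) ≠ 0 := Ring.two_ne_zero h2
  have h2F : (2 : F) ≠ 0 := by
    intro h0
    apply h20
    rw [← map_ofNat (algebraMap F k) 2, h0, map_zero]
  have hnz := card_norm_zeros hκκ hκP hK hK0
    ((Algebra.trace F K).toAddMonoidHom.comp (AddMonoidHom.mulLeft b))
    (fun r => exists_fixed_trace_mul_eq hκF h2F hκκ hb hκb r)
  change Fintype.card F * ((Finset.univ.filter fun z =>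
    Algebra.trace F K (b * (z * κ z)) = 0).card + P) = _ at hnz
  have hN0 : levelCard (fun x => kasamiForm τ κ hτF hκF a b x x) 0 = Fintype.card k *
      (Finset.univ.filter fun z => Algebra.trace F K (b * (z * κ z)) = 0 ∧
        Algebra.trace k K z = 0).card := by
    have h1 := card_filter_addHom (twistedDiff τ (RingEquiv.refl K))
      (fun z => Algebra.trace F K (b * (z * κ z)) = 0)
    rw [levelCard_twistedDiff, card_fixed_eq hfix] at h1
    simp only [mem_image_twistedDiff_iff (κ := RingEquiv.refl K) hfix] at h1
    rw [← h1, levelCard]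
    congr 1
    ext x
    simp only [Finset.mem_filter, Finset.mem_univ, true_and]
    rw [kasamiForm_self_of_one hτF hκF hκκ hc h hκb, neg_eq_zero]
    rfl
  have hoff : Fintype.card F * (Finset.univ.filter fun z => Algebra.trace F K (b * (z * κ z)) = 0 ∧
        ¬Algebra.trace k K z = 0).card =
      (Finset.univ.filter fun z : K => ¬Algebra.trace k K z = 0).card := by
    -- The extra factor |k| allows an average over the translations by t/b; after exchanging sums
    -- each z off the hyperplane is hit by |k| / |F| values of t.
    apply Nat.eq_of_mul_eq_mul_left (Fintype.card_pos (α := k))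
    have hshift : ∀ (z : K) (t : k), Algebra.trace F K
        (b * ((z + algebraMap k K t * b⁻¹) * κ (z + algebraMap k K t * b⁻¹))) =
        Algebra.trace F K (b * (z * κ z)) + Algebra.trace F k (2 * Algebra.trace k K z * t) := by
      intro z t
      rw [← Algebra.trace_trace (S := k), trace_shift hκκ hκk hb hκb, htr, mul_zero, add_zero,
        map_add, Algebra.trace_trace]
      congr 2; ring
    have hin : ∀ z : K, Algebra.trace k K z ≠ 0 → Fintype.card F *
        (Finset.univ.filter fun t : k => Algebra.trace F K
          (b * ((z + algebraMap k K t * b⁻¹) * κ (z + algebraMap k K t * b⁻¹))) = 0).card =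
        Fintype.card k := by
      intro z hz
      have hne : 2 * Algebra.trace k K z ≠ 0 := mul_ne_zero h20 hz
      have := card_mul_levelCard_of_surjective
        ((Algebra.trace F k).toAddMonoidHom.comp (AddMonoidHom.mulLeft (2 * Algebra.trace k K z)))
        (fun r => by
          obtain ⟨x, hx⟩ := Algebra.trace_surjective F k r
          exact ⟨x / (2 * Algebra.trace k K z), by simpa [mul_div_cancel₀ _ hne] using hx⟩)
        (-Algebra.trace F K (b * (z * κ z)))
      rw [← this]
      congr 2
      ext t
      simp only [hshift, Finset.mem_filter, Finset.mem_univ, true_and]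
      rw [eq_neg_iff_add_eq_zero, add_comm]
      rfl
    have hout : ∀ t : k, (Finset.univ.filter fun z : K => Algebra.trace F K
          (b * ((z + algebraMap k K t * b⁻¹) * κ (z + algebraMap k K t * b⁻¹))) = 0 ∧
          ¬Algebra.trace k K z = 0).card =
        (Finset.univ.filter fun z => Algebra.trace F K (b * (z * κ z)) = 0 ∧
          ¬Algebra.trace k K z = 0).card := by
      intro t
      have hs : ∀ (t : k) (z : K), Algebra.trace k K (z + algebraMap k K t * b⁻¹) =
          Algebra.trace k K z := by
        intro t z
        rw [map_add, ← Algebra.smul_def, map_smul, htr, smul_zero, add_zero]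
      refine Finset.card_bij (fun z _ => z + algebraMap k K t * b⁻¹) ?_ ?_ ?_
      · intro z hz
        simpa [hs] using hz
      · intro z _ z' _ h; exact add_right_cancel h
      · intro z hz
        refine ⟨z - algebraMap k K t * b⁻¹, ?_, by ring⟩
        have e : z - algebraMap k K t * b⁻¹ + algebraMap k K t * b⁻¹ = z := by ring
        have e' := hs t (z - algebraMap k K t * b⁻¹)
        rw [e] at e'
        simpa [e, ← e'] using hz
    calc Fintype.card k * (Fintype.card F * _)
        = Fintype.card F * ∑ t : k, (Finset.univ.filter fun z : K => Algebra.trace F K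
          (b * ((z + algebraMap k K t * b⁻¹) * κ (z + algebraMap k K t * b⁻¹))) = 0 ∧
          ¬Algebra.trace k K z = 0).card := by
          simp only [hout, Finset.sum_const, Finset.card_univ, smul_eq_mul]; ring
      _ = ∑ z ∈ Finset.univ.filter (fun z : K => ¬Algebra.trace k K z = 0), Fintype.card F *
          (Finset.univ.filter fun t : k => Algebra.trace F K
          (b * ((z + algebraMap k K t * b⁻¹) * κ (z + algebraMap k K t * b⁻¹))) = 0).card := by
          rw [← Finset.mul_sum]
          congr 1
          simp only [Finset.card_filter]
          rw [Finset.sum_comm, Finset.sum_filter]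
          refine Finset.sum_congr rfl fun z _ => ?_
          split_ifs with hz
          · simp [hz]
          · simp [hz]
      _ = _ := by
          rw [Finset.sum_congr rfl fun z hz => hin z (Finset.mem_filter.mp hz).2,
            Finset.sum_const, smul_eq_mul, mul_comm]
  have hsplit := Finset.card_filter_add_card_filter_not
    (s := Finset.univ.filter fun z => Algebra.trace F K (b * (z * κ z)) = 0)
    (fun z => Algebra.trace k K z = 0)
  rw [Finset.filter_filter, Finset.filter_filter] at hsplit
  have hsplit2 := Finset.card_filter_add_card_filter_not
    (s := (Finset.univ : Finset K)) (fun z => Algebra.trace k K z = 0)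
  have hT := card_trace_eq_zero (k := k) (K := K)
  rw [Finset.card_univ, hK] at hsplit2
  rw [hK] at hT
  rw [hN0]
  zify at *
  linear_combination (Fintype.card k : ℤ) * Fintype.card F * hsplit + Fintype.card k * hnz -
    Fintype.card k * hoff - Fintype.card k * hsplit2 + hT

end Tower

end Degenerate

/-! ### The types of the forms -/

theorem ringEquiv_algebraMap_zmod {p : ℕ} [Fact p.Prime] {K : Type*} [Field K] [Algebra (ZMod p) K]
    (σ : K ≃+* K) (r : ZMod p) : σ (algebraMap (ZMod p) K r) = algebraMap (ZMod p) K r := by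
  rw [← ZMod.natCast_zmod_val r, map_natCast, map_natCast]

section Types

variable (p s : ℕ) [Fact p.Prime] {K : Type*} [Field K] [Algebra (ZMod p) K]
  [Fintype K] [DecidableEq K] (τ κ : K ≃+* K)

/-- The standing assumptions: `κ` is the involution `x ↦ x ^ p ^ s` of the field of order
`p ^ (2 s)`, and the automorphism `τ` commutes with `κ`. -/
structure KasamiSetting : Prop where
  ne_two : p ≠ 2
  pos : 0 < s
  invol : ∀ x, κ (κ x) = x
  comm : ∀ x, τ (κ x) = κ (τ x)
  apply_eq : ∀ x, κ x = x ^ p ^ s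
  card_eq : Fintype.card K = (p ^ s) ^ 2
  card_fixed : (Finset.univ.filter fun x => κ x = x).card = p ^ s

/-- The form `kasamiForm` over the prime field. -/
noncomputable def primeForm (θ : K × K) : LinearMap.BilinForm (ZMod p) K :=
  kasamiForm τ κ (ringEquiv_algebraMap_zmod τ) (ringEquiv_algebraMap_zmod κ) θ.1 θ.2

/-- The number of solutions of `B x x = t` for the form `B = primeForm p τ κ θ`. -/
noncomputable def formCount (θ : K × K) (t : ZMod p) : ℕ :=
  levelCard (fun x => primeForm p τ κ θ x x) t

variable {p s τ κ}

theorem primeForm_self_subst (h : KasamiSetting p s τ κ) (θ : K × K) (u x : K) :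
    primeForm p τ κ (θ.1 * (u * κ u), θ.2 * (u * τ (κ u))) x x =
      primeForm p τ κ θ (u * x) (u * x) :=
  kasamiForm_subst _ _ h.invol h.comm _ _ _ _ _

theorem formCount_subst (h : KasamiSetting p s τ κ) (θ : K × K) {u : K} (hu : u ≠ 0)
    (t : ZMod p) :
    formCount p τ κ (θ.1 * (u * κ u), θ.2 * (u * τ (κ u))) t = formCount p τ κ θ t := by
  unfold formCount
  simp only [primeForm_self_subst h]
  exact levelCard_comp_equiv (Equiv.mulLeft₀ u hu) (fun x => primeForm p τ κ θ x x) t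

namespace KasamiSetting

variable (h : KasamiSetting p s τ κ)
include h

theorem ringChar_zmod_ne_two : ringChar (ZMod p) ≠ 2 := by
  rw [ZMod.ringChar_zmod_n]; exact h.ne_two

theorem card_eq_mul : Fintype.card K = Fintype.card (ZMod p) * p ^ (2 * s - 1) := by
  rw [h.card_eq, ZMod.card, ← pow_succ', ← pow_mul, mul_comm s]
  congr 1
  have := h.pos
  omega

theorem exists_formCount {θ : K × K} (hθ : κ θ.1 = θ.1) :
    ∃ S D : ℤ, (formCount p τ κ θ 0 : ℤ) = p ^ (2 * s - 1) - (p - 1) * S ∧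
      (∀ t ≠ 0, (formCount p τ κ θ t : ℤ) = p ^ (2 * s - 1) + S + quadraticChar (ZMod p) t * D) ∧
      p * S ^ 2 + D ^ 2 = p ^ (2 * s - 1) * (kasamiKer τ κ θ.1 θ.2).card := by
  have h1 := exists_levelCard_eq h.ringChar_zmod_ne_two (primeForm p τ κ θ)
    (fun x y => kasamiForm_symm _ _ h.invol hθ _ _ _) h.card_eq_mul
  rw [ZMod.card, primeForm, card_radical_kasamiForm] at h1
  exact_mod_cast h1

/-- The right side of the quadratic equation is p^(2s-1+2j), an odd power, so only S survives, with
absolute value p^(s-1+j). The sign ε is opposite to that of S. -/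
theorem formCount_of_even {θ : K × K} (hθ : κ θ.1 = θ.1) {j : ℕ}
    (hj : (kasamiKer τ κ θ.1 θ.2).card = p ^ (2 * j)) :
    ∃ ε : ℤ, (ε = 1 ∨ ε = -1) ∧
      (formCount p τ κ θ 0 : ℤ) = p ^ (2 * s - 1) + ε * ((p - 1) * p ^ (s - 1 + j)) ∧
      ∀ t ≠ 0, (formCount p τ κ θ t : ℤ) = p ^ (2 * s - 1) - ε * p ^ (s - 1 + j) := by
  obtain ⟨S, D, h0, ht, hSD⟩ := h.exists_formCount hθ
  rw [hj, Nat.cast_pow, ← pow_add] at hSD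
  have hs := h.pos
  rcases prime_mul_sq_add_sq_eq_pow Fact.out h.ne_two _ S D hSD with
    ⟨i, hi, -, -⟩ | ⟨i, hi, rfl, hS⟩
  · omega
  · obtain rfl : i = s - 1 + j := by omega
    rcases Int.natAbs_eq S with hS' | hS' <;> rw [hS, Nat.cast_pow] at hS'
    · exact ⟨-1, Or.inr rfl, by rw [h0, hS']; ring, fun t h => by rw [ht t h, hS']; ring⟩
    · exact ⟨1, Or.inl rfl, by rw [h0, hS']; ring, fun t h => by rw [ht t h, hS']; ring⟩

/-- Here the right side is the even power p^(2s+2j), so S = 0 and only the quadratic character term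
remains. -/
theorem formCount_of_odd {θ : K × K} (hθ : κ θ.1 = θ.1) {j : ℕ}
    (hj : (kasamiKer τ κ θ.1 θ.2).card = p ^ (2 * j + 1)) :
    ∃ D : ℤ, D.natAbs = p ^ (s + j) ∧ (formCount p τ κ θ 0 : ℤ) = p ^ (2 * s - 1) ∧
      ∀ t ≠ 0, (formCount p τ κ θ t : ℤ) = p ^ (2 * s - 1) + quadraticChar (ZMod p) t * D := by
  obtain ⟨S, D, h0, ht, hSD⟩ := h.exists_formCount hθ
  rw [hj, Nat.cast_pow, ← pow_add] at hSD
  have hs := h.pos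
  rcases prime_mul_sq_add_sq_eq_pow Fact.out h.ne_two _ S D hSD with
    ⟨i, hi, rfl, hD⟩ | ⟨i, hi, -, -⟩
  · obtain rfl : i = s + j := by omega
    exact ⟨D, hD, by rw [h0]; ring, fun t h => by rw [ht t h]; ring⟩
  · omega

theorem card_coeffPairs : (coeffPairs κ).card = (p ^ s) ^ 3 := by
  have : coeffPairs κ = (Finset.univ.filter fun x => κ x = x) ×ˢ Finset.univ := by
    ext θ; simp [coeffPairs]
  rw [this, Finset.card_product, h.card_fixed, Finset.card_univ, h.card_eq]
  ring

theorem primeForm_self (θ : K × K) (x : K) : primeForm p τ κ θ x x =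
    Algebra.trace (ZMod p) K (θ.1 * (x * κ x)) +
      Algebra.trace (ZMod p) K (2 * (x * τ (κ x)) * θ.2) := by
  rw [primeForm, kasamiForm_self _ _ h.invol, map_add]
  congr 2; ring

theorem two_ne_zero' : (2 : K) ≠ 0 := by
  rw [← map_ofNat (algebraMap (ZMod p) K) 2, Ne, map_eq_zero]
  exact Ring.two_ne_zero h.ringChar_zmod_ne_two

/-- Exchange the sums. For x ≠ 0 and fixed a, the value B(x, x) is a surjective affine function of
b, so one pair in p vanishes at x; at x = 0 all pairs do. -/
theorem sum_formCount_zero :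
    p * ∑ θ ∈ coeffPairs κ, formCount p τ κ θ 0 =
      p * (p ^ s) ^ 3 + ((p ^ s) ^ 2 - 1) * (p ^ s) ^ 3 := by
  have h1 : ∀ x ∈ Finset.univ.erase (0 : K),
      p * ((coeffPairs κ).filter fun θ => primeForm p τ κ θ x x = 0).card = (p ^ s) ^ 3 := by
    intro x hx
    have hx0 := Finset.ne_of_mem_erase hx
    have hx1 : 2 * (x * τ (κ x)) ≠ 0 :=
      mul_ne_zero h.two_ne_zero' (mul_ne_zero hx0 (by simpa using hx0))
    have h2 : ∀ a : K, p * (Finset.univ.filter fun b : K =>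
        primeForm p τ κ (a, b) x x = 0).card = (p ^ s) ^ 2 := by
      intro a
      have := card_mul_levelCard_of_surjective ((Algebra.trace (ZMod p) K).toAddMonoidHom.comp
        (AddMonoidHom.mulLeft (2 * (x * τ (κ x))))) (fun r => by
          obtain ⟨y, hy⟩ := Algebra.trace_surjective (ZMod p) K r
          exact ⟨y / (2 * (x * τ (κ x))), by simpa [mul_div_cancel₀ _ hx1] using hy⟩)
        (-Algebra.trace (ZMod p) K (a * (x * κ x)))
      rw [ZMod.card, h.card_eq] at this
      rw [← this, levelCard]
      congr 2
      ext b
      simp only [Finset.mem_filter, Finset.mem_univ, true_and, h.primeForm_self]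
      rw [eq_neg_iff_add_eq_zero, add_comm]
      rfl
    have h3 : coeffPairs κ = (Finset.univ.filter fun x => κ x = x) ×ˢ Finset.univ := by
      ext θ; simp [coeffPairs]
    rw [Finset.card_filter, h3, Finset.sum_product, Finset.mul_sum]
    simp only [← Finset.card_filter, h2]
    rw [Finset.sum_const, h.card_fixed, smul_eq_mul]
    ring
  have h4 : ∑ θ ∈ coeffPairs κ, formCount p τ κ θ 0 =
      ∑ x : K, ((coeffPairs κ).filter fun θ => primeForm p τ κ θ x x = 0).card := by
    simp only [formCount, levelCard, Finset.card_filter]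
    rw [Finset.sum_comm]
  have h5 : ((coeffPairs κ).filter fun θ => primeForm p τ κ θ 0 0 = 0).card = (p ^ s) ^ 3 := by
    rw [← h.card_coeffPairs]; simp
  rw [h4, ← Finset.add_sum_erase _ _ (Finset.mem_univ (0 : K)), h5, mul_add, Finset.mul_sum,
    Finset.sum_congr rfl h1, Finset.sum_const, Finset.card_erase_of_mem (Finset.mem_univ _),
    Finset.card_univ, h.card_eq, smul_eq_mul]

theorem card_kasamiKer_zero : (kasamiKer τ κ 0 0).card = (p ^ s) ^ 2 := by
  rw [← h.card_eq, ← Finset.card_univ]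
  congr 1
  ext x
  simp [mem_kasamiKer, kasamiOp_zero_coeff]

theorem formCount_zero_zero : formCount p τ κ 0 0 = (p ^ s) ^ 2 := by
  rw [← h.card_eq, formCount, levelCard, ← Finset.card_univ]
  congr 1
  ext x
  simp [h.primeForm_self]

theorem zero_mem_coeffPairs : (0 : K × K) ∈ coeffPairs κ := by simp [coeffPairs]

theorem sum_coeffPairs (f : K × K → ℚ) :
    ∑ θ ∈ coeffPairs κ, f θ = f 0 + ∑ θ ∈ (coeffPairs κ).erase 0, f θ :=
  (Finset.add_sum_erase _ _ h.zero_mem_coeffPairs).symm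

theorem card_coeffPairs_erase : (((coeffPairs κ).erase 0).card : ℚ) = ((p : ℚ) ^ s) ^ 3 - 1 := by
  rw [Finset.card_erase_of_mem h.zero_mem_coeffPairs, h.card_coeffPairs, Nat.cast_sub]
  · push_cast; rfl
  · exact Nat.one_le_iff_ne_zero.mpr (pow_ne_zero _ (pow_ne_zero _ (Fact.out : p.Prime).ne_zero))

/-- The first moment of the deviations, used as a linear equation for the frequencies of the types.
-/
theorem sum_formCount_erase :
    ∑ θ ∈ (coeffPairs κ).erase 0, ((formCount p τ κ θ 0 : ℚ) - (p : ℚ) ^ (2 * s - 1)) =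
      (p - 1) * p ^ (s - 1) * ((p : ℚ) ^ s) * (p ^ s - 1) := by
  have hp : (p : ℚ) ≠ 0 := by exact_mod_cast (Fact.out : p.Prime).ne_zero
  have hs := h.pos
  have h1 := h.sum_formCount_zero
  rw [← Finset.add_sum_erase _ _ h.zero_mem_coeffPairs, h.formCount_zero_zero] at h1
  have hp1 : 1 ≤ (p ^ s) ^ 2 :=
    Nat.one_le_iff_ne_zero.mpr (pow_ne_zero _ (pow_ne_zero _ (Fact.out : p.Prime).ne_zero))
  have h2 := congrArg (Nat.cast (R := ℚ)) h1
  push_cast [Nat.cast_sub hp1] at h2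
  have e1 : (p : ℚ) ^ (2 * s - 1) * p = (p ^ s) ^ 2 := by
    rw [← pow_succ, ← pow_mul]; congr 1; omega
  have e2 : (p : ℚ) ^ (s - 1) * p = p ^ s := by
    rw [← pow_succ]; congr 1; omega
  rw [Finset.sum_sub_distrib, Finset.sum_const, nsmul_eq_mul, h.card_coeffPairs_erase]
  apply mul_left_cancel₀ hp
  linear_combination h2 - (((p : ℚ) ^ s) ^ 3 - 1) * e1 - (p - 1) * p ^ s * (p ^ s - 1) * e2

end KasamiSetting

end Types

/-! ### The distribution of the types -/

theorem sum_eq_card_filter_mul_add {ι : Type*} (C : Finset ι) (pr : ι → Prop) [DecidablePred pr]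
    (F : ι → ℚ) (c : ℚ) (h : ∀ i ∈ C, pr i → F i = c) :
    ∑ i ∈ C, F i = ((C.filter pr).card : ℚ) * c + ∑ i ∈ C.filter (fun i => ¬pr i), F i := by
  rw [← Finset.sum_filter_add_sum_filter_not C pr, ← nsmul_eq_mul, ← Finset.sum_const]
  congr 1
  refine Finset.sum_congr rfl fun i hi => ?_
  rw [Finset.mem_filter] at hi
  exact h i hi.1 hi.2

section CaseOne

variable {p s d : ℕ} [Fact p.Prime] {K : Type*} [Field K] [Algebra (ZMod p) K]
  [Fintype K] [DecidableEq K] {τ κ : K ≃+* K}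
  {k : Type*} [Field k] [Fintype k] [DecidableEq k] [Algebra k K] [Algebra (ZMod p) k]
  [IsScalarTower (ZMod p) k K]

namespace KasamiSetting

variable (h : KasamiSetting p s τ κ)
include h

theorem ringChar_ne_two {k : Type*} [Field k] [Algebra (ZMod p) k] : ringChar k ≠ 2 := by
  have := Algebra.ringChar_eq (ZMod p) k
  rw [← this]
  exact h.ringChar_zmod_ne_two

theorem prime_pow_ne_one {n : ℕ} (hn : 0 < n) : p ^ n ≠ 1 :=
  (Nat.one_lt_pow hn.ne' (Fact.out : p.Prime).one_lt).ne'

section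

variable (hd : 0 < d) (hds : d < s)
  (hfix : ∀ x : K, τ x = x ↔ ∃ r : k, algebraMap k K r = x)
  (hκk : ∀ r : k, κ (algebraMap k K r) = algebraMap k K r)
  (hk : Fintype.card k = p ^ d)
include hfix hκk

/-- The difference κ(b) - b is fixed by `τ`, hence lies in k and is fixed by `κ`; but `κ` also
negates it, so it is zero in odd characteristic. -/
theorem mem_coeffPairs_and_op_one_iff (θ : K × K) :
    (θ ∈ coeffPairs κ ∧ kasamiOp τ κ θ.1 θ.2 1 = 0) ↔
      κ θ.2 = θ.2 ∧ θ.1 = -θ.2 - κ (τ.symm θ.2) := by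
  rw [← kasamiOp_one_eq_zero_iff (τ := τ) (κ := κ)]
  simp only [coeffPairs, Finset.mem_filter, Finset.mem_univ, true_and]
  constructor
  · rintro ⟨h1, h2⟩
    refine ⟨?_, h2⟩
    rw [conj_sub_fixed_iff h.invol h.comm h2, hfix] at h1
    obtain ⟨r, hr⟩ := h1
    have h3 := hκk r
    rw [hr, map_sub, h.invol] at h3
    have h4 : 2 * (κ θ.2 - θ.2) = 0 := by linear_combination -h3
    exact sub_eq_zero.mp ((mul_eq_zero.mp h4).resolve_left h.two_ne_zero')
  · rintro ⟨h1, h2⟩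
    refine ⟨?_, h2⟩
    rw [conj_sub_fixed_iff h.invol h.comm h2, h1, sub_self, map_zero]

include hk in
theorem card_kasamiKer_eq {a b : K} (h1 : kasamiOp τ κ a b 1 = 0) (hκb : κ b = b) (hb : b ≠ 0) :
    (kasamiKer τ κ a b).card = if Algebra.trace k K b⁻¹ = 0 then p ^ (2 * d) else p ^ d := by
  rw [card_kasamiKer_of_trace h.invol h.comm hfix h1 hκb hb, hk, ← pow_mul, mul_comm 2]

include hk hd hds in
-- Normalised forms are parametrised by y = 1/b with κ(y) = y, and the corank reads off whether
-- Tr(y) vanishes. The predicate T is either "zero" or "nonzero", which is what `hT` says, so one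
-- argument serves both coranks.
theorem card_filter_corank_op_one (T : k → Prop) [DecidablePred T] {N : ℕ}
    (hN : N = if T 0 then p ^ (2 * d) else p ^ d)
    (hT : ∀ t, T t ↔ (t = 0 ↔ T 0)) :
    (((coeffPairs κ).filter fun θ => (kasamiKer τ κ θ.1 θ.2).card = N).filter
      fun θ => kasamiOp τ κ θ.1 θ.2 1 = 0).card =
    (Finset.univ.filter fun y : K => (κ y = y ∧ y ≠ 0) ∧ T (Algebra.trace k K y)).card := by
  have hp := (Fact.out : p.Prime)
  have hne : p ^ (2 * d) ≠ p ^ d := fun h => by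
    have := Nat.pow_right_injective hp.two_le h
    omega
  refine Finset.card_bij (fun θ _ => θ.2⁻¹) ?_ ?_ ?_
  · intro θ hθ
    simp only [Finset.mem_filter] at hθ
    have h1 := (h.mem_coeffPairs_and_op_one_iff hfix hκk θ).mp ⟨hθ.1.1, hθ.2⟩
    have hb : θ.2 ≠ 0 := by
      intro hb
      have : θ = 0 := by ext <;> simp [h1.2, hb]
      rw [this] at hθ
      have := hθ.1.2
      rw [Prod.fst_zero, Prod.snd_zero, h.card_kasamiKer_zero, hN, ← pow_mul] at this
      split_ifs at this <;> have := Nat.pow_right_injective hp.two_le this <;> omega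
    have h2 := h.card_kasamiKer_eq hfix hκk hk hθ.2 h1.1 hb
    rw [hθ.1.2, hN] at h2
    simp only [Finset.mem_filter, Finset.mem_univ, true_and, map_inv₀, h1.1]
    refine ⟨inv_ne_zero hb, (hT _).mpr ?_⟩
    split_ifs at h2 with h3 h4 h4
    · simp [h3, h4]
    · exact absurd h2 hne
    · exact absurd h2.symm hne
    · simp [h3, h4]
  · intro θ hθ θ' hθ' e
    simp only [Finset.mem_filter] at hθ hθ'
    have h1 := (h.mem_coeffPairs_and_op_one_iff hfix hκk θ).mp ⟨hθ.1.1, hθ.2⟩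
    have h2 := (h.mem_coeffPairs_and_op_one_iff hfix hκk θ').mp ⟨hθ'.1.1, hθ'.2⟩
    have e' := inv_injective e
    exact Prod.ext (by rw [h1.2, h2.2, e']) e'
  · intro y hy
    simp only [Finset.mem_filter, Finset.mem_univ, true_and] at hy
    have h1 := (h.mem_coeffPairs_and_op_one_iff hfix hκk
      (-y⁻¹ - κ (τ.symm y⁻¹), y⁻¹)).mpr ⟨by rw [map_inv₀, hy.1.1], rfl⟩
    refine ⟨(-y⁻¹ - κ (τ.symm y⁻¹), y⁻¹), ?_, inv_inv y⟩
    simp only [Finset.mem_filter]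
    refine ⟨⟨h1.1, ?_⟩, h1.2⟩
    rw [h.card_kasamiKer_eq hfix hκk hk h1.2 (by rw [map_inv₀, hy.1.1]) (inv_ne_zero hy.1.2), hN,
      inv_inv]
    have := (hT _).mp hy.2
    congr 1
    exact propext this

include hk in
theorem card_fixed_trace_zero :
    p ^ d * (Finset.univ.filter fun y : K => κ y = y ∧ Algebra.trace k K y = 0).card = p ^ s := by
  rw [← hk]
  refine card_fixed_filter h.card_fixed (Algebra.trace k K).toAddMonoidHom fun r => ?_
  obtain ⟨y, hy, hr⟩ := exists_fixed_trace_mul_eq hκk (Ring.two_ne_zero h.ringChar_ne_two) h.invol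
    one_ne_zero (map_one κ) r
  exact ⟨y, hy, by simpa using hr⟩

omit hfix hκk in
theorem card_kasamiKer_subst_iff (N : ℕ) (a b u : K) (hu : u ≠ 0) :
    (kasamiKer τ κ (a * (u * κ u)) (b * (u * τ (κ u)))).card = N ↔ (kasamiKer τ κ a b).card = N := by
  rw [card_kasamiKer_subst h.invol h.comm a b hu]

omit hfix hκk in
theorem card_filter_card_kasamiKer_mul (N : ℕ) :
    ((coeffPairs κ).filter fun θ => (kasamiKer τ κ θ.1 θ.2).card = N).card * (N - 1) =
      ((p ^ s) ^ 2 - 1) *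
      (((coeffPairs κ).filter fun θ => (kasamiKer τ κ θ.1 θ.2).card = N).filter
      fun θ => kasamiOp τ κ θ.1 θ.2 1 = 0).card := by
  have := sum_card_kasamiKer_sub_one h.invol h.comm
    (fun θ => (kasamiKer τ κ θ.1 θ.2).card = N) (h.card_kasamiKer_subst_iff N)
  rw [h.card_eq] at this
  rw [← this, ← smul_eq_mul, ← Finset.sum_const]
  refine Finset.sum_congr rfl fun θ hθ => ?_
  rw [(Finset.mem_filter.mp hθ).2]

include hk hd hds in
-- The normalised forms of corank two correspond to the nonzero `κ`-fixed elements of trace zero,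
-- P/D - 1 in number.
theorem card_corank_two :
    (((coeffPairs κ).filter fun θ => (kasamiKer τ κ θ.1 θ.2).card = p ^ (2 * d)).card : ℚ) *
      (((p : ℚ) ^ d) ^ 2 - 1) * p ^ d = ((p ^ s) ^ 2 - 1) * (p ^ s - p ^ d) := by
  have h1 := h.card_filter_card_kasamiKer_mul (p ^ (2 * d))
  rw [h.card_filter_corank_op_one hd hds hfix hκk hk (fun t => t = 0) (by simp) (by simp)] at h1
  have h2 := h.card_fixed_trace_zero hfix hκk hk
  have h3 : (Finset.univ.filter fun y : K => (κ y = y ∧ y ≠ 0) ∧ Algebra.trace k K y = 0) =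
      (Finset.univ.filter fun y : K => κ y = y ∧ Algebra.trace k K y = 0).erase 0 := by
    ext y
    simp only [Finset.mem_filter, Finset.mem_univ, true_and, Finset.mem_erase]
    tauto
  rw [h3, Finset.card_erase_of_mem (by simp)] at h1
  have hpos : 1 ≤ (Finset.univ.filter fun y : K => κ y = y ∧ Algebra.trace k K y = 0).card :=
    Finset.card_pos.mpr ⟨0, by simp⟩
  have hp := (Fact.out : p.Prime)
  have hp1 : ∀ n, 1 ≤ p ^ n := fun n => Nat.one_le_pow _ _ hp.pos
  have h1' := congrArg (Nat.cast (R := ℚ)) h1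
  have h2' := congrArg (Nat.cast (R := ℚ)) h2
  push_cast [Nat.cast_sub hpos, Nat.cast_sub (hp1 _), Nat.cast_sub (Nat.one_le_pow 2 _ (hp1 s))]
    at h1' h2'
  have e : (p : ℚ) ^ (2 * d) = (p ^ d) ^ 2 := by rw [← pow_mul, mul_comm]
  rw [e] at h1'
  linear_combination (p : ℚ) ^ d * h1' + (((p : ℚ) ^ s) ^ 2 - 1) * h2'

include hk hd hds in
-- Now the `κ`-fixed elements of nonzero trace count, P - P/D of them; the factor D - 1 cancels
-- against the order of the radical minus one.
theorem card_corank_one :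
    (((coeffPairs κ).filter fun θ => (kasamiKer τ κ θ.1 θ.2).card = p ^ d).card : ℚ) * p ^ d =
      ((p ^ s) ^ 2 - 1) * p ^ s := by
  have h1 := h.card_filter_card_kasamiKer_mul (p ^ d)
  rw [h.card_filter_corank_op_one hd hds hfix hκk hk (fun t => t ≠ 0) (by simp) (by simp)] at h1
  have h2 := h.card_fixed_trace_zero hfix hκk hk
  have h3 := Finset.card_filter_add_card_filter_not (s := Finset.univ.filter fun y : K => κ y = y)
    (fun y => Algebra.trace k K y = 0)
  rw [Finset.filter_filter, Finset.filter_filter, h.card_fixed] at h3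
  have h4 : (Finset.univ.filter fun y : K => (κ y = y ∧ y ≠ 0) ∧ Algebra.trace k K y ≠ 0) =
      Finset.univ.filter fun y : K => κ y = y ∧ ¬Algebra.trace k K y = 0 := by
    ext y
    simp only [Finset.mem_filter, Finset.mem_univ, true_and]
    constructor
    · tauto
    · rintro ⟨h1, h2⟩
      exact ⟨⟨h1, by rintro rfl; simp at h2⟩, h2⟩
  rw [h4] at h1
  have hp := (Fact.out : p.Prime)
  have hp1 : ∀ n, 1 ≤ p ^ n := fun n => Nat.one_le_pow _ _ hp.pos
  have h1' := congrArg (Nat.cast (R := ℚ)) h1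
  have h2' := congrArg (Nat.cast (R := ℚ)) h2
  have h3' := congrArg (Nat.cast (R := ℚ)) h3
  push_cast [Nat.cast_sub (hp1 _), Nat.cast_sub (Nat.one_le_pow 2 _ (hp1 s))] at h1' h2' h3'
  have hne : (p : ℚ) ^ d - 1 ≠ 0 := by
    rw [sub_ne_zero]
    exact_mod_cast h.prime_pow_ne_one hd
  apply mul_left_cancel₀ hne
  linear_combination (p : ℚ) ^ d * h1' + (((p : ℚ) ^ s) ^ 2 - 1) * (p ^ d * h3' - h2')

omit hfix hκk in
theorem exists_subst_op_one {θ : K × K} (hθ : κ θ.1 = θ.1)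
    (hne : (kasamiKer τ κ θ.1 θ.2).card ≠ 1) :
    ∃ u : K, u ≠ 0 ∧ (θ.1 * (u * κ u), θ.2 * (u * τ (κ u))) ∈ coeffPairs κ ∧
      kasamiOp τ κ (θ.1 * (u * κ u)) (θ.2 * (u * τ (κ u))) 1 = 0 := by
  have : ∃ u ∈ kasamiKer τ κ θ.1 θ.2, u ≠ 0 := by
    by_contra! hcon
    exact hne (Finset.card_eq_one.mpr ⟨0, Finset.eq_singleton_iff_unique_mem.mpr
      ⟨mem_kasamiKer.mpr (by simp), hcon⟩⟩)
  obtain ⟨u, hu, hu0⟩ := this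
  refine ⟨u, hu0, ?_, ?_⟩
  · simp only [coeffPairs, Finset.mem_filter, Finset.mem_univ, true_and, map_mul, hθ, h.invol]
    ring
  · rw [kasamiOp_subst h.invol h.comm, mul_one, mem_kasamiKer.mp hu, mul_zero]

omit hfix hκk in
theorem card_kasamiKer_eq_or {q : ℕ} (hq : (Finset.univ.filter fun x => τ x = x).card = q)
    {θ : K × K} (hθ0 : θ ≠ 0) :
    (kasamiKer τ κ θ.1 θ.2).card = 1 ∨ (kasamiKer τ κ θ.1 θ.2).card = q ∨
      (kasamiKer τ κ θ.1 θ.2).card = q ^ 2 := by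
  rw [← hq]
  refine _root_.card_kasamiKer_eq_or h.invol h.comm fun h => hθ0 ?_
  exact Prod.ext h.1 h.2

include hk hd hds in
theorem formCount_corank_two {θ : K × K} (hθ : κ θ.1 = θ.1)
    (hR : (kasamiKer τ κ θ.1 θ.2).card = p ^ (2 * d)) :
    (formCount p τ κ θ 0 : ℤ) = p ^ (2 * s - 1) - (p - 1) * p ^ (s - 1 + d) := by
  have hp := (Fact.out : p.Prime)
  obtain ⟨u, hu, h1, h2⟩ := h.exists_subst_op_one hθ
    (by rw [hR]; exact h.prime_pow_ne_one (by omega))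
  rw [← formCount_subst h θ hu]
  set θ' := (θ.1 * (u * κ u), θ.2 * (u * τ (κ u))) with hθ'
  have hR' : (kasamiKer τ κ θ'.1 θ'.2).card = p ^ (2 * d) := by
    rw [← hR]; exact card_kasamiKer_subst h.invol h.comm _ _ hu
  have h3 := (h.mem_coeffPairs_and_op_one_iff hfix hκk θ').mp ⟨h1, h2⟩
  -- With b = 0 the normalised form would be zero, whose kernel is all of K and too large.
  have hb : θ'.2 ≠ 0 := by
    intro hb
    have : θ' = 0 := by ext <;> simp [h3.2, hb]
    rw [this] at hR'
    rw [Prod.fst_zero, Prod.snd_zero, h.card_kasamiKer_zero, ← pow_mul] at hR'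
    have := Nat.pow_right_injective hp.two_le hR'
    omega
  have h4 := h.card_kasamiKer_eq hfix hκk hk h2 h3.1 hb
  have ht : Algebra.trace k K θ'.2⁻¹ = 0 := by
    by_contra ht
    rw [if_neg ht] at h4
    have := Nat.pow_right_injective hp.two_le (hR'.symm.trans h4)
    omega
  have h5 := levelCard_zero_of_corank_two h.invol h.comm hfix hκk h.apply_eq h.card_eq h.card_fixed
    h.ringChar_ne_two (ringEquiv_algebraMap_zmod (p := p) τ) (ringEquiv_algebraMap_zmod κ)
    h2 h3.1 hb ht
  rw [ZMod.card, hk] at h5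
  have hp0 : (p : ℤ) ≠ 0 := by exact_mod_cast hp.ne_zero
  apply mul_left_cancel₀ hp0
  refine h5.trans ?_
  have e1 : (p : ℤ) * p ^ (2 * s - 1) = (p ^ s) ^ 2 := by
    rw [← pow_succ', ← pow_mul]; congr 1; omega
  have e2 : (p : ℤ) * p ^ (s - 1 + d) = p ^ s * p ^ d := by
    rw [← pow_succ', ← pow_add]; congr 1; omega
  push_cast
  linear_combination (p - 1 : ℤ) * e2 - e1

include hk hd hds in
theorem formCount_add_corank_one {θ : K × K} (hθ : κ θ.1 = θ.1)
    (hR : (kasamiKer τ κ θ.1 θ.2).card = p ^ d) {u : k} (hu : quadraticChar k u = -1) :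
    (formCount p τ κ θ 0 : ℤ) +
      formCount p τ κ (algebraMap k K u * θ.1, algebraMap k K u * θ.2) 0 =
        2 * p ^ (2 * s - 1) := by
  have hp := (Fact.out : p.Prime)
  obtain ⟨v, hv, h1, h2⟩ := h.exists_subst_op_one hθ
    (by rw [hR]; exact h.prime_pow_ne_one (by omega))
  -- The same v normalises the form and its multiple by u, because substitution commutes with
  -- scaling.
  rw [← formCount_subst h θ hv,
    ← formCount_subst h (algebraMap k K u * θ.1, algebraMap k K u * θ.2) hv]
  dsimp only
  rw [mul_assoc, mul_assoc]
  set θ' := (θ.1 * (v * κ v), θ.2 * (v * τ (κ v))) with hθ'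
  have hR' : (kasamiKer τ κ θ'.1 θ'.2).card = p ^ d := by
    rw [← hR]; exact card_kasamiKer_subst h.invol h.comm _ _ hv
  have h3 := (h.mem_coeffPairs_and_op_one_iff hfix hκk θ').mp ⟨h1, h2⟩
  have hb : θ'.2 ≠ 0 := by
    intro hb
    have : θ' = 0 := by ext <;> simp [h3.2, hb]
    rw [this] at hR'
    rw [Prod.fst_zero, Prod.snd_zero, h.card_kasamiKer_zero, ← pow_mul] at hR'
    have := Nat.pow_right_injective hp.two_le hR'
    omega
  have h4 := h.card_kasamiKer_eq hfix hκk hk h2 h3.1 hb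
  have ht : Algebra.trace k K θ'.2⁻¹ ≠ 0 := by
    intro ht
    rw [if_pos ht] at h4
    have := Nat.pow_right_injective hp.two_le (hR'.symm.trans h4)
    omega
  have h5 := levelCard_zero_add_of_corank_one h.invol h.comm hfix hκk h.apply_eq h.card_eq
    h.card_fixed h.ringChar_ne_two (ringEquiv_algebraMap_zmod (p := p) τ)
    (ringEquiv_algebraMap_zmod κ) h2 h3.1 hb ht hu
  rw [h.card_eq_mul, ZMod.card] at h5
  have hp0 : (p : ℤ) ≠ 0 := by exact_mod_cast hp.ne_zero
  apply mul_left_cancel₀ hp0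
  have h6 := congrArg (Nat.cast (R := ℤ)) h5
  push_cast at h6
  refine h6.trans ?_
  ring

end

end KasamiSetting

end CaseOne

/-- The n-th roots of unity act freely on S, and their orbits are the fibres of x ↦ x^n. -/
theorem dvd_card_of_mul_invariant {K : Type*} [Field K] [DecidableEq K] [Fintype K] {n : ℕ}
    (hn : 0 < n) (hU : (Finset.univ.filter fun u : K => u ^ n = 1).card = n) (S : Finset K)
    (h0 : (0 : K) ∉ S) (hS : ∀ u x : K, u ^ n = 1 → x ∈ S → u * x ∈ S) : n ∣ S.card := by
  rw [Finset.card_eq_sum_card_image (fun x => x ^ n) S]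
  refine Finset.dvd_sum fun y hy => ?_
  obtain ⟨x, hx, rfl⟩ := Finset.mem_image.mp hy
  have hx0 : x ≠ 0 := fun h => h0 (h ▸ hx)
  have : (S.filter fun a => a ^ n = x ^ n).card = n := by
    refine Eq.trans (Eq.symm ?_) hU
    refine Finset.card_bij (fun u _ => u * x) ?_ ?_ ?_
    · intro u hu
      simp only [Finset.mem_filter, Finset.mem_univ, true_and] at hu ⊢
      exact ⟨hS u x hu hx, by rw [mul_pow, hu, one_mul]⟩
    · intro u _ v _ h; exact mul_right_cancel₀ hx0 h
    · intro z hz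
      simp only [Finset.mem_filter, Finset.mem_univ, true_and] at hz ⊢
      exact ⟨z / x, by rw [div_pow, hz.2, div_self (pow_ne_zero _ hx0)], by field_simp⟩
  rw [this]

section Distribution

variable {p s d : ℕ} [Fact p.Prime] {K : Type*} [Field K] [Algebra (ZMod p) K]
  [Fintype K] [DecidableEq K] {τ κ : K ≃+* K}

namespace KasamiSetting

variable (h : KasamiSetting p s τ κ)
include h

theorem filter_erase_zero {N : ℕ} (hN : N ≠ (p ^ s) ^ 2) :
    ((coeffPairs κ).erase 0).filter (fun θ => (kasamiKer τ κ θ.1 θ.2).card = N) =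
      (coeffPairs κ).filter fun θ => (kasamiKer τ κ θ.1 θ.2).card = N := by
  ext θ
  simp only [Finset.mem_filter, Finset.mem_erase]
  constructor
  · rintro ⟨⟨_, h1⟩, h2⟩; exact ⟨h1, h2⟩
  · rintro ⟨h1, h2⟩
    refine ⟨⟨?_, h1⟩, h2⟩
    rintro rfl
    rw [Prod.fst_zero, Prod.snd_zero, h.card_kasamiKer_zero] at h2
    exact hN h2.symm

/-- The sum of a function of the type over the nonzero pairs of coefficients, split by the order
of the radical, where the pairs with trivial radical are split further. -/
theorem sum_split {q : ℕ} (hq : (Finset.univ.filter fun x => τ x = x).card = q) (hq1 : 1 < q)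
    (hqP : q ^ 2 < (p ^ s) ^ 2) :
    ∃ n₁ n₂ : ℕ,
    ∀ g : ℕ → ℤ → ℚ,
      ∑ θ ∈ (coeffPairs κ).erase 0, g (kasamiKer τ κ θ.1 θ.2).card (formCount p τ κ θ 0) =
        n₁ * g 1 (p ^ (2 * s - 1) + (p - 1) * p ^ (s - 1)) +
        n₂ * g 1 (p ^ (2 * s - 1) - (p - 1) * p ^ (s - 1)) +
        ∑ θ ∈ (coeffPairs κ).filter (fun θ => (kasamiKer τ κ θ.1 θ.2).card = q),
          g q (formCount p τ κ θ 0) +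
        ∑ θ ∈ (coeffPairs κ).filter (fun θ => (kasamiKer τ κ θ.1 θ.2).card = q ^ 2),
          g (q ^ 2) (formCount p τ κ θ 0) := by
  set C := (coeffPairs κ).erase 0 with hC
  have hqq : q < q ^ 2 := by nlinarith
  have hC' : ∀ θ ∈ C, κ θ.1 = θ.1 ∧ ((kasamiKer τ κ θ.1 θ.2).card = 1 ∨
      (kasamiKer τ κ θ.1 θ.2).card = q ∨ (kasamiKer τ κ θ.1 θ.2).card = q ^ 2) := by
    intro θ hθ
    rw [hC, Finset.mem_erase, coeffPairs, Finset.mem_filter] at hθ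
    exact ⟨hθ.2.2, h.card_kasamiKer_eq_or hq hθ.1⟩
  set C1 := C.filter fun θ => (kasamiKer τ κ θ.1 θ.2).card = 1 with hC1
  set C1p := C1.filter fun θ =>
    (formCount p τ κ θ 0 : ℤ) = p ^ (2 * s - 1) + (p - 1) * p ^ (s - 1) with hC1p
  set C1m := C1.filter fun θ =>
    ¬(formCount p τ κ θ 0 : ℤ) = p ^ (2 * s - 1) + (p - 1) * p ^ (s - 1) with hC1m
  -- The two signs of nondegenerate forms are only counted, not identified; their numbers follow
  -- later from moments, by choosing g.
  refine ⟨C1p.card, C1m.card, fun g => ?_⟩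
  · rw [← Finset.sum_filter_add_sum_filter_not C (fun θ => (kasamiKer τ κ θ.1 θ.2).card = 1),
      ← Finset.sum_filter_add_sum_filter_not (C.filter fun θ => ¬(kasamiKer τ κ θ.1 θ.2).card = 1)
        (fun θ => (kasamiKer τ κ θ.1 θ.2).card = q),
      ← Finset.sum_filter_add_sum_filter_not C1 (fun θ =>
        (formCount p τ κ θ 0 : ℤ) = p ^ (2 * s - 1) + (p - 1) * p ^ (s - 1)), ← hC1p, ← hC1m,
      ← add_assoc]
    congr 1
    · congr 1
      · congr 1
        · rw [← nsmul_eq_mul, ← Finset.sum_const]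
          refine Finset.sum_congr rfl fun θ hθ => ?_
          rw [hC1p, Finset.mem_filter, hC1, Finset.mem_filter] at hθ
          rw [hθ.2, hθ.1.2]
        · rw [← nsmul_eq_mul, ← Finset.sum_const]
          refine Finset.sum_congr rfl fun θ hθ => ?_
          rw [hC1m, Finset.mem_filter, hC1, Finset.mem_filter] at hθ
          obtain ⟨ε, hε, h0, -⟩ := h.formCount_of_even (hC' θ hθ.1.1).1 (j := 0)
            (by simpa using hθ.1.2)
          rw [add_zero] at h0
          rcases hε with rfl | rfl
          · exact absurd (by rw [h0]; ring) hθ.2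
          · rw [h0, hθ.1.2]
            congr 1; ring
      · rw [Finset.filter_filter, ← h.filter_erase_zero (by omega : q ≠ (p ^ s) ^ 2), ← hC]
        refine Finset.sum_congr ?_ fun θ hθ => ?_
        · ext θ
          simp only [Finset.mem_filter]
          constructor
          · tauto
          · rintro ⟨h1, h2⟩; exact ⟨h1, by omega, h2⟩
        · rw [(Finset.mem_filter.mp hθ).2]
    · rw [Finset.filter_filter,
        ← h.filter_erase_zero (by omega : q ^ 2 ≠ (p ^ s) ^ 2), ← hC]
      refine Finset.sum_congr ?_ fun θ hθ => ?_
      · ext θ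
        simp only [Finset.mem_filter]
        constructor
        · rintro ⟨h1, h2, h3⟩
          have := (hC' θ h1).2
          tauto
        · rintro ⟨h1, h2⟩; exact ⟨h1, by omega, by omega⟩
      · rw [(Finset.mem_filter.mp hθ).2]

theorem exists_quadraticChar_eq_neg_one_of_algebra {k : Type*} [Field k] [Fintype k]
    [DecidableEq k] [Algebra (ZMod p) k] : ∃ u : k, quadraticChar k u = -1 :=
  quadraticChar_exists_neg_one h.ringChar_ne_two

/-! ### The case d' = d: frequencies of the degenerate types. -/

section CaseOne

variable {k : Type*} [Field k] [Fintype k] [DecidableEq k] [Algebra k K] [Algebra (ZMod p) k]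
  [IsScalarTower (ZMod p) k K]
  (hd : 0 < d) (hds : 2 * d ≤ s)
  (hfix : ∀ x : K, τ x = x ↔ ∃ r : k, algebraMap k K r = x)
  (hκk : ∀ r : k, κ (algebraMap k K r) = algebraMap k K r)
  (hk : Fintype.card k = p ^ d)
include hfix hκk hk hd hds

theorem sum_corank_two (g : ℤ → ℚ) :
    ∑ θ ∈ (coeffPairs κ).filter (fun θ => (kasamiKer τ κ θ.1 θ.2).card = (p ^ d) ^ 2),
      g (formCount p τ κ θ 0) =
    (((p : ℚ) ^ s) ^ 2 - 1) * (p ^ s - p ^ d) / (((p ^ d) ^ 2 - 1) * p ^ d) *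
      g (p ^ (2 * s - 1) - (p - 1) * p ^ (s - 1 + d)) := by
  have hp := (Fact.out : p.Prime)
  have e : (p ^ d) ^ 2 = p ^ (2 * d) := by rw [← pow_mul, mul_comm]
  have h1 := h.card_corank_two hd (by omega) hfix hκk hk
  have hp0 : (p : ℚ) ^ d ≠ 0 := pow_ne_zero _ (by exact_mod_cast hp.ne_zero)
  have hne : ((p : ℚ) ^ d) ^ 2 - 1 ≠ 0 := by
    rw [sub_ne_zero, ← pow_mul]
    exact_mod_cast h.prime_pow_ne_one (by omega)
  rw [e, Finset.sum_congr rfl (g := fun _ => g (p ^ (2 * s - 1) - (p - 1) * p ^ (s - 1 + d))),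
    Finset.sum_const, nsmul_eq_mul]
  · congr 1
    rw [eq_div_iff (mul_ne_zero hne hp0), ← h1]
    ring
  · intro θ hθ
    simp only [coeffPairs, Finset.mem_filter, Finset.mem_univ, true_and] at hθ
    rw [h.formCount_corank_two hd (by omega) hfix hκk hk hθ.1 hθ.2]

/-- A radical of odd dimension over the prime field gives the mean number of zeros, whatever the
sign of D. -/
theorem sum_corank_one_of_odd (hodd : Odd d) (g : ℤ → ℚ) :
    ∑ θ ∈ (coeffPairs κ).filter (fun θ => (kasamiKer τ κ θ.1 θ.2).card = p ^ d),
      g (formCount p τ κ θ 0) =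
    (((p : ℚ) ^ s) ^ 2 - 1) * p ^ s / p ^ d * g (p ^ (2 * s - 1)) := by
  have hp := (Fact.out : p.Prime)
  have h1 := h.card_corank_one hd (by omega) hfix hκk hk
  have hp0 : (p : ℚ) ^ d ≠ 0 := pow_ne_zero _ (by exact_mod_cast hp.ne_zero)
  rw [Finset.sum_congr rfl (g := fun _ => g (p ^ (2 * s - 1))), Finset.sum_const, nsmul_eq_mul]
  · congr 1
    rw [eq_div_iff hp0, ← h1]
  · intro θ hθ
    simp only [coeffPairs, Finset.mem_filter, Finset.mem_univ, true_and] at hθ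
    obtain ⟨j, rfl⟩ := hodd
    obtain ⟨D, -, h0, -⟩ := h.formCount_of_odd hθ.1 hθ.2
    rw [h0]

/-- Multiplication by a nonsquare of k permutes these forms and exchanges the two possible zero
counts, since the counts of a form and its multiple sum to twice the mean. So each occurs for half
of the forms. -/
theorem sum_corank_one_of_even {e : ℕ} (hde : d = 2 * e) (g : ℤ → ℚ) :
    ∑ θ ∈ (coeffPairs κ).filter (fun θ => (kasamiKer τ κ θ.1 θ.2).card = p ^ d),
      g (formCount p τ κ θ 0) =
    (((p : ℚ) ^ s) ^ 2 - 1) * p ^ s / (2 * p ^ d) *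
      (g (p ^ (2 * s - 1) + (p - 1) * p ^ (s - 1 + e)) +
        g (p ^ (2 * s - 1) - (p - 1) * p ^ (s - 1 + e))) := by
  have hp := (Fact.out : p.Prime)
  have h1 := h.card_corank_one hd (by omega) hfix hκk hk
  have hp0 : (p : ℚ) ^ d ≠ 0 := pow_ne_zero _ (by exact_mod_cast hp.ne_zero)
  obtain ⟨u, hu⟩ := h.exists_quadraticChar_eq_neg_one_of_algebra (k := k)
  have hu0 : u ≠ 0 := by rintro rfl; simp at hu
  have huK : algebraMap k K u ≠ 0 := by simpa using hu0
  set C := (coeffPairs κ).filter (fun θ => (kasamiKer τ κ θ.1 θ.2).card = p ^ d) with hC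
  set a : ℤ := p ^ (2 * s - 1) + (p - 1) * p ^ (s - 1 + e) with ha
  set b : ℤ := p ^ (2 * s - 1) - (p - 1) * p ^ (s - 1 + e) with hb
  have hab : a ≠ b := by
    intro hab
    have h2 : (2 * (p - 1) * p ^ (s - 1 + e) : ℤ) = 0 := by linear_combination hab - ha + hb
    have hp1 : (p : ℤ) - 1 ≠ 0 := by
      rw [sub_ne_zero]; exact_mod_cast hp.one_lt.ne'
    have hp2 : (p : ℤ) ≠ 0 := by exact_mod_cast hp.ne_zero
    exact mul_ne_zero (mul_ne_zero two_ne_zero hp1) (pow_ne_zero _ hp2) h2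
  have hval : ∀ θ ∈ C, (formCount p τ κ θ 0 : ℤ) = a ∨ (formCount p τ κ θ 0 : ℤ) = b := by
    intro θ hθ
    simp only [hC, coeffPairs, Finset.mem_filter, Finset.mem_univ, true_and] at hθ
    obtain ⟨ε, hε, h0, -⟩ := h.formCount_of_even hθ.1 (hde ▸ hθ.2)
    rcases hε with rfl | rfl
    · left; rw [h0, ha]; ring
    · right; rw [h0, hb]; ring
  have hfl : ∀ θ ∈ C, (formCount p τ κ θ 0 : ℤ) +
      formCount p τ κ (algebraMap k K u * θ.1, algebraMap k K u * θ.2) 0 = a + b := by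
    intro θ hθ
    simp only [hC, coeffPairs, Finset.mem_filter, Finset.mem_univ, true_and] at hθ
    rw [h.formCount_add_corank_one hd (by omega) hfix hκk hk hθ.1 hθ.2 hu, ha, hb]
    ring
  have hτu : ∀ v : k, τ (algebraMap k K v) = algebraMap k K v := fun v => (hfix _).mpr ⟨v, rfl⟩
  have hmem : ∀ v : k, v ≠ 0 → ∀ θ ∈ C, (algebraMap k K v * θ.1, algebraMap k K v * θ.2) ∈ C := by
    intro v hv θ hθ
    have hvK : algebraMap k K v ≠ 0 := by simpa using hv
    simp only [hC, coeffPairs, Finset.mem_filter, Finset.mem_univ, true_and] at hθ ⊢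
    refine ⟨by rw [map_mul, hκk, hθ.1], ?_⟩
    rw [← hθ.2]
    congr 1
    ext x
    simp [mem_kasamiKer, kasamiOp_smul_coeff τ κ (hτu v) (hκk v), hvK]
  have heq : (C.filter fun θ => (formCount p τ κ θ 0 : ℤ) = a).card =
      (C.filter fun θ => ¬(formCount p τ κ θ 0 : ℤ) = a).card := by
    refine Finset.card_bij
      (fun θ _ => (algebraMap k K u * θ.1, algebraMap k K u * θ.2)) ?_ ?_ ?_
    · intro θ hθ
      rw [Finset.mem_filter] at hθ ⊢
      refine ⟨hmem u hu0 θ hθ.1, ?_⟩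
      have := hfl θ hθ.1
      intro h'
      rw [hθ.2, h'] at this
      exact hab (by linarith)
    · intro θ _ θ' _ h'
      simp only [Prod.mk.injEq] at h'
      exact Prod.ext (mul_left_cancel₀ huK h'.1) (mul_left_cancel₀ huK h'.2)
    · intro θ hθ
      rw [Finset.mem_filter] at hθ
      have hm := hmem u⁻¹ (inv_ne_zero hu0) θ hθ.1
      have hback : (algebraMap k K u * (algebraMap k K u⁻¹ * θ.1),
          algebraMap k K u * (algebraMap k K u⁻¹ * θ.2)) = θ := by
        rw [map_inv₀]
        ext <;> field_simp
      refine ⟨(algebraMap k K u⁻¹ * θ.1, algebraMap k K u⁻¹ * θ.2), ?_, hback⟩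
      rw [Finset.mem_filter]
      refine ⟨hm, ?_⟩
      have := hfl _ hm
      dsimp only at this
      rw [hback] at this
      rcases hval θ hθ.1 with h' | h'
      · exact absurd h' hθ.2
      · rw [h'] at this; linarith
  have hsum := Finset.card_filter_add_card_filter_not (s := C)
    (fun θ => (formCount p τ κ θ 0 : ℤ) = a)
  rw [← heq] at hsum
  rw [← hsum] at h1
  rw [← Finset.sum_filter_add_sum_filter_not C (fun θ => (formCount p τ κ θ 0 : ℤ) = a),
    Finset.sum_congr rfl (g := fun _ => g a) (fun θ hθ => by rw [(Finset.mem_filter.mp hθ).2]),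
    Finset.sum_congr (s₁ := C.filter fun θ => ¬(formCount p τ κ θ 0 : ℤ) = a) rfl
      (g := fun _ => g b) (fun θ hθ => by
        rw [Finset.mem_filter] at hθ
        rw [(hval θ hθ.1).resolve_left hθ.2]),
    Finset.sum_const, Finset.sum_const, ← heq, ← smul_add, nsmul_eq_mul]
  congr 1
  rw [eq_div_iff (mul_ne_zero two_ne_zero hp0), ← h1]
  push_cast
  ring

end CaseOne

/-! ### The case d' = 2d: invariance under the (p^d + 1)-th roots of unity. -/

section CaseTwo

variable (hfix : (Finset.univ.filter fun x => τ x = x).card = (p ^ d) ^ 2)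
  (hanti : (Finset.univ.filter fun x => τ x = x ∧ κ x = -x).card = p ^ d)
  (hU : (Finset.univ.filter fun u : K => u ^ (p ^ d + 1) = 1).card = p ^ d + 1)
  (hUκ : ∀ u : K, u ^ (p ^ d + 1) = 1 → u * κ u = 1)
  (hUτ : ∀ u : K, u ^ (p ^ d + 1) = 1 → u * τ (κ u) = 1)
  (hdvd : ((p : ℤ) ^ d + 1) ∣ p ^ s + 1)

include hU hUκ hUτ in
-- Substitution by such a root u fixes both coefficients, so the level sets are unions of orbits,
-- free away from zero.
theorem succ_dvd_formCount (θ : K × K) {t : ZMod p} (ht : t ≠ 0) :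
    p ^ d + 1 ∣ formCount p τ κ θ t := by
  refine dvd_card_of_mul_invariant (Nat.succ_pos _) hU _ ?_ ?_
  · simpa using ht.symm
  · intro u x hu hx
    simp only [Finset.mem_filter, Finset.mem_univ, true_and] at hx ⊢
    rw [← primeForm_self_subst h, hUκ u hu, hUτ u hu, mul_one, mul_one]
    exact hx

include hU hUκ hUτ hdvd in
/-- If `p ^ d + 1` divides `p ^ s + 1`, the sign of a form with radical of dimension `2 i d` is
determined by `i`. -/
theorem formCount_of_hermitian (hd : 0 < d) {θ : K × K} (hθ : κ θ.1 = θ.1) {i : ℕ}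
    (hR : (kasamiKer τ κ θ.1 θ.2).card = p ^ (2 * (d * i))) :
    (formCount p τ κ θ 0 : ℤ) = p ^ (2 * s - 1) - (-1) ^ i * ((p - 1) * p ^ (s - 1 + d * i)) := by
  have hp := (Fact.out : p.Prime)
  have hs := h.pos
  obtain ⟨ε, hε, h0, h1⟩ := h.formCount_of_even hθ hR
  have h2 := h.succ_dvd_formCount hU hUκ hUτ θ (one_ne_zero (α := ZMod p))
  zify at h2
  rw [h1 1 one_ne_zero] at h2
  have h3 := h2.mul_left (p : ℤ)
  have e1 : (p : ℤ) * p ^ (2 * s - 1) = (p ^ s) ^ 2 := by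
    rw [← pow_succ', ← pow_mul]; congr 1; omega
  have e2 : (p : ℤ) * p ^ (s - 1 + d * i) = p ^ s * (p ^ d) ^ i := by
    rw [← pow_succ', ← pow_mul, ← pow_add]; congr 1; omega
  have e3 : (p : ℤ) * (p ^ (2 * s - 1) - ε * p ^ (s - 1 + d * i)) =
      (p ^ s) ^ 2 - ε * (p ^ s * (p ^ d) ^ i) := by
    linear_combination e1 - ε * e2
  rw [e3] at h3
  -- Modulo p^d + 1 both p^s and p^d are -1, so p times the size of the level 1 is 1 + ε(-1)^i.
  -- Divisibility fixes ε because the modulus exceeds 2.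
  have hP : (p : ℤ) ^ s ≡ -1 [ZMOD p ^ d + 1] := by
    rw [Int.modEq_comm, Int.modEq_iff_dvd]; simpa using hdvd
  have hD : ((p : ℤ) ^ d) ^ i ≡ (-1) ^ i [ZMOD p ^ d + 1] := by
    refine Int.ModEq.pow i ?_
    rw [Int.modEq_comm, Int.modEq_iff_dvd]; simp
  have h4 : ((p : ℤ) ^ s) ^ 2 - ε * (p ^ s * (p ^ d) ^ i) ≡ (-1) ^ 2 - ε * (-1 * (-1) ^ i)
      [ZMOD p ^ d + 1] := ((hP.pow 2).sub ((hP.mul hD).mul_left ε))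
  have h5 : ((p : ℤ) ^ d + 1) ∣ 1 + ε * (-1) ^ i := by
    have := (Int.modEq_zero_iff_dvd.mpr h3).symm.trans h4
    have := Int.modEq_zero_iff_dvd.mp this.symm
    convert this using 1; ring
  have hlt : (2 : ℤ) < p ^ d + 1 := by
    have : 1 < p ^ d := Nat.one_lt_pow hd.ne' hp.one_lt
    zify at this
    linarith
  have h6 : ε = -(-1) ^ i := by
    rcases hε with rfl | rfl <;> rcases neg_one_pow_eq_or ℤ i with h' | h' <;> rw [h'] at h5 ⊢
    · exact absurd (Int.le_of_dvd (by norm_num) h5) (by linarith)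
    · norm_num
    · exact absurd (Int.le_of_dvd (by norm_num) h5) (by linarith)
  rw [h0, h6]
  ring

include hfix hanti in
-- The coefficient a is determined by b, and b is subject to κ(b) - b being fixed by `τ`. The map κ
-- - 1 has the `κ`-fixed elements as kernel and the elements negated by `κ` as image.
theorem card_filter_op_one :
    ((coeffPairs κ).filter fun θ => kasamiOp τ κ θ.1 θ.2 1 = 0).card = p ^ s * p ^ d := by
  have h1 : ((coeffPairs κ).filter fun θ => kasamiOp τ κ θ.1 θ.2 1 = 0).card =
      (Finset.univ.filter fun b : K => τ (κ b - b) = κ b - b).card := by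
    refine Finset.card_bij (fun θ _ => θ.2) ?_ ?_ ?_
    · intro θ hθ
      simp only [coeffPairs, Finset.mem_filter, Finset.mem_univ, true_and] at hθ ⊢
      exact (conj_sub_fixed_iff h.invol h.comm hθ.2).mp hθ.1
    · intro θ hθ θ' hθ' e
      rw [Finset.mem_filter, kasamiOp_one_eq_zero_iff] at hθ hθ'
      exact Prod.ext (by rw [hθ.2, hθ'.2, e]) e
    · intro b hb
      simp only [Finset.mem_filter, Finset.mem_univ, true_and] at hb
      have h2 : kasamiOp τ κ (-b - κ (τ.symm b)) b 1 = 0 := kasamiOp_one_eq_zero_iff.mpr rfl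
      refine ⟨(-b - κ (τ.symm b), b), ?_, rfl⟩
      simp only [coeffPairs, Finset.mem_filter, Finset.mem_univ, true_and]
      exact ⟨(conj_sub_fixed_iff h.invol h.comm h2).mpr hb, h2⟩
  let g : K →+ K := κ.toAddEquiv.toAddMonoidHom - AddMonoidHom.id K
  have hg : ∀ x, g x = κ x - x := fun x => rfl
  have h3 := card_filter_addHom g (fun z => τ z = z)
  simp only [hg] at h3
  rw [h1, h3, ← hanti]
  congr 1
  · rw [← h.card_fixed, levelCard]
    congr 1
    ext x
    simp [hg, sub_eq_zero]
  · congr 1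
    ext z
    simp only [Finset.mem_filter, Finset.mem_univ, true_and, Finset.mem_image, hg]
    refine and_congr_right fun _ => ⟨?_, fun hz => ⟨-z / 2, ?_⟩⟩
    · rintro ⟨x, rfl⟩
      rw [map_sub, h.invol]; ring
    · have h2 := h.two_ne_zero'
      rw [map_div₀, map_neg, hz, map_ofNat]
      field_simp
      ring

end CaseTwo

end KasamiSetting

end Distribution

/-! ### The words of the code, as functions on the field -/

section Words

variable {p s : ℕ} [Fact p.Prime] {K : Type*} [Field K] [Algebra (ZMod p) K]
  [Fintype K] [DecidableEq K] (τ κ : K ≃+* K)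

variable (p) in
/-- The function `x ↦ B(x, x) + Tr(c x) + r` for the form `B` with coefficients `θ`. -/
noncomputable def kasamiWord (θ : K × K) (c : K) (r : ZMod p) (x : K) : ZMod p :=
  primeForm p τ κ θ x x + Algebra.trace (ZMod p) K (c * x) + r

variable (p) in
/-- The number of zeros of a word. -/
noncomputable def zeroCount (θ : K × K) (c : K) (r : ZMod p) : ℕ :=
  levelCard (kasamiWord p τ κ θ c r) 0

variable (p) in
/-- The operator `kasamiOp` as a linear map over the prime field. -/
noncomputable def kasamiLin (θ : K × K) : K →ₗ[ZMod p] K :=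
  AddMonoidHom.toZModLinearMap p
    { toFun := kasamiOp τ κ θ.1 θ.2
      map_zero' := kasamiOp_zero τ κ _ _
      map_add' := kasamiOp_add τ κ _ _ }

variable {τ κ}

theorem kasamiLin_apply (θ : K × K) (x : K) : kasamiLin p τ κ θ x = kasamiOp τ κ θ.1 θ.2 x := rfl

theorem primeForm_apply (θ : K × K) (x y : K) :
    primeForm p τ κ θ x y = Algebra.trace (ZMod p) K (kasamiOp τ κ θ.1 θ.2 x * y) := rfl

namespace KasamiSetting

variable (h : KasamiSetting p s τ κ)
include h

theorem primeForm_symm {θ : K × K} (hθ : κ θ.1 = θ.1) (x y : K) :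
    primeForm p τ κ θ x y = primeForm p τ κ θ y x :=
  kasamiForm_symm _ _ h.invol hθ _ _ _

theorem primeForm_add_self {θ : K × K} (hθ : κ θ.1 = θ.1) (x y : K) :
    primeForm p τ κ θ (x + y) (x + y) =
      primeForm p τ κ θ x x + 2 * primeForm p τ κ θ y x + primeForm p τ κ θ y y := by
  simp only [map_add, LinearMap.add_apply, h.primeForm_symm hθ x y]
  ring

omit h in
theorem trace_two_mul (x : K) :
    Algebra.trace (ZMod p) K (2 * x) = 2 * Algebra.trace (ZMod p) K x := by
  rw [two_mul, map_add, two_mul]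

/-- Self-adjointness gives one inclusion, and the dimensions agree. -/
theorem range_kasamiLin {θ : K × K} (hθ : κ θ.1 = θ.1) :
    LinearMap.range (kasamiLin p τ κ θ) =
      (Algebra.traceForm (ZMod p) K).orthogonal (LinearMap.ker (kasamiLin p τ κ θ)) := by
  apply Submodule.eq_of_le_of_finrank_eq
  · rintro _ ⟨y, rfl⟩ x hx
    rw [LinearMap.mem_ker, kasamiLin_apply] at hx
    change Algebra.trace (ZMod p) K (x * kasamiOp τ κ θ.1 θ.2 y) = 0
    rw [mul_comm, ← primeForm_apply, h.primeForm_symm hθ, primeForm_apply, hx, zero_mul, map_zero]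
  · rw [LinearMap.BilinForm.finrank_orthogonal (traceForm_nondegenerate _ _)]
    have := LinearMap.finrank_range_add_finrank_ker (kasamiLin p τ κ θ)
    omega

/-- Completing the square: with c = E(y), the translation by y/2 absorbs the linear term and leaves
the constant t₀. -/
theorem levelCard_kasamiWord_of_range {θ : K × K} (hθ : κ θ.1 = θ.1) {c : K}
    (hc : c ∈ LinearMap.range (kasamiLin p τ κ θ)) :
    ∃ t₀ : ZMod p, ∀ r, zeroCount p τ κ θ c r = formCount p τ κ θ (t₀ - r) := by
  obtain ⟨y, rfl⟩ := hc
  have h2 := h.two_ne_zero'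
  refine ⟨primeForm p τ κ θ (y / 2) (y / 2), fun r => ?_⟩
  unfold formCount zeroCount
  rw [← levelCard_comp_equiv (Equiv.addRight (y / 2)) (fun x => primeForm p τ κ θ x x)]
  unfold levelCard
  congr 1
  ext x
  rw [Finset.mem_filter, Finset.mem_filter, Equiv.coe_addRight]
  have e1 : Algebra.trace (ZMod p) K (kasamiLin p τ κ θ y * x) =
      2 * primeForm p τ κ θ (y / 2) x := by
    have e : y = y / 2 + y / 2 := by field_simp; ring
    nth_rewrite 1 [e]
    rw [map_add, add_mul, map_add, two_mul]
    rfl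
  simp only [Finset.mem_univ, true_and]
  rw [kasamiWord, e1, h.primeForm_add_self hθ]
  constructor <;> intro h <;> linear_combination h

/-- Some y in the kernel has Tr(cy) ≠ 0. Translation along y leaves the form alone and shifts the
word by an arbitrary constant, so all values are equally frequent. -/
theorem zeroCount_of_not_range {θ : K × K} (hθ : κ θ.1 = θ.1) {c : K}
    (hc : c ∉ LinearMap.range (kasamiLin p τ κ θ)) (r : ZMod p) :
    zeroCount p τ κ θ c r = p ^ (2 * s - 1) := by
  rw [h.range_kasamiLin hθ, LinearMap.BilinForm.mem_orthogonal_iff] at hc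
  push Not at hc
  obtain ⟨y, hy, hyc⟩ := hc
  have hyc' : Algebra.trace (ZMod p) K (c * y) ≠ 0 := by rw [mul_comm]; exact hyc
  set e := Algebra.trace (ZMod p) K (c * y) with he
  rw [LinearMap.mem_ker, kasamiLin_apply] at hy
  have hB : ∀ x, primeForm p τ κ θ y x = 0 := fun x => by
    rw [primeForm_apply, hy, zero_mul, map_zero]
  have hshift : ∀ (t : ZMod p) (x : K), kasamiWord p τ κ θ c r (x + (t / e) • y) =
      kasamiWord p τ κ θ c r x + t := by
    intro t x
    have e1 : primeForm p τ κ θ (x + (t / e) • y) (x + (t / e) • y) = primeForm p τ κ θ x x := by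
      rw [h.primeForm_add_self hθ, map_smul, LinearMap.smul_apply, LinearMap.smul_apply, hB, hB]
      simp
    rw [kasamiWord, kasamiWord, e1, mul_add, mul_smul_comm, map_add, map_smul, ← he, smul_eq_mul,
      div_mul_cancel₀ _ hyc']
    ring
  have hlev : ∀ t, levelCard (kasamiWord p τ κ θ c r) t = zeroCount p τ κ θ c r := by
    intro t
    unfold zeroCount
    rw [← levelCard_comp_equiv (Equiv.addRight ((t / e) • y)) (kasamiWord p τ κ θ c r) t]
    unfold levelCard
    congr 1
    ext x
    simp [hshift]
  have hsum := sum_levelCard (kasamiWord p τ κ θ c r)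
  simp only [hlev, Finset.sum_const, smul_eq_mul, Finset.card_univ] at hsum
  rw [h.card_eq_mul] at hsum
  exact Nat.eq_of_mul_eq_mul_left Fintype.card_pos hsum

/-- The numbers of zeros of the words with given coefficients `θ`. -/
theorem sum_zeroCount {θ : K × K} (hθ : κ θ.1 = θ.1) (φ : ℤ → ℚ) :
    ∑ c : K, ∑ r : ZMod p, φ (zeroCount p τ κ θ c r) =
      ((p : ℚ) ^ s) ^ 2 / (kasamiKer τ κ θ.1 θ.2).card * ∑ t : ZMod p, φ (formCount p τ κ θ t) +
      (((p : ℚ) ^ s) ^ 2 - ((p : ℚ) ^ s) ^ 2 / (kasamiKer τ κ θ.1 θ.2).card) * p *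
        φ (p ^ (2 * s - 1)) := by
  classical
  set I := Finset.univ.filter fun c : K => c ∈ LinearMap.range (kasamiLin p τ κ θ) with hI
  set R := (kasamiKer τ κ θ.1 θ.2).card with hR
  have hR0 : (R : ℚ) ≠ 0 := by
    have : 0 < R := Finset.card_pos.mpr ⟨0, mem_kasamiKer.mpr (by simp)⟩
    exact_mod_cast this.ne'
  have hcard := card_filter_addHom (kasamiLin p τ κ θ).toAddMonoidHom (fun _ => True)
  simp only [Finset.filter_true, true_and, Finset.card_univ, h.card_eq] at hcard
  have hIc : (Finset.univ.filter fun c : K =>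
      c ∈ Finset.univ.image (kasamiLin p τ κ θ).toAddMonoidHom) = I := by
    ext c; simp [hI]
  have hlev : levelCard (kasamiLin p τ κ θ).toAddMonoidHom 0 = R := rfl
  rw [hIc, hlev] at hcard
  have hIcard : (I.card : ℚ) = ((p : ℚ) ^ s) ^ 2 / R := by
    rw [eq_div_iff hR0]
    exact_mod_cast (by rw [hcard, mul_comm] : I.card * R = (p ^ s) ^ 2)
  have hsplit := Finset.card_filter_add_card_filter_not (s := (Finset.univ : Finset K))
    (fun c => c ∈ LinearMap.range (kasamiLin p τ κ θ))
  rw [← hI, Finset.card_univ, h.card_eq] at hsplit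
  have hsplit' := congrArg (Nat.cast (R := ℚ)) hsplit
  push_cast at hsplit'
  rw [← Finset.sum_filter_add_sum_filter_not Finset.univ
    (fun c => c ∈ LinearMap.range (kasamiLin p τ κ θ)), ← hI]
  congr 1
  · rw [← hIcard, ← nsmul_eq_mul, ← Finset.sum_const]
    refine Finset.sum_congr rfl fun c hc => ?_
    obtain ⟨t₀, ht⟩ := h.levelCard_kasamiWord_of_range hθ (Finset.mem_filter.mp hc).2
    simp only [ht]
    -- As r runs over the prime field, so does t₀ - r, and t₀ disappears.
    exact (Equiv.subLeft t₀).sum_comp (fun t => φ (formCount p τ κ θ t))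
  · rw [← hIcard, ← hsplit', add_sub_cancel_left, mul_assoc, ← nsmul_eq_mul, ← Finset.sum_const]
    refine Finset.sum_congr rfl fun c hc => ?_
    simp only [h.zeroCount_of_not_range hθ (Finset.mem_filter.mp hc).2]
    simp

/-- Scaling the variable rescales the coefficients, and translating it adds only linear and constant
terms; this is the affine invariance of the code. -/
theorem exists_kasamiWord_affine {θ : K × K} (hθ : κ θ.1 = θ.1) (c : K) (r : ZMod p) (u v : K) :
    ∃ (θ' : K × K) (c' : K) (r' : ZMod p), κ θ'.1 = θ'.1 ∧
      ∀ x, kasamiWord p τ κ θ' c' r' x = kasamiWord p τ κ θ c r (u * x + v) := by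
  refine ⟨(θ.1 * (u * κ u), θ.2 * (u * τ (κ u))), 2 * kasamiOp τ κ θ.1 θ.2 v * u + c * u,
    primeForm p τ κ θ v v + Algebra.trace (ZMod p) K (c * v) + r, ?_, fun x => ?_⟩
  · simp only [map_mul, hθ, h.invol]; ring
  · have e1 : Algebra.trace (ZMod p) K (2 * kasamiOp τ κ θ.1 θ.2 v * u * x) =
        2 * primeForm p τ κ θ v (u * x) := by
      rw [primeForm_apply, ← trace_two_mul]
      congr 1; ring
    rw [kasamiWord, kasamiWord, primeForm_self_subst h, h.primeForm_add_self hθ, add_mul, map_add, e1, mul_add, map_add]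
    ring_nf

omit h in
theorem kasamiWord_sub (θ θ' : K × K) (c c' : K) (r r' : ZMod p) (x : K) :
    kasamiWord p τ κ (θ - θ') (c - c') (r - r') x =
      kasamiWord p τ κ θ c r x - kasamiWord p τ κ θ' c' r' x := by
  have e : primeForm p τ κ θ x x = primeForm p τ κ (θ - θ') x x + primeForm p τ κ θ' x x := by
    rw [primeForm_apply, primeForm_apply, primeForm_apply, ← map_add, ← add_mul,
      ← kasamiOp_add_coeff, Prod.fst_sub, Prod.snd_sub, sub_add_cancel, sub_add_cancel]
  rw [kasamiWord, kasamiWord, kasamiWord, e, sub_mul, map_sub]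
  ring

/-- Values at x and -x isolate the quadratic part, which polarises to B = 0. A nonzero pair of
coefficients has a kernel of order at most q² < |K|, so it cannot give B = 0. -/
theorem eq_zero_of_kasamiWord_eq_zero {q : ℕ}
    (hq : (Finset.univ.filter fun x => τ x = x).card = q) (hq1 : 1 < q) (hqP : q ^ 2 < (p ^ s) ^ 2)
    {θ : K × K} (hθ : κ θ.1 = θ.1) {c : K} {r : ZMod p}
    (h0 : ∀ x, kasamiWord p τ κ θ c r x = 0) : θ = 0 ∧ c = 0 ∧ r = 0 := by
  have hr : r = 0 := by simpa [kasamiWord] using h0 0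
  subst hr
  have h2 : (2 : ZMod p) ≠ 0 := Ring.two_ne_zero h.ringChar_zmod_ne_two
  have hB : ∀ x, primeForm p τ κ θ x x = 0 := by
    intro x
    have h1 := h0 x
    have h3 := h0 (-x)
    simp only [kasamiWord, map_neg, LinearMap.neg_apply, neg_neg, mul_neg] at h1 h3
    have : 2 * primeForm p τ κ θ x x = 0 := by linear_combination h1 + h3
    exact (mul_eq_zero.mp this).resolve_left h2
  have hθ0 : θ = 0 := by
    by_contra hne
    have hall : (kasamiKer τ κ θ.1 θ.2).card = (p ^ s) ^ 2 := by
      rw [← h.card_eq, ← Finset.card_univ]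
      congr 1
      ext x
      simp only [mem_kasamiKer, Finset.mem_univ, iff_true]
      rw [← kasamiForm_eq_zero_iff (ringEquiv_algebraMap_zmod (p := p) τ)
        (ringEquiv_algebraMap_zmod κ)]
      ext y
      change primeForm p τ κ θ x y = 0
      have h4 := hB (x + y)
      rw [h.primeForm_add_self hθ, hB, hB, zero_add, add_zero] at h4
      rw [h.primeForm_symm hθ]
      exact (mul_eq_zero.mp h4).resolve_left h2
    have hlt : q < q ^ 2 := by nlinarith
    rcases h.card_kasamiKer_eq_or hq hne with h' | h' | h' <;> omega
  refine ⟨hθ0, ?_, rfl⟩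
  refine (traceForm_nondegenerate (ZMod p) K).1 _ fun y => ?_
  have := h0 y
  rw [kasamiWord, hB, zero_add, add_zero] at this
  exact this

end KasamiSetting

end Words

/-! ### The weight distribution -/

section WeightDistribution

/-- Contribution of a form of even rank with radical of order `R`, over all linear and constant
terms; `x` is the signed deviation and `P` is the square root of the order of the field. -/
def evenTerm (p : ℕ) (P R : ℚ) (ψ : ℤ → ℚ) (x : ℤ) : ℚ :=
  P ^ 2 / R * (ψ ((p - 1) * x) + (p - 1) * ψ (-x)) + (P ^ 2 - P ^ 2 / R) * p * ψ 0

/-- Contribution of a form of odd rank. -/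
def oddTerm (p : ℕ) (P R : ℚ) (ψ : ℤ → ℚ) (x : ℤ) : ℚ :=
  P ^ 2 / R * (ψ 0 + (p - 1) / 2 * (ψ x + ψ (-x))) + (P ^ 2 - P ^ 2 / R) * p * ψ 0

variable {p s d : ℕ} [Fact p.Prime] {K : Type*} [Field K] [Algebra (ZMod p) K]
  [Fintype K] [DecidableEq K] {τ κ : K ≃+* K}

variable (p s τ κ) in
/-- The sum of a function of the deviation of the number of zeros from its mean, over all words. -/
noncomputable def wordSum (ψ : ℤ → ℚ) : ℚ :=
  ∑ θ ∈ coeffPairs κ, ∑ c : K, ∑ r : ZMod p, ψ (zeroCount p τ κ θ c r - p ^ (2 * s - 1))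

namespace KasamiSetting

variable (h : KasamiSetting p s τ κ)
include h

theorem card_erase_zmod : ((Finset.univ.erase (0 : ZMod p)).card : ℚ) = p - 1 := by
  rw [Finset.card_erase_of_mem (Finset.mem_univ _), Finset.card_univ, ZMod.card,
    Nat.cast_sub (Fact.out : p.Prime).one_lt.le, Nat.cast_one]

/-- The integer division is exact: the zero level deviates from the mean by (p - 1)x and every other
level by -x. -/
theorem sum_words_even {θ : K × K} (hθ : κ θ.1 = θ.1) {j : ℕ}
    (hR : (kasamiKer τ κ θ.1 θ.2).card = p ^ (2 * j)) (ψ : ℤ → ℚ) :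
    ∑ c : K, ∑ r : ZMod p, ψ (zeroCount p τ κ θ c r - p ^ (2 * s - 1)) =
      evenTerm p (p ^ s) (kasamiKer τ κ θ.1 θ.2).card ψ
        ((formCount p τ κ θ 0 - p ^ (2 * s - 1)) / (p - 1)) := by
  obtain ⟨ε, -, h0, ht⟩ := h.formCount_of_even hθ hR
  have hp1 : (p : ℤ) - 1 ≠ 0 := by
    rw [sub_ne_zero]; exact_mod_cast (Fact.out : p.Prime).one_lt.ne'
  rw [h.sum_zeroCount hθ (fun z => ψ (z - p ^ (2 * s - 1))), evenTerm,
    ← Finset.add_sum_erase _ _ (Finset.mem_univ (0 : ZMod p)),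
    Finset.sum_congr (s₁ := Finset.univ.erase (0 : ZMod p)) rfl
      (g := fun _ => ψ (-(ε * p ^ (s - 1 + j)))), Finset.sum_const, nsmul_eq_mul,
    h.card_erase_zmod, h0]
  · have e : ((p : ℤ) ^ (2 * s - 1) + ε * ((p - 1) * p ^ (s - 1 + j)) - p ^ (2 * s - 1)) /
        (p - 1) = ε * p ^ (s - 1 + j) := by
      rw [show (p : ℤ) ^ (2 * s - 1) + ε * ((p - 1) * p ^ (s - 1 + j)) - p ^ (2 * s - 1) =
        (p - 1) * (ε * p ^ (s - 1 + j)) by ring]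
      exact Int.mul_ediv_cancel_left _ hp1
    rw [e, sub_self]
    congr 5
    ring
  · intro t htm
    rw [ht t (Finset.ne_of_mem_erase htm)]
    congr 1; ring

/-- Squares and nonsquares are equally many among the nonzero t, so the sum is even in D and its
unknown sign does not matter. -/
theorem sum_words_odd {θ : K × K} (hθ : κ θ.1 = θ.1) {j : ℕ}
    (hR : (kasamiKer τ κ θ.1 θ.2).card = p ^ (2 * j + 1)) (ψ : ℤ → ℚ) :
    ∑ c : K, ∑ r : ZMod p, ψ (zeroCount p τ κ θ c r - p ^ (2 * s - 1)) =
      oddTerm p (p ^ s) (kasamiKer τ κ θ.1 θ.2).card ψ (p ^ (s + j)) := by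
  obtain ⟨D, hD, h0, ht⟩ := h.formCount_of_odd hθ hR
  have hsum : ∑ t ∈ Finset.univ.erase (0 : ZMod p), ψ (formCount p τ κ θ t - p ^ (2 * s - 1)) =
      (p - 1) / 2 * (ψ D + ψ (-D)) := by
    have hχ : ∑ t ∈ Finset.univ.erase (0 : ZMod p), (quadraticChar (ZMod p) t : ℚ) = 0 := by
      have := quadraticChar_sum_zero h.ringChar_zmod_ne_two
      rw [← Finset.add_sum_erase _ _ (Finset.mem_univ (0 : ZMod p))] at this
      have h' : ∑ t ∈ Finset.univ.erase (0 : ZMod p), quadraticChar (ZMod p) t = 0 := by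
        simpa using this
      exact_mod_cast h'
    have hval : ∀ t ∈ Finset.univ.erase (0 : ZMod p),
        ψ (formCount p τ κ θ t - p ^ (2 * s - 1)) =
        (ψ D + ψ (-D)) / 2 + quadraticChar (ZMod p) t * ((ψ D - ψ (-D)) / 2) := by
      intro t htm
      have ht0 := Finset.ne_of_mem_erase htm
      rw [ht t ht0, add_sub_cancel_left]
      rcases quadraticChar_dichotomy ht0 with h' | h' <;> rw [h']
      · rw [one_mul]; push_cast; ring
      · rw [neg_one_mul]; push_cast; ring
    rw [Finset.sum_congr rfl hval, Finset.sum_add_distrib, ← Finset.sum_mul, hχ, Finset.sum_const,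
      nsmul_eq_mul, h.card_erase_zmod]
    ring
  rw [h.sum_zeroCount hθ (fun z => ψ (z - p ^ (2 * s - 1))), oddTerm,
    ← Finset.add_sum_erase _ _ (Finset.mem_univ (0 : ZMod p)), hsum, h0, sub_self]
  rcases Int.natAbs_eq D with hD' | hD' <;> rw [hD, Nat.cast_pow] at hD' <;> rw [hD']
  rw [neg_neg]
  congr 4
  ring

/-- The zero form is split off: it behaves as a form of even rank with full radical and deviation
p^(2s-1). -/
theorem wordSum_eq_of (ψ : ℤ → ℚ) (g : ℕ → ℤ → ℚ)
    (hg : ∀ θ ∈ (coeffPairs κ).erase 0,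
      ∑ c : K, ∑ r : ZMod p, ψ (zeroCount p τ κ θ c r - p ^ (2 * s - 1)) =
        g (kasamiKer τ κ θ.1 θ.2).card (formCount p τ κ θ 0)) :
    wordSum p s τ κ ψ = evenTerm p (p ^ s) ((p ^ s) ^ 2) ψ (p ^ (2 * s - 1)) +
      ∑ θ ∈ (coeffPairs κ).erase 0, g (kasamiKer τ κ θ.1 θ.2).card (formCount p τ κ θ 0) := by
  have hp1 : (p : ℤ) - 1 ≠ 0 := by
    rw [sub_ne_zero]; exact_mod_cast (Fact.out : p.Prime).one_lt.ne'
  have hs := h.pos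
  rw [wordSum, h.sum_coeffPairs, Finset.sum_congr rfl hg]
  congr 1
  have hR : (kasamiKer τ κ (0 : K × K).1 (0 : K × K).2).card = p ^ (2 * s) := by
    rw [Prod.fst_zero, Prod.snd_zero, h.card_kasamiKer_zero, ← pow_mul, mul_comm]
  rw [h.sum_words_even (by simp) hR, hR, h.formCount_zero_zero]
  have e1 : (((p ^ s) ^ 2 : ℕ) : ℤ) - p ^ (2 * s - 1) = (p - 1) * p ^ (2 * s - 1) := by
    have : ((p : ℤ) ^ s) ^ 2 = p * p ^ (2 * s - 1) := by
      rw [← pow_succ', ← pow_mul]; congr 1; omega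
    push_cast
    rw [this]; ring
  rw [e1, Int.mul_ediv_cancel_left _ hp1]
  congr 1
  push_cast
  rw [← pow_mul, mul_comm]

section CaseOne

variable {k : Type*} [Field k] [Fintype k] [DecidableEq k] [Algebra k K] [Algebra (ZMod p) k]
  [IsScalarTower (ZMod p) k K]
  (hd : 0 < d) (hds : 2 * d ≤ s)
  (hfix : ∀ x : K, τ x = x ↔ ∃ r : k, algebraMap k K r = x)
  (hκk : ∀ r : k, κ (algebraMap k K r) = algebraMap k K r)
  (hk : Fintype.card k = p ^ d)
include hfix hκk hk hd hds

omit [Algebra (ZMod p) K] hκk hd hds [DecidableEq k] [Algebra (ZMod p) k]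
  [IsScalarTower (ZMod p) k K] [Fact p.Prime] h in
theorem card_fixed_tau : (Finset.univ.filter fun x => τ x = x).card = p ^ d := by
  classical
  rw [card_fixed_eq hfix, hk]

omit [Algebra (ZMod p) K] hκk hd hds [DecidableEq k] [Algebra (ZMod p) k]
  [IsScalarTower (ZMod p) k K] hfix hk [Fintype k] [Field k] [Algebra k K] h in
theorem pow_lt_pow_card (e : ℕ) (he : e < s) : (p ^ e) ^ 2 < (p ^ s) ^ 2 :=
  Nat.pow_lt_pow_left (Nat.pow_lt_pow_right (Fact.out : p.Prime).one_lt he) two_ne_zero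

/-- The two linear equations are `sum_split` at a constant function and at the deviation of the zero
count, with the degenerate frequencies already inserted. -/
theorem wordSum_of_odd (hodd : Odd d) : ∃ n₁ n₂ : ℚ,
    n₁ + n₂ + (((p : ℚ) ^ s) ^ 2 - 1) * p ^ s / p ^ d +
      (((p : ℚ) ^ s) ^ 2 - 1) * (p ^ s - p ^ d) / (((p ^ d) ^ 2 - 1) * p ^ d) = (p ^ s) ^ 3 - 1 ∧
    n₁ - n₂ = (p ^ s) ^ 2 - p ^ s +
      (((p : ℚ) ^ s) ^ 2 - 1) * (p ^ s - p ^ d) / ((p ^ d) ^ 2 - 1) ∧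
    ∀ ψ : ℤ → ℚ, wordSum p s τ κ ψ = evenTerm p (p ^ s) ((p ^ s) ^ 2) ψ (p ^ (2 * s - 1)) +
      (n₁ * evenTerm p (p ^ s) 1 ψ (p ^ (s - 1)) + n₂ * evenTerm p (p ^ s) 1 ψ (-p ^ (s - 1)) +
      (((p : ℚ) ^ s) ^ 2 - 1) * p ^ s / p ^ d *
        oddTerm p (p ^ s) (p ^ d) ψ (p ^ (s + (d - 1) / 2)) +
      (((p : ℚ) ^ s) ^ 2 - 1) * (p ^ s - p ^ d) / (((p ^ d) ^ 2 - 1) * p ^ d) *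
        evenTerm p (p ^ s) ((p ^ d) ^ 2) ψ (-p ^ (s - 1 + d))) := by
  have hp := (Fact.out : p.Prime)
  have hq := card_fixed_tau hfix hk
  have hq1 : 1 < p ^ d := Nat.one_lt_pow hd.ne' hp.one_lt
  have hp0 : (p : ℚ) ≠ 0 := by exact_mod_cast hp.ne_zero
  have hp1 : (p : ℚ) - 1 ≠ 0 := by rw [sub_ne_zero]; exact_mod_cast hp.one_lt.ne'
  have hp1z : (p : ℤ) - 1 ≠ 0 := by rw [sub_ne_zero]; exact_mod_cast hp.one_lt.ne'
  have hD0 : (p : ℚ) ^ d ≠ 0 := pow_ne_zero _ hp0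
  have hD1 : ((p : ℚ) ^ d) ^ 2 - 1 ≠ 0 := by
    rw [sub_ne_zero, ← pow_mul]; exact_mod_cast h.prime_pow_ne_one (by omega)
  obtain ⟨n₁, n₂, hg⟩ := h.sum_split hq hq1 (pow_lt_pow_card d (by omega))
  have hg' : ∀ g : ℕ → ℤ → ℚ,
      ∑ θ ∈ (coeffPairs κ).erase 0, g (kasamiKer τ κ θ.1 θ.2).card (formCount p τ κ θ 0) =
        n₁ * g 1 (p ^ (2 * s - 1) + (p - 1) * p ^ (s - 1)) +
        n₂ * g 1 (p ^ (2 * s - 1) - (p - 1) * p ^ (s - 1)) +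
        (((p : ℚ) ^ s) ^ 2 - 1) * p ^ s / p ^ d * g (p ^ d) (p ^ (2 * s - 1)) +
        (((p : ℚ) ^ s) ^ 2 - 1) * (p ^ s - p ^ d) / (((p ^ d) ^ 2 - 1) * p ^ d) *
          g ((p ^ d) ^ 2) (p ^ (2 * s - 1) - (p - 1) * p ^ (s - 1 + d)) := by
    intro g
    rw [hg g, h.sum_corank_two hd hds hfix hκk hk, h.sum_corank_one_of_odd hd hds hfix hκk hk hodd]
  refine ⟨n₁, n₂, ?_, ?_, fun ψ => ?_⟩
  · have := hg' (fun _ _ => 1)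
    rw [Finset.sum_const, nsmul_eq_mul, h.card_coeffPairs_erase] at this
    linear_combination -this
  · have h1 := hg' (fun _ N => (N : ℚ) - (p : ℚ) ^ (2 * s - 1))
    simp only [Int.cast_natCast] at h1
    rw [h.sum_formCount_erase] at h1
    push_cast at h1
    have e : (p : ℚ) ^ (s - 1 + d) = p ^ (s - 1) * p ^ d := pow_add _ _ _
    rw [e] at h1
    have hps : (p : ℚ) ^ (s - 1) ≠ 0 := pow_ne_zero _ hp0
    have hY : (((p : ℚ) ^ s) ^ 2 - 1) * (p ^ s - p ^ d) / ((p ^ d) ^ 2 - 1) =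
        (((p : ℚ) ^ s) ^ 2 - 1) * (p ^ s - p ^ d) / (((p ^ d) ^ 2 - 1) * p ^ d) * p ^ d := by
      field_simp
    apply mul_left_cancel₀ (mul_ne_zero hp1 hps)
    linear_combination -h1 - (p - 1) * p ^ (s - 1) * hY
  -- The order of the radical decides the parity of the rank: among 1, p^d and p^(2d) only p^d is an
  -- odd power of p.
  · have h0 := hg' (fun R N => if R = p ^ d then
      oddTerm p (p ^ s) R ψ (p ^ (s + (d - 1) / 2))
      else evenTerm p (p ^ s) R ψ ((N - p ^ (2 * s - 1)) / (p - 1)))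
    rw [h.wordSum_eq_of ψ (fun R N => if R = p ^ d then oddTerm p (p ^ s) R ψ (p ^ (s + (d - 1) / 2))
      else evenTerm p (p ^ s) R ψ ((N - p ^ (2 * s - 1)) / (p - 1)))]
    · rw [h0]
      have h1 : (1 : ℕ) ≠ p ^ d := hq1.ne
      have h2 : (p ^ d) ^ 2 ≠ p ^ d := by nlinarith
      simp only [h1, h2, if_true, if_false]
      have e1 : ((p : ℤ) ^ (2 * s - 1) + (p - 1) * p ^ (s - 1) - p ^ (2 * s - 1)) / (p - 1) =
          p ^ (s - 1) := by
        rw [add_sub_cancel_left, Int.mul_ediv_cancel_left _ hp1z]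
      have e2 : ∀ e, ((p : ℤ) ^ (2 * s - 1) - (p - 1) * p ^ e - p ^ (2 * s - 1)) / (p - 1) =
          -p ^ e := by
        intro e
        rw [show (p : ℤ) ^ (2 * s - 1) - (p - 1) * p ^ e - p ^ (2 * s - 1) =
          (p - 1) * (-p ^ e) by ring, Int.mul_ediv_cancel_left _ hp1z]
      rw [e1, e2, e2]
      push_cast
      rfl
    · intro θ hθ
      rw [Finset.mem_erase, coeffPairs, Finset.mem_filter] at hθ
      obtain ⟨j, hj⟩ := hodd
      rcases h.card_kasamiKer_eq_or hq hθ.1 with h' | h' | h'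
      · rw [h.sum_words_even hθ.2.2 (j := 0) (by simpa using h'), h', if_neg hq1.ne]
      · rw [h.sum_words_odd hθ.2.2 (j := j) (by rw [h', hj]), h', if_pos rfl]
        congr 3
        omega
      · have h2 : (p ^ d) ^ 2 ≠ p ^ d := by nlinarith
        rw [h.sum_words_even hθ.2.2 (j := d) (by rw [h', ← pow_mul, mul_comm]), h', if_neg h2]

theorem wordSum_of_even {e : ℕ} (hde : d = 2 * e) : ∃ n₁ n₂ : ℚ,
    n₁ + n₂ + (((p : ℚ) ^ s) ^ 2 - 1) * p ^ s / p ^ d +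
      (((p : ℚ) ^ s) ^ 2 - 1) * (p ^ s - p ^ d) / (((p ^ d) ^ 2 - 1) * p ^ d) = (p ^ s) ^ 3 - 1 ∧
    n₁ - n₂ = (p ^ s) ^ 2 - p ^ s +
      (((p : ℚ) ^ s) ^ 2 - 1) * (p ^ s - p ^ d) / ((p ^ d) ^ 2 - 1) ∧
    ∀ ψ : ℤ → ℚ, wordSum p s τ κ ψ = evenTerm p (p ^ s) ((p ^ s) ^ 2) ψ (p ^ (2 * s - 1)) +
      (n₁ * evenTerm p (p ^ s) 1 ψ (p ^ (s - 1)) + n₂ * evenTerm p (p ^ s) 1 ψ (-p ^ (s - 1)) +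
      (((p : ℚ) ^ s) ^ 2 - 1) * p ^ s / (2 * p ^ d) *
        (evenTerm p (p ^ s) (p ^ d) ψ (p ^ (s - 1 + e)) +
          evenTerm p (p ^ s) (p ^ d) ψ (-p ^ (s - 1 + e))) +
      (((p : ℚ) ^ s) ^ 2 - 1) * (p ^ s - p ^ d) / (((p ^ d) ^ 2 - 1) * p ^ d) *
        evenTerm p (p ^ s) ((p ^ d) ^ 2) ψ (-p ^ (s - 1 + d))) := by
  have hp := (Fact.out : p.Prime)
  have hq := card_fixed_tau hfix hk
  have hq1 : 1 < p ^ d := Nat.one_lt_pow hd.ne' hp.one_lt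
  have hp0 : (p : ℚ) ≠ 0 := by exact_mod_cast hp.ne_zero
  have hp1 : (p : ℚ) - 1 ≠ 0 := by rw [sub_ne_zero]; exact_mod_cast hp.one_lt.ne'
  have hp1z : (p : ℤ) - 1 ≠ 0 := by rw [sub_ne_zero]; exact_mod_cast hp.one_lt.ne'
  have hD0 : (p : ℚ) ^ d ≠ 0 := pow_ne_zero _ hp0
  have hD1 : ((p : ℚ) ^ d) ^ 2 - 1 ≠ 0 := by
    rw [sub_ne_zero, ← pow_mul]; exact_mod_cast h.prime_pow_ne_one (by omega)
  obtain ⟨n₁, n₂, hg⟩ := h.sum_split hq hq1 (pow_lt_pow_card d (by omega))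
  have hg' : ∀ g : ℕ → ℤ → ℚ,
      ∑ θ ∈ (coeffPairs κ).erase 0, g (kasamiKer τ κ θ.1 θ.2).card (formCount p τ κ θ 0) =
        n₁ * g 1 (p ^ (2 * s - 1) + (p - 1) * p ^ (s - 1)) +
        n₂ * g 1 (p ^ (2 * s - 1) - (p - 1) * p ^ (s - 1)) +
        (((p : ℚ) ^ s) ^ 2 - 1) * p ^ s / (2 * p ^ d) *
          (g (p ^ d) (p ^ (2 * s - 1) + (p - 1) * p ^ (s - 1 + e)) +
            g (p ^ d) (p ^ (2 * s - 1) - (p - 1) * p ^ (s - 1 + e))) +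
        (((p : ℚ) ^ s) ^ 2 - 1) * (p ^ s - p ^ d) / (((p ^ d) ^ 2 - 1) * p ^ d) *
          g ((p ^ d) ^ 2) (p ^ (2 * s - 1) - (p - 1) * p ^ (s - 1 + d)) := by
    intro g
    rw [hg g, h.sum_corank_two hd hds hfix hκk hk,
      h.sum_corank_one_of_even hd hds hfix hκk hk hde]
  refine ⟨n₁, n₂, ?_, ?_, fun ψ => ?_⟩
  · have := hg' (fun _ _ => 1)
    rw [Finset.sum_const, nsmul_eq_mul, h.card_coeffPairs_erase] at this
    have hX : (((p : ℚ) ^ s) ^ 2 - 1) * p ^ s / p ^ d =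
        (((p : ℚ) ^ s) ^ 2 - 1) * p ^ s / (2 * p ^ d) * (1 + 1) := by field_simp; ring
    linear_combination -this + hX
  · have h1 := hg' (fun _ N => (N : ℚ) - (p : ℚ) ^ (2 * s - 1))
    simp only [Int.cast_natCast] at h1
    rw [h.sum_formCount_erase] at h1
    push_cast at h1
    have e : (p : ℚ) ^ (s - 1 + d) = p ^ (s - 1) * p ^ d := pow_add _ _ _
    rw [e] at h1
    have hps : (p : ℚ) ^ (s - 1) ≠ 0 := pow_ne_zero _ hp0
    have hY : (((p : ℚ) ^ s) ^ 2 - 1) * (p ^ s - p ^ d) / ((p ^ d) ^ 2 - 1) =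
        (((p : ℚ) ^ s) ^ 2 - 1) * (p ^ s - p ^ d) / (((p ^ d) ^ 2 - 1) * p ^ d) * p ^ d := by
      field_simp
    apply mul_left_cancel₀ (mul_ne_zero hp1 hps)
    linear_combination -h1 - (p - 1) * p ^ (s - 1) * hY
  · have h0 := hg' (fun R N => evenTerm p (p ^ s) R ψ ((N - p ^ (2 * s - 1)) / (p - 1)))
    rw [h.wordSum_eq_of ψ (fun R N => evenTerm p (p ^ s) R ψ ((N - p ^ (2 * s - 1)) / (p - 1)))]
    · rw [h0]
      have e1 : ∀ e, ((p : ℤ) ^ (2 * s - 1) + (p - 1) * p ^ e - p ^ (2 * s - 1)) / (p - 1) =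
          p ^ e := by
        intro e
        rw [add_sub_cancel_left, Int.mul_ediv_cancel_left _ hp1z]
      have e2 : ∀ e, ((p : ℤ) ^ (2 * s - 1) - (p - 1) * p ^ e - p ^ (2 * s - 1)) / (p - 1) =
          -p ^ e := by
        intro e
        rw [show (p : ℤ) ^ (2 * s - 1) - (p - 1) * p ^ e - p ^ (2 * s - 1) =
          (p - 1) * (-p ^ e) by ring, Int.mul_ediv_cancel_left _ hp1z]
      simp only [e1, e2]
      push_cast
      rfl
    · intro θ hθ
      rw [Finset.mem_erase, coeffPairs, Finset.mem_filter] at hθ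
      rcases h.card_kasamiKer_eq_or hq hθ.1 with h' | h' | h'
      · rw [h.sum_words_even hθ.2.2 (j := 0) (by simpa using h')]
      · rw [h.sum_words_even hθ.2.2 (j := e) (by rw [h', hde])]
      · rw [h.sum_words_even hθ.2.2 (j := d) (by rw [h', ← pow_mul, mul_comm])]

end CaseOne

/-! ### The case d' = 2d: three frequencies from three moments. -/

section CaseTwo

variable (hd : 0 < d) (hds : 3 * d ≤ s)
  (hfix : (Finset.univ.filter fun x => τ x = x).card = (p ^ d) ^ 2)
  (hanti : (Finset.univ.filter fun x => τ x = x ∧ κ x = -x).card = p ^ d)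
  (hU : (Finset.univ.filter fun u : K => u ^ (p ^ d + 1) = 1).card = p ^ d + 1)
  (hUκ : ∀ u : K, u ^ (p ^ d + 1) = 1 → u * κ u = 1)
  (hUτ : ∀ u : K, u ^ (p ^ d + 1) = 1 → u * τ (κ u) = 1)
  (hdvd : ((p : ℤ) ^ d + 1) ∣ p ^ s + 1)
include hd hds hfix hanti hU hUκ hUτ hdvd

/-- With all signs forced, one frequency per corank remains. The equations count the forms, sum the
orders of their kernels by double counting, and sum their zero counts. -/
theorem wordSum_of_double : ∃ n₀ n₂ n₄ : ℚ,
    n₀ + n₂ + n₄ = ((p : ℚ) ^ s) ^ 3 - 1 ∧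
    ((p ^ d) ^ 2 - 1) * n₂ + ((p ^ d) ^ 4 - 1) * n₄ =
      (((p : ℚ) ^ s) ^ 2 - 1) * (p ^ s * p ^ d - 1) ∧
    -n₀ + p ^ d * n₂ - (p ^ d) ^ 2 * n₄ = (p ^ s) ^ 2 - p ^ s ∧
    ∀ ψ : ℤ → ℚ, wordSum p s τ κ ψ = evenTerm p (p ^ s) ((p ^ s) ^ 2) ψ (p ^ (2 * s - 1)) +
      (n₀ * evenTerm p (p ^ s) 1 ψ (-p ^ (s - 1)) +
      n₂ * evenTerm p (p ^ s) ((p ^ d) ^ 2) ψ (p ^ (s - 1 + d)) +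
      n₄ * evenTerm p (p ^ s) ((p ^ d) ^ 4) ψ (-p ^ (s - 1 + 2 * d))) := by
  have hp := (Fact.out : p.Prime)
  have hs := h.pos
  have hq1 : 1 < (p ^ d) ^ 2 := by
    rw [← pow_mul]; exact Nat.one_lt_pow (by omega) hp.one_lt
  have hp0 : (p : ℚ) ≠ 0 := by exact_mod_cast hp.ne_zero
  have hp1 : (p : ℚ) - 1 ≠ 0 := by rw [sub_ne_zero]; exact_mod_cast hp.one_lt.ne'
  have hp1z : (p : ℤ) - 1 ≠ 0 := by rw [sub_ne_zero]; exact_mod_cast hp.one_lt.ne'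
  have hqP : ((p ^ d) ^ 2) ^ 2 < (p ^ s) ^ 2 := by
    rw [← pow_mul p d 2]; exact pow_lt_pow_card _ (by omega)
  set C := (coeffPairs κ).erase 0 with hC
  have hor : ∀ θ ∈ C, κ θ.1 = θ.1 ∧ ((kasamiKer τ κ θ.1 θ.2).card = 1 ∨
      (kasamiKer τ κ θ.1 θ.2).card = (p ^ d) ^ 2 ∨
        (kasamiKer τ κ θ.1 θ.2).card = ((p ^ d) ^ 2) ^ 2) := by
    intro θ hθ
    rw [hC, Finset.mem_erase, coeffPairs, Finset.mem_filter] at hθ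
    exact ⟨hθ.2.2, h.card_kasamiKer_eq_or hfix hθ.1⟩
  obtain ⟨n₀, n₂, n₄, key⟩ : ∃ n₀ n₂ n₄ : ℚ, ∀ g : ℕ → ℤ → ℚ,
      ∑ θ ∈ C, g (kasamiKer τ κ θ.1 θ.2).card (formCount p τ κ θ 0) =
      n₀ * g 1 (p ^ (2 * s - 1) - (p - 1) * p ^ (s - 1)) +
      (n₂ * g ((p ^ d) ^ 2) (p ^ (2 * s - 1) + (p - 1) * p ^ (s - 1 + d)) +
      n₄ * g ((p ^ d) ^ 4) (p ^ (2 * s - 1) - (p - 1) * p ^ (s - 1 + 2 * d))) := by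
    refine ⟨((C.filter fun θ => (kasamiKer τ κ θ.1 θ.2).card = 1).card : ℚ),
      ((C.filter fun θ => ¬(kasamiKer τ κ θ.1 θ.2).card = 1).filter
        fun θ => (kasamiKer τ κ θ.1 θ.2).card = (p ^ d) ^ 2).card,
      ((C.filter fun θ => ¬(kasamiKer τ κ θ.1 θ.2).card = 1).filter
        fun θ => ¬(kasamiKer τ κ θ.1 θ.2).card = (p ^ d) ^ 2).card, ?_⟩
    intro g
    rw [sum_eq_card_filter_mul_add C (fun θ => (kasamiKer τ κ θ.1 θ.2).card = 1) _
        (g 1 (p ^ (2 * s - 1) - (p - 1) * p ^ (s - 1))),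
      sum_eq_card_filter_mul_add _ (fun θ => (kasamiKer τ κ θ.1 θ.2).card = (p ^ d) ^ 2) _
        (g ((p ^ d) ^ 2) (p ^ (2 * s - 1) + (p - 1) * p ^ (s - 1 + d)))]
    · congr 2
      rw [← nsmul_eq_mul, ← Finset.sum_const]
      refine Finset.sum_congr rfl fun θ hθ => ?_
      simp only [Finset.mem_filter] at hθ
      obtain ⟨h1, h2⟩ := hor θ hθ.1.1
      have h3 := (h2.resolve_left hθ.1.2).resolve_left hθ.2
      have h4 := h.formCount_of_hermitian hU hUκ hUτ hdvd hd h1 (i := 2)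
        (by rw [h3, ← pow_mul, ← pow_mul]; congr 1; ring)
      rw [h4, h3]
      congr 1
      · ring
      · rw [mul_comm d 2]; ring
    · intro θ hθ h3
      simp only [Finset.mem_filter] at hθ
      obtain ⟨h1, -⟩ := hor θ hθ.1
      have h4 := h.formCount_of_hermitian hU hUκ hUτ hdvd hd h1 (i := 1)
        (by rw [h3, ← pow_mul]; congr 1; ring)
      rw [h4, h3]
      congr 1
      rw [mul_one]; ring
    · intro θ hθ h3
      obtain ⟨h1, -⟩ := hor θ hθ
      have h4 := h.formCount_of_hermitian hU hUκ hUτ hdvd hd h1 (i := 0)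
        (by rw [h3]; simp)
      rw [h4, h3]
      congr 1
      rw [mul_zero, add_zero]; ring
  refine ⟨n₀, n₂, n₄, ?_, ?_, ?_, fun ψ => ?_⟩
  rotate_left 3
  · have h0 := key (fun R N => evenTerm p (p ^ s) R ψ ((N - p ^ (2 * s - 1)) / (p - 1)))
    rw [h.wordSum_eq_of ψ (fun R N => evenTerm p (p ^ s) R ψ ((N - p ^ (2 * s - 1)) / (p - 1)))]
    · rw [h0]
      have e1 : ∀ e, ((p : ℤ) ^ (2 * s - 1) + (p - 1) * p ^ e - p ^ (2 * s - 1)) / (p - 1) =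
          p ^ e := by
        intro e
        rw [add_sub_cancel_left, Int.mul_ediv_cancel_left _ hp1z]
      have e2 : ∀ e, ((p : ℤ) ^ (2 * s - 1) - (p - 1) * p ^ e - p ^ (2 * s - 1)) / (p - 1) =
          -p ^ e := by
        intro e
        rw [show (p : ℤ) ^ (2 * s - 1) - (p - 1) * p ^ e - p ^ (2 * s - 1) =
          (p - 1) * (-p ^ e) by ring, Int.mul_ediv_cancel_left _ hp1z]
      simp only [e1, e2]
      push_cast
      rw [← add_assoc (_ * _)]
    · intro θ hθ
      obtain ⟨h1, h' | h' | h'⟩ := hor θ hθ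
      · rw [h.sum_words_even h1 (j := 0) (by simpa using h')]
      · rw [h.sum_words_even h1 (j := d) (by rw [h', ← pow_mul, mul_comm])]
      · rw [h.sum_words_even h1 (j := 2 * d)
          (by rw [h', ← pow_mul, ← pow_mul]; congr 1; ring)]
  · have := key (fun _ _ => 1)
    rw [Finset.sum_const, nsmul_eq_mul, h.card_coeffPairs_erase] at this
    linear_combination -this
  · have h1 := key (fun R _ => (R : ℚ) - 1)
    have h2 := sum_card_kasamiKer_sub_one h.invol h.comm (fun _ => True) (fun _ _ _ _ => by simp)
    simp only [Finset.filter_true] at h2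
    rw [h.card_filter_op_one hfix hanti, h.card_eq] at h2
    have h3 := congrArg (Nat.cast (R := ℚ)) h2
    have hone : ∀ θ : K × K, 1 ≤ (kasamiKer τ κ θ.1 θ.2).card := fun θ =>
      Finset.card_pos.mpr ⟨0, mem_kasamiKer.mpr (by simp)⟩
    have hP1 : 1 ≤ (p ^ s) ^ 2 := Nat.one_le_pow _ _ (Nat.pow_pos hp.pos)
    push_cast [Nat.cast_sub (hone _), Nat.cast_sub hP1] at h3
    rw [h.sum_coeffPairs, ← hC, h1, Prod.fst_zero, Prod.snd_zero, h.card_kasamiKer_zero] at h3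
    push_cast at h3
    linear_combination h3
  · have h1 := key (fun _ N => (N : ℚ) - (p : ℚ) ^ (2 * s - 1))
    simp only [Int.cast_natCast] at h1
    rw [h.sum_formCount_erase] at h1
    push_cast at h1
    have e1 : (p : ℚ) ^ (s - 1 + d) = p ^ (s - 1) * p ^ d := pow_add _ _ _
    have e2 : (p : ℚ) ^ (s - 1 + 2 * d) = p ^ (s - 1) * (p ^ d) ^ 2 := by
      rw [pow_add, ← pow_mul, mul_comm d]
    rw [e1, e2] at h1
    have hps : (p : ℚ) ^ (s - 1) ≠ 0 := pow_ne_zero _ hp0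
    apply mul_left_cancel₀ (mul_ne_zero hp1 hps)
    linear_combination -h1

end CaseTwo

end KasamiSetting

end WeightDistribution

/-! ### Designs from the words of given weight of a code -/

section CodeDesigns

variable {p n : ℕ} [Fact p.Prime]

theorem mem_wordSupport {w : Fin n → ZMod p} {x : Fin n} : x ∈ wordSupport w ↔ w x ≠ 0 := by
  simp [wordSupport]

theorem card_wordSupport (w : Fin n → ZMod p) : (wordSupport w).card = hammingNorm w := rfl

theorem wordSupport_smul {t : ZMod p} (ht : t ≠ 0) (w : Fin n → ZMod p) :
    wordSupport (t • w) = wordSupport w := by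
  ext x; simp [mem_wordSupport, ht]

/-- At a point of the common support exactly one nonzero t makes f - tg vanish; off the support
every t does. -/
theorem sum_hammingNorm_sub_smul {f g : Fin n → ZMod p} (hfg : wordSupport f = wordSupport g) :
    ∑ t ∈ Finset.univ.erase (0 : ZMod p), hammingNorm (f - t • g) = (p - 2) * hammingNorm g := by
  classical
  have hp := (Fact.out : p.Prime).two_le
  simp only [← card_wordSupport, Finset.card_eq_sum_ones, wordSupport, Finset.sum_filter]
  rw [Finset.sum_comm, Finset.mul_sum]
  refine Finset.sum_congr rfl fun x _ => ?_
  have hx : f x ≠ 0 ↔ g x ≠ 0 := by rw [← mem_wordSupport, hfg, mem_wordSupport]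
  by_cases hg : g x = 0
  · have hf : f x = 0 := not_not.mp fun h => hx.mp h hg
    simp [hf, hg]
  · have hf := hx.mpr hg
    rw [if_pos hg, mul_one, ← Finset.sum_filter, ← Finset.card_eq_sum_ones]
    have : (Finset.univ.erase (0 : ZMod p)).filter (fun t => (f - t • g) x ≠ 0) =
        (Finset.univ.erase (0 : ZMod p)).erase (f x / g x) := by
      ext t
      simp only [Pi.sub_apply, Pi.smul_apply, smul_eq_mul, Finset.mem_filter, Finset.mem_erase,
        Finset.mem_univ, and_true, ne_eq, sub_eq_zero, eq_div_iff hg]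
      constructor
      · rintro ⟨h1, h2⟩; exact ⟨fun h => h2 h.symm, h1⟩
      · rintro ⟨h1, h2⟩; exact ⟨h2, fun h => h1 h.symm⟩
    rw [this, Finset.card_erase_of_mem (by simp [hf, hg]), Finset.card_erase_of_mem (by simp),
      Finset.card_univ, ZMod.card]
    omega

/-- If no nonzero word is too light, words of the same weight and support are proportional. -/
theorem exists_smul_eq_of_wordSupport_eq {D : Submodule (ZMod p) (Fin n → ZMod p)} {i : ℕ}
    (hmin : ∀ w ∈ D, w ≠ 0 → (p - 2) * i < (p - 1) * hammingNorm w)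
    {f g : Fin n → ZMod p} (hf : f ∈ D) (hg : g ∈ D) (hgi : hammingNorm g = i)
    (hfg : wordSupport f = wordSupport g) : ∃ t : ZMod p, t ≠ 0 ∧ f = t • g := by
  by_contra! hne
  have hp := (Fact.out : p.Prime).two_le
  have hcard : (Finset.univ.erase (0 : ZMod p)).card = p - 1 := by
    rw [Finset.card_erase_of_mem (by simp), Finset.card_univ, ZMod.card]
  have h1 := sum_hammingNorm_sub_smul hfg
  -- If f is no multiple of g, all p - 1 words f - tg are nonzero, and their total weight exceeds
  -- the exact value just computed.
  have h2 : ∑ _t ∈ Finset.univ.erase (0 : ZMod p), (p - 2) * i <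
      ∑ t ∈ Finset.univ.erase (0 : ZMod p), (p - 1) * hammingNorm (f - t • g) := by
    refine Finset.sum_lt_sum_of_nonempty (Finset.card_pos.mp (by omega)) fun t ht => ?_
    exact hmin _ (D.sub_mem hf (D.smul_mem t hg))
      (sub_ne_zero.mpr (hne t (Finset.ne_of_mem_erase ht)))
  rw [Finset.sum_const, ← Finset.mul_sum, h1, hcard, smul_eq_mul, hgi] at h2
  exact lt_irrefl _ h2

open Classical in
/-- The number of words of weight `i` whose support contains `T`. -/
noncomputable def wordsThrough (D : Submodule (ZMod p) (Fin n → ZMod p)) (i : ℕ)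
    (T : Finset (Fin n)) : ℕ :=
  (Finset.univ.filter fun w => w ∈ D ∧ hammingNorm w = i ∧ T ⊆ wordSupport w).card

/-- Each fibre of the support map on words of weight i consists of the p - 1 nonzero multiples of
one word. -/
theorem mul_ncard_blocks_through {D : Submodule (ZMod p) (Fin n → ZMod p)} {i : ℕ} (hi : i ≠ 0)
    (hmin : ∀ w ∈ D, w ≠ 0 → (p - 2) * i < (p - 1) * hammingNorm w) (T : Finset (Fin n)) :
    (p - 1) * {b | b ∈ supportBlocks D i ∧ T ⊆ b}.ncard = wordsThrough D i T := by
  classical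
  set W := Finset.univ.filter fun w => w ∈ D ∧ hammingNorm w = i ∧ T ⊆ wordSupport w with hW
  have hset : {b | b ∈ supportBlocks D i ∧ T ⊆ b} = (W.image wordSupport : Set (Finset (Fin n))) := by
    ext b
    simp only [supportBlocks, Set.mem_ofPred_eq, Finset.coe_image, Set.mem_image, Finset.mem_coe,
      hW, Finset.mem_filter, Finset.mem_univ, true_and]
    constructor
    · rintro ⟨⟨w, h1, h2, rfl⟩, h3⟩; exact ⟨w, ⟨h1, h2, h3⟩, rfl⟩
    · rintro ⟨w, ⟨h1, h2, h3⟩, rfl⟩; exact ⟨⟨w, h1, h2, rfl⟩, h3⟩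
  rw [hset, Set.ncard_coe_finset, wordsThrough, ← hW,
    Finset.card_eq_sum_card_image wordSupport W, mul_comm, ← smul_eq_mul, ← Finset.sum_const]
  refine Finset.sum_congr rfl fun b hb => ?_
  obtain ⟨g, hg, rfl⟩ := Finset.mem_image.mp hb
  simp only [hW, Finset.mem_filter, Finset.mem_univ, true_and] at hg
  obtain ⟨hgD, hgi, hgT⟩ := hg
  have hg0 : g ≠ 0 := by rintro rfl; simp at hgi; exact hi hgi.symm
  have hinj : Function.Injective fun t : ZMod p => t • g := smul_left_injective _ hg0
  have hfib : W.filter (fun w => wordSupport w = wordSupport g) =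
      (Finset.univ.erase (0 : ZMod p)).image fun t => t • g := by
    ext f
    simp only [hW, Finset.mem_filter, Finset.mem_univ, true_and, Finset.mem_image,
      Finset.mem_erase, and_true]
    constructor
    · rintro ⟨⟨hf, -, -⟩, hfg⟩
      obtain ⟨t, ht, rfl⟩ := exists_smul_eq_of_wordSupport_eq hmin hf hgD hgi hfg
      exact ⟨t, ht, rfl⟩
    · rintro ⟨t, ht, rfl⟩
      have e := wordSupport_smul ht g
      refine ⟨⟨D.smul_mem t hgD, ?_, by rwa [e]⟩, e⟩
      rw [← card_wordSupport, e, card_wordSupport, hgi]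
  rw [hfib, Finset.card_image_of_injective _ hinj, Finset.card_erase_of_mem (by simp),
    Finset.card_univ, ZMod.card]

/-- Both sides count words of weight i together with an ordered pair of distinct points of the
support. -/
theorem sum_wordsThrough (D : Submodule (ZMod p) (Fin n → ZMod p)) (i : ℕ) :
    ∑ z ∈ (Finset.univ : Finset (Fin n)).offDiag, wordsThrough D i {z.1, z.2} =
      wordsThrough D i ∅ * (i * (i - 1)) := by
  classical
  simp only [wordsThrough, Finset.card_eq_sum_ones, Finset.sum_filter, Finset.sum_mul]
  rw [Finset.sum_comm]
  refine Finset.sum_congr rfl fun w _ => ?_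
  by_cases hw : w ∈ D ∧ hammingNorm w = i
  · have e : ∀ z : Fin n × Fin n, ({z.1, z.2} ⊆ wordSupport w) ↔
        z.1 ∈ wordSupport w ∧ z.2 ∈ wordSupport w := fun z => by
      rw [Finset.insert_subset_iff, Finset.singleton_subset_iff]
    simp only [hw, true_and, e, Finset.empty_subset, if_true, one_mul]
    rw [← Finset.sum_filter, ← Finset.card_eq_sum_ones]
    have : (Finset.univ : Finset (Fin n)).offDiag.filter
        (fun z => z.1 ∈ wordSupport w ∧ z.2 ∈ wordSupport w) = (wordSupport w).offDiag := by
      ext z; simp only [Finset.mem_filter, Finset.mem_offDiag, Finset.mem_univ, true_and]; tauto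
    rw [this, Finset.offDiag_card, card_wordSupport, hw.2, Nat.mul_sub, mul_one]
  · have h1 : ∀ T : Finset (Fin n), ¬(w ∈ D ∧ hammingNorm w = i ∧ T ⊆ wordSupport w) :=
      fun T h => hw ⟨h.1, h.2.1⟩
    simp only [h1, if_false, Finset.sum_const_zero, zero_mul]

theorem wordsThrough_le_of_perm {D : Submodule (ZMod p) (Fin n → ZMod p)} (i : ℕ)
    {σ : Equiv.Perm (Fin n)} (hσ : ∀ w ∈ D, w ∘ σ ∈ D) (x y : Fin n) :
    wordsThrough D i {σ x, σ y} ≤ wordsThrough D i {x, y} := by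
  classical
  refine Finset.card_le_card_of_injOn (fun w => w ∘ σ) ?_ ?_
  · intro w hw
    simp only [Finset.coe_filter, Finset.mem_univ, true_and, Set.mem_ofPred_eq,
      Finset.insert_subset_iff, Finset.singleton_subset_iff, mem_wordSupport] at hw ⊢
    refine ⟨hσ w hw.1, ?_, hw.2.2⟩
    rw [← hw.2.1]
    exact Finset.card_equiv σ (by simp)
  · intro w _ w' _ h
    funext z
    simpa using congrFun h (σ.symm z)

/-- The supports of the words of weight `i` form a `2`-design if the code is invariant under a
doubly transitive set of permutations and has no nonzero word that is too light. -/
theorem exists_isDesign {D : Submodule (ZMod p) (Fin n → ZMod p)} {v i : ℕ} (hv : n = v)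
    (hi : 2 ≤ i)
    (hmin : ∀ w ∈ D, w ≠ 0 → (p - 2) * i < (p - 1) * hammingNorm w)
    (htrans : ∀ x y x' y' : Fin n, x ≠ y → x' ≠ y' →
      ∃ σ : Equiv.Perm (Fin n), σ x = x' ∧ σ y = y' ∧ ∀ w ∈ D, w ∘ σ ∈ D)
    (hpos : wordsThrough D i ∅ ≠ 0) :
    (∃ c ∈ D, hammingNorm c = i) ∧ ∃ lam : ℕ,
      lam * (v * (v - 1)) * (p - 1) = wordsThrough D i ∅ * (i * (i - 1)) ∧
        IsDesign 2 v i lam (supportBlocks D i) := by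
  classical
  subst hv
  obtain ⟨w, hw⟩ := Finset.card_pos.mp (Nat.pos_of_ne_zero hpos)
  simp only [Finset.mem_filter, Finset.mem_univ, true_and] at hw
  have hin : i ≤ n := by
    rw [← hw.2.1]
    simpa using hammingNorm_le_card_fintype (x := w)
  refine ⟨⟨w, hw.1, hw.2.1⟩, ?_⟩
  have hp1 : 0 < p - 1 := by have := (Fact.out : p.Prime).two_le; omega
  have hi0 : i ≠ 0 := by omega
  set x₀ : Fin n := ⟨0, by omega⟩
  set y₀ : Fin n := ⟨1, by omega⟩
  have hxy : x₀ ≠ y₀ := by simp [x₀, y₀, Fin.ext_iff]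
  set lam := {b | b ∈ supportBlocks D i ∧ {x₀, y₀} ⊆ b}.ncard with hlam
  have hconst : ∀ x y : Fin n, x ≠ y → {b | b ∈ supportBlocks D i ∧ {x, y} ⊆ b}.ncard = lam := by
    intro x y hne
    apply Nat.eq_of_mul_eq_mul_left hp1
    rw [hlam, mul_ncard_blocks_through hi0 hmin, mul_ncard_blocks_through hi0 hmin]
    obtain ⟨σ, rfl, rfl, h1⟩ := htrans x₀ y₀ x y hxy hne
    -- A permutation of the code gives only an inequality; a second one carrying the pair back gives
    -- the reverse.
    obtain ⟨ρ, h2, h3, h4⟩ := htrans (σ x₀) (σ y₀) x₀ y₀ hne hxy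
    refine le_antisymm (wordsThrough_le_of_perm i h1 _ _) ?_
    have := wordsThrough_le_of_perm i h4 (σ x₀) (σ y₀)
    rwa [h2, h3] at this
  refine ⟨lam, ?_, one_le_two, hi, hin, Fintype.card_fin n, ?_, ?_⟩
  · rw [← sum_wordsThrough]
    have : ∀ z ∈ (Finset.univ : Finset (Fin n)).offDiag, wordsThrough D i {z.1, z.2} =
        (p - 1) * lam := by
      intro z hz
      rw [← mul_ncard_blocks_through hi0 hmin, hconst _ _ (Finset.mem_offDiag.mp hz).2.2]
    rw [Finset.sum_congr rfl this, Finset.sum_const, Finset.offDiag_card, Finset.card_univ,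
      Fintype.card_fin, smul_eq_mul, ← Nat.mul_sub_one]
    ring
  · rintro b ⟨c, -, h1, rfl⟩
    exact h1
  · intro T hT
    obtain ⟨x, y, hne, rfl⟩ := Finset.card_eq_two.mp hT
    exact hconst x y hne

end CodeDesigns

/-! ### Duals, extensions and cyclic codes -/

section CodeGeneralities

variable {F : Type*} [Field F] {n : ℕ}

theorem mem_dualCode {D : Submodule F (Fin n → F)} {c : Fin n → F} :
    c ∈ dualCode D ↔ ∀ u ∈ D, ∑ i, c i * u i = 0 := Iff.rfl

theorem dualCode_dualCode (D : Submodule F (Fin n → F)) : dualCode (dualCode D) = D := by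
  have hsymm : ∀ u v : Fin n → F, dotProductBilin F F u v = dotProductBilin F F v u :=
    fun u v => dotProduct_comm u v
  have hnd : LinearMap.BilinForm.Nondegenerate
      (dotProductBilin F F : LinearMap.BilinForm F (Fin n → F)) := by
    refine ⟨fun u hu => dotProduct_eq_zero u hu, fun u hu => dotProduct_eq_zero u fun v => ?_⟩
    rw [dotProduct_comm]
    exact hu v
  have hrefl : LinearMap.IsRefl (dotProductBilin F F : LinearMap.BilinForm F (Fin n → F)) :=
    fun u v huv => by rw [hsymm, huv]
  have hdual : ∀ E : Submodule F (Fin n → F), dualCode E =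
      LinearMap.BilinForm.orthogonal (dotProductBilin F F) E := by
    intro E
    ext c
    rw [mem_dualCode, LinearMap.BilinForm.mem_orthogonal_iff]
    refine forall₂_congr fun u _ => ?_
    rw [← hsymm c u]
    rfl
  rw [hdual, hdual, LinearMap.BilinForm.orthogonal_orthogonal hnd hrefl]

/-- Against a word of coordinate sum zero only the differences from the last coordinate of w matter,
and every dual word extends to such a word. The differences must therefore lie in the bidual of D.
-/
theorem mem_dualCode_extendedCode_dualCode {D : Submodule F (Fin n → F)} {w : Fin (n + 1) → F} :
    w ∈ dualCode (extendedCode (dualCode D)) ↔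
      (fun i : Fin n => w i.castSucc - w (Fin.last n)) ∈ D := by
  conv_rhs => rw [← dualCode_dualCode D]
  rw [mem_dualCode, mem_dualCode]
  have hsum : ∀ u : Fin (n + 1) → F, ∑ i, u i = 0 → ∑ i, w i * u i =
      ∑ i : Fin n, (w i.castSucc - w (Fin.last n)) * u i.castSucc := by
    intro u hu
    rw [Fin.sum_univ_castSucc] at hu ⊢
    simp only [sub_mul, Finset.sum_sub_distrib, ← Finset.mul_sum]
    linear_combination w (Fin.last n) * hu
  constructor
  · intro h v hv
    have hu : ∑ i, (Fin.snoc (α := fun _ => F) v (-∑ i, v i) : Fin (n + 1) → F) i = 0 := by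
      simp [Fin.sum_univ_castSucc]
    have := h (Fin.snoc (α := fun _ => F) v (-∑ i, v i)) ⟨by simpa using hv, hu⟩
    rw [hsum _ hu] at this
    simpa using this
  · rintro h u ⟨hu, hu0⟩
    rw [hsum u hu0]
    exact h _ hu

/-- The polynomial with the given coefficients. -/
noncomputable def wordPolynomial (c : Fin n → F) : F[X] := ∑ i : Fin n, C (c i) * X ^ (i : ℕ)

theorem coeff_wordPolynomial (c : Fin n → F) (i : Fin n) : (wordPolynomial c).coeff i = c i := by
  simp only [wordPolynomial, finsetSum_coeff, coeff_C_mul, coeff_X_pow, Fin.val_inj]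
  simp

theorem degree_wordPolynomial_lt (c : Fin n → F) : (wordPolynomial c).degree < n := by
  refine (degree_sum_le _ _).trans_lt ((Finset.sup_lt_iff (WithBot.bot_lt_coe n)).mpr fun i _ => ?_)
  exact (degree_C_mul_X_pow_le _ _).trans_lt (Nat.cast_lt.mpr i.2)

theorem aeval_wordPolynomial {K : Type*} [Field K] [Algebra F K] (c : Fin n → F) (β : K) :
    aeval β (wordPolynomial c) = ∑ i : Fin n, algebraMap F K (c i) * β ^ (i : ℕ) := by
  simp [wordPolynomial]

theorem mem_cyclicCodeOfParityCheck {h : F[X]} {c : Fin n → F} :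
    c ∈ cyclicCodeOfParityCheck n h ↔ (X ^ n - 1) /ₘ h ∣ wordPolynomial c := Iff.rfl

theorem divByMonic_mul_eq {h : F[X]} (hm : h.Monic) (hd : h ∣ X ^ n - 1) :
    h * ((X ^ n - 1) /ₘ h) = X ^ n - 1 := by
  have := modByMonic_add_div (X ^ n - 1) h
  rwa [(modByMonic_eq_zero_iff_dvd hm).mpr hd, zero_add] at this

/-- A word polynomial is the generator times a quotient of degree below that of h, so deg h
coefficients determine it. -/
theorem card_cyclicCodeOfParityCheck_le [Fintype F] (hn : 0 < n) {h : F[X]} (hm : h.Monic)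
    (hd : h ∣ X ^ n - 1) :
    Nat.card (cyclicCodeOfParityCheck n h) ≤ Fintype.card F ^ h.natDegree := by
  set g := (X ^ n - 1) /ₘ h with hg
  have hgh : h * g = X ^ n - 1 := divByMonic_mul_eq hm hd
  have hX : (X ^ n - 1 : F[X]).Monic := monic_X_pow_sub_C 1 hn.ne'
  have hgm : g.Monic := hm.of_mul_monic_left (hgh ▸ hX)
  have hdeg : h.natDegree + g.natDegree = n := by
    rw [← hm.natDegree_mul hgm, hgh]
    exact natDegree_X_pow_sub_C
  have hq : ∀ c ∈ cyclicCodeOfParityCheck n h, g * (wordPolynomial c /ₘ g) = wordPolynomial c := by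
    intro c hc
    have := modByMonic_add_div (wordPolynomial c) g
    rwa [(modByMonic_eq_zero_iff_dvd hgm).mpr (mem_cyclicCodeOfParityCheck.mp hc), zero_add] at this
  have hqd : ∀ c ∈ cyclicCodeOfParityCheck n h,
      ∀ i, h.natDegree ≤ i → (wordPolynomial c /ₘ g).coeff i = 0 := by
    intro c hc i hi
    by_contra hne
    have h0 : wordPolynomial c /ₘ g ≠ 0 := fun h0 => hne (by rw [h0, coeff_zero])
    have h1 := le_natDegree_of_ne_zero hne
    have h2 := degree_wordPolynomial_lt c
    rw [← hq c hc, degree_eq_natDegree (mul_ne_zero hgm.ne_zero h0),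
      natDegree_mul hgm.ne_zero h0] at h2
    have h3 : g.natDegree + (wordPolynomial c /ₘ g).natDegree < n := by exact_mod_cast h2
    omega
  have : Function.Injective fun (c : cyclicCodeOfParityCheck n h) (i : Fin h.natDegree) =>
      (wordPolynomial c.1 /ₘ g).coeff i := by
    intro c c' hcc
    have e : wordPolynomial c.1 /ₘ g = wordPolynomial c'.1 /ₘ g := by
      ext i
      rcases lt_or_ge i h.natDegree with hi | hi
      · exact congrFun hcc ⟨i, hi⟩
      · rw [hqd _ c.2 i hi, hqd _ c'.2 i hi]
    have e2 : wordPolynomial c.1 = wordPolynomial c'.1 := by rw [← hq _ c.2, e, hq _ c'.2]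
    apply Subtype.ext
    funext i
    rw [← coeff_wordPolynomial c.1, e2, coeff_wordPolynomial]
  calc Nat.card (cyclicCodeOfParityCheck n h)
      ≤ Nat.card (Fin h.natDegree → F) := Nat.card_le_card_of_injective _ this
    _ = Fintype.card F ^ h.natDegree := by simp

/-- At an n-th root of unity β that is no zero of h, the word polynomial is a sum over the Galois
group of multiples of geometric sums with ratio β/σ(γ) ≠ 1, which vanish. So X^n - 1 divides h times
the word polynomial, and h cancels. -/
theorem trace_mem_cyclicCodeOfParityCheck {K : Type*} [Field K] [Algebra F K]
    [FiniteDimensional F K] [IsGalois F K] (hn : 0 < n) {α : K} (hα : IsPrimitiveRoot α n)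
    {h : F[X]} (hm : h.Monic) (hd : h ∣ X ^ n - 1) {γ : K} (hγ : γ ^ n = 1)
    (hγh : minpoly F γ ∣ h) (a : K) :
    (fun j : Fin n => Algebra.trace F K (a * (γ ^ (j : ℕ))⁻¹)) ∈ cyclicCodeOfParityCheck n h := by
  classical
  set c : Fin n → F := fun j : Fin n => Algebra.trace F K (a * (γ ^ (j : ℕ))⁻¹) with hc
  rw [mem_cyclicCodeOfParityCheck]
  have hroot : ∀ β ∈ nthRootsFinset n (1 : K),
      aeval β (h * wordPolynomial c) = 0 := by
    intro β hβ
    rw [mem_nthRootsFinset hn] at hβ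
    by_cases hh : aeval β h = 0
    · rw [map_mul, hh, zero_mul]
    rw [map_mul, aeval_wordPolynomial]
    have hz : ∀ σ : Gal(K/F), ∑ j : Fin n, (σ γ⁻¹ * β) ^ (j : ℕ) = 0 := by
      intro σ
      have hne : σ γ⁻¹ * β ≠ 1 := by
        intro h1
        have hβσ : β = σ γ := by
          have : σ γ ≠ 0 := by
            rw [ne_eq, EmbeddingLike.map_eq_zero_iff]
            rintro rfl
            rw [zero_pow hn.ne'] at hγ
            exact zero_ne_one hγ
          rw [map_inv₀] at h1
          field_simp at h1
          exact h1
        apply hh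
        obtain ⟨q, rfl⟩ := hγh
        rw [map_mul, hβσ, ← AlgEquiv.coe_toAlgHom, aeval_algHom_apply, minpoly.aeval, map_zero, zero_mul]
      have hpow : (σ γ⁻¹ * β) ^ n = 1 := by
        rw [mul_pow, hβ, mul_one, ← map_pow, inv_pow, hγ, inv_one, map_one]
      rw [Fin.sum_univ_eq_sum_range (fun j => (σ γ⁻¹ * β) ^ j)]
      have := mul_neg_geom_sum (σ γ⁻¹ * β) n
      rw [hpow, sub_self] at this
      exact (mul_eq_zero.mp this).resolve_left (sub_ne_zero.mpr hne.symm)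
    have : ∑ j : Fin n, algebraMap F K (c j) * β ^ (j : ℕ) =
        ∑ σ : Gal(K/F), σ a * ∑ j : Fin n, (σ γ⁻¹ * β) ^ (j : ℕ) := by
      simp only [hc, trace_eq_sum_automorphisms, Finset.mul_sum, Finset.sum_mul]
      rw [Finset.sum_comm]
      refine Finset.sum_congr rfl fun σ _ => Finset.sum_congr rfl fun j _ => ?_
      rw [map_mul, mul_pow, ← map_pow, inv_pow, mul_assoc]
    rw [this, Finset.sum_eq_zero fun σ _ => by rw [hz, mul_zero], mul_zero]
  have hdvd : (X ^ n - 1 : F[X]) ∣ h * wordPolynomial c := by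
    rw [← map_dvd_map' (algebraMap F K)]
    have : (X ^ n - 1 : F[X]).map (algebraMap F K) = X ^ n - 1 := by simp
    rw [this, X_pow_sub_one_eq_prod hn hα]
    refine Finset.prod_dvd_of_coprime ?_ fun β hβ => ?_
    · intro x _ y _ hxy
      exact pairwise_coprime_X_sub_C Function.injective_id hxy
    · rw [dvd_iff_isRoot, IsRoot, eval_map_algebraMap]
      exact hroot β hβ
  rw [← divByMonic_mul_eq hm hd] at hdvd
  exact (mul_dvd_mul_iff_left hm.ne_zero).mp hdvd

end CodeGeneralities

/-! ### The Kasami code consists of trace words -/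

section TraceWords

variable {p s l : ℕ} [Fact p.Prime] {K : Type*} [Field K] [Algebra (ZMod p) K]
  [Fintype K] [DecidableEq K] {τ κ : K ≃+* K}

namespace KasamiSetting

variable (h : KasamiSetting p s τ κ)
include h

theorem finrank_eq : Module.finrank (ZMod p) K = 2 * s := by
  have h1 := Module.natCard_eq_pow_finrank (K := ZMod p) (V := K)
  rw [Nat.card_eq_fintype_card, h.card_eq, Nat.card_zmod, ← pow_mul, mul_comm] at h1
  exact (Nat.pow_right_injective (Fact.out : p.Prime).two_le h1).symm

theorem absTrace_two_mul (y : K) :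
    absTrace p (2 * s) y = algebraMap (ZMod p) K (Algebra.trace (ZMod p) K y) := by
  rw [FiniteField.algebraMap_trace_eq_sum_pow, h.finrank_eq, Nat.card_zmod]
  rfl

/-- For a fixed element of `κ` the second half of the 2s conjugates repeats the first, so the full
trace is twice the half trace. -/
theorem absTrace_of_fixed {y : K} (hy : κ y = y) :
    absTrace p s y = algebraMap (ZMod p) K (Algebra.trace (ZMod p) K (y / 2)) := by
  have h2 := h.two_ne_zero'
  have hκ : y ^ p ^ s = y := by rw [← h.apply_eq, hy]
  have h1 : absTrace p (2 * s) y = 2 * absTrace p s y := by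
    rw [absTrace, two_mul s, Finset.sum_range_add, two_mul, absTrace]
    congr 1
    refine Finset.sum_congr rfl fun i _ => ?_
    rw [pow_add, pow_mul, hκ]
  rw [h.absTrace_two_mul] at h1
  have h3 := trace_two_mul (p := p) (y / 2)
  rw [mul_div_cancel₀ y h2] at h3
  rw [h3, map_mul, map_ofNat] at h1
  exact (mul_left_cancel₀ h2 h1).symm

theorem fixed_pow_succ (x : K) : κ (x ^ (p ^ s + 1)) = x ^ (p ^ s + 1) := by
  rw [pow_succ, ← h.apply_eq, map_mul, h.invol, mul_comm]

variable (hτ : ∀ x, τ (κ x) = x ^ p ^ l)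
include hτ

theorem kasamiWord_eq (θ : K × K) (c : K) (r : ZMod p) (x : K) : kasamiWord p τ κ θ c r x =
    Algebra.trace (ZMod p) K (θ.1 * x ^ (p ^ s + 1)) +
      Algebra.trace (ZMod p) K (2 * θ.2 * x ^ (p ^ l + 1)) + Algebra.trace (ZMod p) K (c * x) +
        r := by
  have e : 2 * θ.2 * x ^ (p ^ l + 1) = 2 * (x * x ^ p ^ l) * θ.2 := by ring
  rw [kasamiWord, h.primeForm_self, hτ, h.apply_eq, e, pow_succ']

theorem mem_traceWords_iff {n : ℕ} (x : Fin n → K) (w : Fin n → ZMod p) :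
    w ∈ traceWords p s l x ↔
      ∃ (θ : K × K) (c : K) (r : ZMod p), κ θ.1 = θ.1 ∧ ∀ j, w j = kasamiWord p τ κ θ c r (x j) := by
  have h2 := h.two_ne_zero'
  have hinj : Function.Injective (algebraMap (ZMod p) K) := (algebraMap (ZMod p) K).injective
  have key : ∀ (a b c : K) (r : ZMod p) (y : K), κ a = a →
      absTrace p s (a * y ^ (p ^ s + 1)) + absTrace p (2 * s) (b * y ^ (p ^ l + 1) + c * y) +
        algebraMap (ZMod p) K r = algebraMap (ZMod p) K (kasamiWord p τ κ (a / 2, b / 2) c r y) := by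
    intro a b c r y ha
    have e1 : a / 2 * y ^ (p ^ s + 1) = a * y ^ (p ^ s + 1) / 2 := by ring
    have e2 : 2 * (b / 2) * y ^ (p ^ l + 1) = b * y ^ (p ^ l + 1) := by field_simp
    rw [h.absTrace_of_fixed (by rw [map_mul, ha, h.fixed_pow_succ]), h.absTrace_two_mul,
      h.kasamiWord_eq hτ, e1, e2]
    simp only [map_add]
    ring
  constructor
  · rintro ⟨a, b, c, r, ha, hw⟩
    have ha' : κ a = a := by rw [h.apply_eq, ha]
    refine ⟨(a / 2, b / 2), c, r, by simp only [map_div₀, ha', map_ofNat], fun j => hinj ?_⟩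
    rw [hw, key _ _ _ _ _ ha']
  · rintro ⟨θ, c, r, hθ, hw⟩
    refine ⟨2 * θ.1, 2 * θ.2, c, r, by rw [← h.apply_eq, map_mul, hθ, map_ofNat], fun j => ?_⟩
    rw [key _ _ _ _ _ (by rw [map_mul, hθ, map_ofNat]), hw, mul_div_cancel_left₀ _ h2,
      mul_div_cancel_left₀ _ h2]

variable {q : ℕ} (hq : (Finset.univ.filter fun x => τ x = x).card = q) (hq1 : 1 < q)
  (hqP : q ^ 2 < (p ^ s) ^ 2) {α : K} (hα : IsPrimitiveRoot α (p ^ (2 * s) - 1))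

omit hτ in
theorem card_sub_one_pos : 0 < p ^ (2 * s) - 1 :=
  Nat.sub_pos_of_lt (Nat.one_lt_pow (by have := h.pos; omega) (Fact.out : p.Prime).one_lt)

include hα

omit hτ in
theorem exists_pow_eq {x : K} (hx : x ≠ 0) : ∃ i < p ^ (2 * s) - 1, α ^ i = x := by
  have : NeZero (p ^ (2 * s) - 1) := ⟨h.card_sub_one_pos.ne'⟩
  apply hα.eq_pow_of_pow_eq_one
  have := FiniteField.pow_card_sub_one_eq_one x hx
  rwa [h.card_eq, ← pow_mul, mul_comm] at this

omit hτ in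
/-- Conjugate powers of a primitive element give conjugate power functions. -/
theorem exists_trace_mul_pow_eq {u v : ℕ} (hu : u ≠ 0) (hv : v ≠ 0)
    (huv : minpoly (ZMod p) (α ^ u) = minpoly (ZMod p) (α ^ v)) :
    ∃ σ : K ≃+* K, ∀ b x : K, Algebra.trace (ZMod p) K (σ b * x ^ v) =
      Algebra.trace (ZMod p) K (b * x ^ u) := by
  have hconj : IsConjRoot (ZMod p) (α ^ u) (α ^ v) := huv
  obtain ⟨σ, hσ⟩ := hconj.symm.exists_algEquiv
  refine ⟨σ, fun b x => ?_⟩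
  have hx : x ^ v = σ (x ^ u) := by
    by_cases hx0 : x = 0
    · rw [hx0, zero_pow hu, zero_pow hv, map_zero]
    · obtain ⟨i, -, rfl⟩ := h.exists_pow_eq hα hx0
      rw [← pow_mul, mul_comm, pow_mul, ← hσ, ← map_pow, ← pow_mul, mul_comm, pow_mul]
  change Algebra.trace (ZMod p) K (σ b * x ^ v) = _
  rw [hx, ← map_mul, Algebra.trace_eq_of_algEquiv]

include hq hq1 hqP

/-- Equal minimal polynomials would identify two power functions under the trace up to a conjugation
of coefficients, and produce a vanishing word with nonzero coefficients. -/
theorem minpoly_ne : minpoly (ZMod p) α ≠ minpoly (ZMod p) (α ^ (p ^ s + 1)) ∧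
    minpoly (ZMod p) α ≠ minpoly (ZMod p) (α ^ (p ^ l + 1)) ∧
    minpoly (ZMod p) (α ^ (p ^ s + 1)) ≠ minpoly (ZMod p) (α ^ (p ^ l + 1)) := by
  refine ⟨fun he => ?_, fun he => ?_, fun he => ?_⟩
  · obtain ⟨σ, hσ⟩ := h.exists_trace_mul_pow_eq hα (u := 1) (v := p ^ s + 1) one_ne_zero
      (Nat.succ_ne_zero _) (by rwa [pow_one])
    have := (h.eq_zero_of_kasamiWord_eq_zero hq hq1 hqP (θ := (1, 0)) (c := -1) (r := 0)
      (map_one κ) fun x => ?_).1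
    · simp at this
    · have := hσ 1 x
      rw [h.kasamiWord_eq hτ]
      rw [map_one, one_mul, one_mul, pow_one] at this
      rw [one_mul, this]
      simp
  · obtain ⟨σ, hσ⟩ := h.exists_trace_mul_pow_eq hα (u := 1) (v := p ^ l + 1) one_ne_zero
      (Nat.succ_ne_zero _) (by rwa [pow_one])
    have := (h.eq_zero_of_kasamiWord_eq_zero hq hq1 hqP (θ := (0, 1)) (c := -2) (r := 0)
      (map_zero κ) fun x => ?_).1
    · simp at this
    · have := hσ 2 x
      rw [h.kasamiWord_eq hτ]
      rw [map_ofNat] at this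
      simp [this]
  · obtain ⟨σ, hσ⟩ := h.exists_trace_mul_pow_eq hα (Nat.succ_ne_zero _) (Nat.succ_ne_zero _) he
    have := (h.eq_zero_of_kasamiWord_eq_zero hq hq1 hqP (θ := (-2, 1)) (c := 0) (r := 0)
      (by rw [map_neg, map_ofNat]) fun x => ?_).1
    · simp at this
    · have := hσ 2 x
      rw [h.kasamiWord_eq hτ]
      rw [map_ofNat] at this
      simp [this]

omit hτ hq hq1 hqP hα in
-- The field generated by y consists of fixed elements of `κ`, so its order is at most p^s.
theorem natDegree_minpoly_le {y : K} (hy : κ y = y) : (minpoly (ZMod p) y).natDegree ≤ s := by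
  have hint : IsIntegral (ZMod p) y := Algebra.IsIntegral.isIntegral y
  have hfix : ∀ x ∈ IntermediateField.adjoin (ZMod p) {y}, κ x = x := by
    intro x hx
    induction hx using IntermediateField.adjoin_induction with
    | mem x hx => rw [Set.mem_singleton_iff.mp hx, hy]
    | algebraMap r => exact ringEquiv_algebraMap_zmod κ r
    | add x y _ _ hx hy => rw [map_add, hx, hy]
    | inv x _ hx => rw [map_inv₀, hx]
    | mul x y _ _ hx hy => rw [map_mul, hx, hy]
  have h1 := Module.natCard_eq_pow_finrank (K := ZMod p)
    (V := IntermediateField.adjoin (ZMod p) {y})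
  rw [IntermediateField.adjoin.finrank hint, Nat.card_zmod] at h1
  have h2 : Nat.card (IntermediateField.adjoin (ZMod p) {y}) ≤ p ^ s := by
    rw [← h.card_fixed, ← Fintype.card_subtype, ← Nat.card_eq_fintype_card]
    exact Nat.card_le_card_of_injective
      (fun x => (⟨x.1, hfix x.1 x.2⟩ : {x : K // κ x = x}))
      fun x y hxy => Subtype.ext (Subtype.mk.inj hxy)
  rw [h1] at h2
  exact (Nat.pow_le_pow_iff_right (Fact.out : p.Prime).one_lt).mp h2

variable (p s l α) in
omit h hτ hq hq1 hqP hα [Fintype K] [DecidableEq K] in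
/-- The parity-check polynomial of the Kasami code. -/
noncomputable def parityPolynomial : (ZMod p)[X] :=
  minpoly (ZMod p) α * minpoly (ZMod p) (α ^ (p ^ s + 1)) * minpoly (ZMod p) (α ^ (p ^ l + 1))

omit hτ hq hq1 hqP hα h [DecidableEq K] in
theorem monic_parityPolynomial : (parityPolynomial p s l α).Monic :=
  ((minpoly.monic (Algebra.IsIntegral.isIntegral _)).mul
    (minpoly.monic (Algebra.IsIntegral.isIntegral _))).mul
      (minpoly.monic (Algebra.IsIntegral.isIntegral _))

omit hτ hq hq1 hqP hα in
theorem natDegree_parityPolynomial_le : (parityPolynomial p s l α).natDegree ≤ 5 * s := by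
  have h1 : (minpoly (ZMod p) α).natDegree ≤ _ := minpoly.natDegree_le α
  have h2 : (minpoly (ZMod p) (α ^ (p ^ l + 1))).natDegree ≤ _ := minpoly.natDegree_le _
  have h3 := h.natDegree_minpoly_le (h.fixed_pow_succ α)
  rw [h.finrank_eq] at h1 h2
  refine (natDegree_mul_le.trans (Nat.add_le_add_right natDegree_mul_le _)).trans ?_
  omega

theorem parityPolynomial_dvd : parityPolynomial p s l α ∣ X ^ (p ^ (2 * s) - 1) - 1 := by
  obtain ⟨h1, h2, h3⟩ := h.minpoly_ne hτ hq hq1 hqP hα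
  have hcop : ∀ y z : K, minpoly (ZMod p) y ≠ minpoly (ZMod p) z →
      IsCoprime (minpoly (ZMod p) y) (minpoly (ZMod p) z) := by
    intro y z hne
    have hy : IsIntegral (ZMod p) y := Algebra.IsIntegral.isIntegral y
    have hz : IsIntegral (ZMod p) z := Algebra.IsIntegral.isIntegral z
    refine ((minpoly.irreducible hy).coprime_iff_not_dvd).mpr fun hd => hne ?_
    exact eq_of_monic_of_associated (minpoly.monic hy) (minpoly.monic hz)
      ((minpoly.irreducible hy).associated_of_dvd (minpoly.irreducible hz) hd)
  have hdvd : ∀ u : ℕ, minpoly (ZMod p) (α ^ u) ∣ X ^ (p ^ (2 * s) - 1) - 1 := by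
    intro u
    apply minpoly.dvd
    simp only [map_sub, map_pow, aeval_X, map_one]
    rw [← pow_mul, mul_comm, pow_mul, hα.pow_eq_one, one_pow, sub_self]
  have hdvd1 := hdvd 1
  rw [pow_one] at hdvd1
  exact ((hcop _ _ h2).mul_left (hcop _ _ h3)).mul_dvd
    ((hcop _ _ h1).mul_dvd hdvd1 (hdvd _)) (hdvd _)

theorem kasamiWord_mem_kasamiCyclicCode (θ : K × K) (c : K) :
    (fun j : Fin (p ^ (2 * s) - 1) => kasamiWord p τ κ θ c 0 (α ^ (j : ℕ))⁻¹) ∈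
      kasamiCyclicCode p s l α := by
  have hmem : ∀ (u : ℕ) (a : K), minpoly (ZMod p) (α ^ u) ∣ parityPolynomial p s l α →
      (fun j : Fin (p ^ (2 * s) - 1) =>
        Algebra.trace (ZMod p) K (a * ((α ^ (j : ℕ))⁻¹) ^ u)) ∈ kasamiCyclicCode p s l α := by
    intro u a hu
    have := trace_mem_cyclicCodeOfParityCheck h.card_sub_one_pos hα
      (monic_parityPolynomial (p := p) (s := s) (l := l) (α := α))
      (h.parityPolynomial_dvd hτ hq hq1 hqP hα) (γ := α ^ u)
      (by rw [← pow_mul, mul_comm, pow_mul, hα.pow_eq_one, one_pow]) hu a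
    have e : ∀ j : ℕ, ((α ^ j)⁻¹) ^ u = ((α ^ u) ^ j)⁻¹ := fun j => by
      rw [inv_pow, ← pow_mul, ← pow_mul, mul_comm]
    simp only [e]
    exact this
  have h1 := hmem 1 c (by
    rw [pow_one, parityPolynomial, mul_assoc]; exact dvd_mul_right _ _)
  have h2 := hmem (p ^ s + 1) θ.1 ((dvd_mul_left _ _).mul_right _)
  have h3 := hmem (p ^ l + 1) (2 * θ.2) (dvd_mul_left _ _)
  convert Submodule.add_mem _ (Submodule.add_mem _ h2 h3) h1 using 1
  funext j
  rw [h.kasamiWord_eq hτ, add_zero, Pi.add_apply, Pi.add_apply, pow_one]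

/-- The trace words embed injectively, there are p^(5s) of them, and the degree of the parity-check
polynomial bounds the order of the code by the same number. -/
theorem mem_kasamiCyclicCode_iff (w : Fin (p ^ (2 * s) - 1) → ZMod p) :
    w ∈ kasamiCyclicCode p s l α ↔ ∃ (θ : K × K) (c : K), κ θ.1 = θ.1 ∧
      ∀ j, w j = kasamiWord p τ κ θ c 0 (α ^ (j : ℕ))⁻¹ := by
  constructor
  · set f : ({a : K // κ a = a} × K) × K → kasamiCyclicCode p s l α := fun z =>
      ⟨_, h.kasamiWord_mem_kasamiCyclicCode hτ hq hq1 hqP hα (z.1.1, z.1.2) z.2⟩ with hf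
    have hinj : Function.Injective f := by
      rintro ⟨⟨⟨a, ha⟩, b⟩, c⟩ ⟨⟨⟨a', ha'⟩, b'⟩, c'⟩ he
      have he' := congrArg Subtype.val he
      have h0 := h.eq_zero_of_kasamiWord_eq_zero hq hq1 hqP (θ := (a, b) - (a', b'))
        (c := c - c') (r := 0 - 0) (by simp [ha, ha']) fun x => ?_
      · obtain ⟨h1, h2, -⟩ := h0
        rw [sub_eq_zero, Prod.mk.injEq] at h1
        obtain ⟨rfl, rfl⟩ := h1
        rw [sub_eq_zero] at h2
        rw [h2]
      · rw [kasamiWord_sub, sub_eq_zero]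
        -- Without constant term both words vanish at 0, so agreement at the nonzero labels is
        -- agreement on K.
        by_cases hx : x = 0
        · simp [hx, kasamiWord]
        · obtain ⟨i, hi, hix⟩ := h.exists_pow_eq hα (inv_ne_zero hx)
          have := congrFun he' ⟨i, hi⟩
          simp only [hf] at this
          rwa [hix, inv_inv] at this
    have hcard : Nat.card (kasamiCyclicCode p s l α) ≤
        Nat.card (({a : K // κ a = a} × K) × K) := by
      have h1 := card_cyclicCodeOfParityCheck_le h.card_sub_one_pos
        (monic_parityPolynomial (p := p) (s := s) (l := l) (α := α))
        (h.parityPolynomial_dvd hτ hq hq1 hqP hα)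
      refine h1.trans ?_
      rw [Nat.card_prod, Nat.card_prod, Nat.card_eq_fintype_card, Nat.card_eq_fintype_card,
        Fintype.card_subtype, h.card_fixed, h.card_eq, ZMod.card]
      refine (Nat.pow_le_pow_right (Fact.out : p.Prime).pos h.natDegree_parityPolynomial_le).trans
        (le_of_eq ?_)
      ring
    have hbij := hinj.bijective_of_nat_card_le hcard
    intro hw
    obtain ⟨z, hz⟩ := hbij.2 ⟨w, hw⟩
    refine ⟨(z.1.1, z.1.2), z.2, z.1.1.2, fun j => ?_⟩
    exact (congrFun (congrArg Subtype.val hz) j).symm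
  · rintro ⟨θ, c, -, hw⟩
    rw [funext hw]
    exact h.kasamiWord_mem_kasamiCyclicCode hτ hq hq1 hqP hα θ c

/-- The coordinate labelled 0 carries the constant r; subtracting it from the others leaves a word
of the cyclic code. -/
theorem mem_kasamiDualExtDual_iff (w : Fin (p ^ (2 * s) - 1 + 1) → ZMod p) :
    w ∈ kasamiDualExtDual p s l α ↔ ∃ (θ : K × K) (c : K) (r : ZMod p), κ θ.1 = θ.1 ∧
      ∀ j, w j = kasamiWord p τ κ θ c r (coordLabel α j) := by
  have hword : ∀ (θ : K × K) (c x : K) (r : ZMod p),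
      kasamiWord p τ κ θ c r x = kasamiWord p τ κ θ c 0 x + r := fun θ c x r => by
    rw [kasamiWord, kasamiWord, add_zero]
  have h0 : ∀ (θ : K × K) (c : K), kasamiWord p τ κ θ c 0 0 = 0 := by simp [kasamiWord]
  rw [kasamiDualExtDual, mem_dualCode_extendedCode_dualCode,
    h.mem_kasamiCyclicCode_iff hτ hq hq1 hqP hα]
  constructor
  · rintro ⟨θ, c, hθ, hw⟩
    refine ⟨θ, c, w (Fin.last _), hθ, fun j => ?_⟩
    induction j using Fin.lastCases with
    | last => rw [hword, coordLabel, Fin.snoc_last, h0, zero_add]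
    | cast j => rw [hword, coordLabel, Fin.snoc_castSucc, ← hw, sub_add_cancel]
  · rintro ⟨θ, c, r, hθ, hw⟩
    refine ⟨θ, c, hθ, fun j => ?_⟩
    rw [hw, hw, hword, hword _ _ _ r, coordLabel, Fin.snoc_last, Fin.snoc_castSucc, h0]
    ring

end KasamiSetting

end TraceWords

/-! ### Designs from the Kasami code -/

section KasamiDesigns

theorem coordLabel_bijective {K : Type*} [Field K] [Fintype K] {α : K} {n : ℕ}
    (hn : Fintype.card K = n + 1) (hα : IsPrimitiveRoot α n) :
    Function.Bijective (coordLabel α : Fin (n + 1) → K) := by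
  rw [Fintype.bijective_iff_injective_and_card]
  refine ⟨?_, by simp [hn]⟩
  have hn0 : 0 < n := by
    have := Fintype.one_lt_card (α := K)
    omega
  have hα0 : α ≠ 0 := hα.ne_zero hn0.ne'
  have hne : ∀ i : Fin n, (α ^ (i : ℕ))⁻¹ ≠ 0 := fun i => inv_ne_zero (pow_ne_zero _ hα0)
  intro i j hij
  induction i using Fin.lastCases with
  | last =>
    induction j using Fin.lastCases with
    | last => rfl
    | cast j =>
      rw [coordLabel, Fin.snoc_last, Fin.snoc_castSucc] at hij
      exact absurd hij.symm (hne j)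
  | cast i =>
    induction j using Fin.lastCases with
    | last =>
      rw [coordLabel, Fin.snoc_last, Fin.snoc_castSucc] at hij
      exact absurd hij (hne i)
    | cast j =>
      rw [coordLabel, Fin.snoc_castSucc, Fin.snoc_castSucc, inv_inj] at hij
      exact congrArg _ (Fin.ext (hα.pow_inj i.2 j.2 hij))

variable {p s l : ℕ} [Fact p.Prime] {K : Type*} [Field K] [Algebra (ZMod p) K]
  [Fintype K] [DecidableEq K] {τ κ : K ≃+* K}

theorem hammingNorm_add_zeroCount {n : ℕ} {x : Fin n → K} (hx : Function.Bijective x)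
    {θ : K × K} {c : K} {r : ZMod p} {w : Fin n → ZMod p}
    (hw : ∀ j, w j = kasamiWord p τ κ θ c r (x j)) :
    hammingNorm w + zeroCount p τ κ θ c r = Fintype.card K := by
  have h1 : hammingNorm w = (Finset.univ.filter fun y => kasamiWord p τ κ θ c r y ≠ 0).card := by
    refine Finset.card_bij (fun j _ => x j) ?_ (fun i _ j _ hij => hx.1 hij) ?_
    · intro j hj
      simpa [hw] using hj
    · intro y hy
      obtain ⟨j, rfl⟩ := hx.2 y
      exact ⟨j, by simpa [hw] using hy, rfl⟩
  rw [h1, zeroCount, levelCard, add_comm, ← Finset.card_univ,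
    Finset.card_filter_add_card_filter_not]

theorem wordSum_ite (P : ℤ → Prop) [DecidablePred P] :
    wordSum p s τ κ (fun x => if P x then 1 else 0) =
      (((coeffPairs κ) ×ˢ (Finset.univ : Finset (K × ZMod p))).filter fun z =>
        P (zeroCount p τ κ z.1 z.2.1 z.2.2 - p ^ (2 * s - 1))).card := by
  rw [wordSum, Finset.card_filter, Nat.cast_sum, Finset.sum_product]
  refine Finset.sum_congr rfl fun θ _ => ?_
  rw [← Finset.univ_product_univ, Finset.sum_product]
  simp

namespace KasamiSetting

variable (h : KasamiSetting p s τ κ) (hτ : ∀ x, τ (κ x) = x ^ p ^ l)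
  {q : ℕ} (hq : (Finset.univ.filter fun x => τ x = x).card = q) (hq1 : 1 < q)
  (hqP : q ^ 2 < (p ^ s) ^ 2) {α : K} (hα : IsPrimitiveRoot α (p ^ (2 * s) - 1))
include h hτ hq hq1 hqP hα

omit hτ hq hq1 hqP in
theorem coordLabel_bijective : Function.Bijective
    (coordLabel α : Fin (p ^ (2 * s) - 1 + 1) → K) := by
  refine _root_.coordLabel_bijective ?_ hα
  rw [h.card_eq, ← pow_mul, mul_comm]
  have := h.card_sub_one_pos
  omega

/-- Affine maps of K are doubly transitive; the labelling transports them to the coordinates. -/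
theorem exists_perm (i j i' j' : Fin (p ^ (2 * s) - 1 + 1)) (hij : i ≠ j) (hij' : i' ≠ j') :
    ∃ σ : Equiv.Perm (Fin (p ^ (2 * s) - 1 + 1)), σ i = i' ∧ σ j = j' ∧
      ∀ w ∈ kasamiDualExtDual p s l α, w ∘ σ ∈ kasamiDualExtDual p s l α := by
  set e := Equiv.ofBijective _ (h.coordLabel_bijective hα) with he
  have hx : e i - e j ≠ 0 := sub_ne_zero.mpr (e.injective.ne hij)
  have hx' : e i' - e j' ≠ 0 := sub_ne_zero.mpr (e.injective.ne hij')
  set u := (e i' - e j') / (e i - e j) with hu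
  have hu0 : u ≠ 0 := div_ne_zero hx' hx
  set v := e i' - u * e i with hv
  set f : K ≃ K := (Equiv.mulLeft₀ u hu0).trans (Equiv.addRight v) with hf
  have hfa : ∀ x, f x = u * x + v := fun x => rfl
  refine ⟨(e.trans f).trans e.symm, ?_, ?_, ?_⟩
  · rw [Equiv.trans_apply, Equiv.trans_apply, Equiv.symm_apply_eq, hfa, hv]
    ring
  · rw [Equiv.trans_apply, Equiv.trans_apply, Equiv.symm_apply_eq, hfa, hv, hu]
    field_simp
    ring
  · intro w hw
    rw [h.mem_kasamiDualExtDual_iff hτ hq hq1 hqP hα] at hw ⊢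
    obtain ⟨θ, c, r, hθ, hw⟩ := hw
    obtain ⟨θ', c', r', hθ', hw'⟩ := h.exists_kasamiWord_affine hθ c r u v
    refine ⟨θ', c', r', hθ', fun j => ?_⟩
    rw [Function.comp_apply, hw, hw']
    congr 1
    change e (e.symm (f (e j))) = _
    rw [Equiv.apply_symm_apply, hfa]
    rfl

/-- Weight and deviation determine each other, and words correspond bijectively to their
coefficients. -/
theorem wordsThrough_eq_wordSum {δ : ℤ} {i : ℕ} (hi : (i : ℤ) = p ^ (2 * s) - p ^ (2 * s - 1) - δ) :
    (wordsThrough (kasamiDualExtDual p s l α) i ∅ : ℚ) =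
      wordSum p s τ κ (fun x => if x = δ then 1 else 0) := by
  classical
  have hb := h.coordLabel_bijective hα
  have hK : (Fintype.card K : ℤ) = p ^ (2 * s) := by
    rw [h.card_eq, ← pow_mul, mul_comm]; push_cast; rfl
  rw [wordSum_ite, Nat.cast_inj, wordsThrough]
  symm
  refine Finset.card_bij (fun z _ j => kasamiWord p τ κ z.1 z.2.1 z.2.2 (coordLabel α j)) ?_ ?_ ?_
  · rintro ⟨θ, c, r⟩ hz
    simp only [Finset.mem_filter, Finset.mem_product, coeffPairs, Finset.mem_univ, true_and,
      and_true] at hz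
    have h1 := hammingNorm_add_zeroCount (τ := τ) (κ := κ) hb (θ := θ) (c := c) (r := r)
      (fun j => rfl)
    rw [Finset.mem_filter]
    refine ⟨Finset.mem_univ _, ?_, ?_, Finset.empty_subset _⟩
    · rw [h.mem_kasamiDualExtDual_iff hτ hq hq1 hqP hα]
      exact ⟨θ, c, r, hz.1, fun j => rfl⟩
    · have h2 := congrArg (Nat.cast (R := ℤ)) h1
      push_cast at h2
      rw [hK] at h2
      rw [← Nat.cast_inj (R := ℤ), hi]
      linarith [hz.2]
  · rintro ⟨θ, c, r⟩ hz ⟨θ', c', r'⟩ hz' hzz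
    simp only [Finset.mem_filter, Finset.mem_product, coeffPairs, Finset.mem_univ, true_and,
      and_true] at hz hz'
    obtain ⟨h1, h2, h3⟩ := h.eq_zero_of_kasamiWord_eq_zero hq hq1 hqP (θ := θ - θ')
      (c := c - c') (r := r - r') (by rw [Prod.fst_sub, map_sub, hz.1, hz'.1]) fun x => by
        obtain ⟨j, rfl⟩ := hb.2 x
        rw [kasamiWord_sub, sub_eq_zero]
        exact congrFun hzz j
    rw [sub_eq_zero] at h1 h2 h3
    rw [h1, h2, h3]
  · intro w hw
    rw [Finset.mem_filter, h.mem_kasamiDualExtDual_iff hτ hq hq1 hqP hα] at hw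
    obtain ⟨-, ⟨θ, c, r, hθ, hw⟩, hwi, -⟩ := hw
    refine ⟨(θ, c, r), ?_, (funext hw).symm⟩
    simp only [Finset.mem_filter, Finset.mem_product, coeffPairs, Finset.mem_univ, true_and,
      and_true]
    have h2 := congrArg (Nat.cast (R := ℤ)) (hammingNorm_add_zeroCount hb hw)
    push_cast at h2
    rw [hK, hwi, hi] at h2
    exact ⟨hθ, by linarith⟩

/-- The hypothesis says that exactly one word has deviation above p^(2s-2). The zero word is one, so
every other word obeys the bound. -/
theorem le_hammingNorm
    (hsmall : wordSum p s τ κ (fun x => if (p : ℤ) ^ (2 * s - 2) < x then 1 else 0) = 1)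
    {w : Fin (p ^ (2 * s) - 1 + 1) → ZMod p} (hw : w ∈ kasamiDualExtDual p s l α) (hw0 : w ≠ 0) :
    (p : ℤ) ^ (2 * s) - p ^ (2 * s - 1) - p ^ (2 * s - 2) ≤ hammingNorm w := by
  have hb := h.coordLabel_bijective hα
  have hp3 : (3 : ℤ) ≤ p := by
    have h1 := (Fact.out : p.Prime).two_le
    have h2 := h.ne_two
    exact_mod_cast (by omega : 3 ≤ p)
  have hs := h.pos
  have hK : (Fintype.card K : ℤ) = p ^ (2 * s) := by
    rw [h.card_eq, ← pow_mul, mul_comm]; push_cast; rfl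
  rw [h.mem_kasamiDualExtDual_iff hτ hq hq1 hqP hα] at hw
  obtain ⟨θ, c, r, hθ, hw⟩ := hw
  have h2 := congrArg (Nat.cast (R := ℤ)) (hammingNorm_add_zeroCount hb hw)
  push_cast at h2
  rw [hK] at h2
  by_contra hlt
  rw [wordSum_ite, Nat.cast_eq_one, Finset.card_eq_one] at hsmall
  obtain ⟨z, hz⟩ := hsmall
  have h1 : (θ, c, r) = z := by
    rw [← Finset.mem_singleton, ← hz]
    simp only [Finset.mem_filter, Finset.mem_product, coeffPairs, Finset.mem_univ, true_and,
      and_true]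
    exact ⟨hθ, by linarith⟩
  have h0 : ((0, 0), 0, 0) = z := by
    rw [← Finset.mem_singleton, ← hz]
    simp only [Finset.mem_filter, Finset.mem_product, coeffPairs, Finset.mem_univ, true_and,
      and_true]
    refine ⟨map_zero κ, ?_⟩
    have h4 : zeroCount p τ κ (0, 0) 0 0 = Fintype.card K := by
      rw [zeroCount, levelCard, Finset.filter_true_of_mem, Finset.card_univ]
      intro x _
      rw [h.kasamiWord_eq hτ]
      simp
    rw [h4, hK]
    obtain ⟨t, ht⟩ : ∃ t, 2 * s = t + 2 := ⟨2 * s - 2, by omega⟩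
    have h5 : (0 : ℤ) < p ^ t := by positivity
    have h6 : (2 : ℤ) ≤ p ^ 2 - p := by nlinarith
    rw [show 2 * s - 2 = t by omega, show 2 * s - 1 = t + 1 by omega, ht, pow_add, pow_add (p : ℤ) t 1,
      pow_one]
    have := mul_le_mul_of_nonneg_left h6 h5.le
    linarith
  obtain ⟨h11, h12⟩ := Prod.mk.inj (h1.trans h0.symm)
  obtain ⟨rfl, rfl⟩ := Prod.mk.inj h12
  subst h11
  apply hw0
  funext j
  rw [hw, h.kasamiWord_eq hτ]
  simp

/-- With Q = p^(2s-2), the lower bound on δ gives i ≤ (p² - 1)Q, while nonzero words have weight at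
least (p² - p - 1)Q; then (p - 2)i stays below (p - 1) times the minimum weight by at least (p -
1)Q. The upper bound on δ keeps i at least 2. -/
theorem givesTwoDesign
    (hsmall : wordSum p s τ κ (fun x => if (p : ℤ) ^ (2 * s - 2) < x then 1 else 0) = 1)
    {δ : ℤ} (hδ : -((p - 1) * (p : ℤ) ^ (2 * s - 2)) ≤ δ) (hδ' : δ ≤ (p : ℤ) ^ (2 * s - 2))
    {i lam : ℚ} (hi : i = (p : ℚ) ^ (2 * s) - p ^ (2 * s - 1) - δ)
    (hA : wordSum p s τ κ (fun x => if x = δ then 1 else 0) ≠ 0)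
    (hlam : lam * ((p : ℚ) ^ (2 * s) * (p ^ (2 * s) - 1)) * (p - 1) =
      wordSum p s τ κ (fun x => if x = δ then 1 else 0) * (i * (i - 1))) :
    GivesTwoDesign (kasamiDualExtDual p s l α) (p ^ (2 * s)) (i, lam) := by
  have hp3 : (3 : ℤ) ≤ p := by
    have h1 := (Fact.out : p.Prime).two_le
    have h2 := h.ne_two
    exact_mod_cast (by omega : 3 ≤ p)
  have hs := h.pos
  have hN := h.card_sub_one_pos
  obtain ⟨t, ht⟩ : ∃ t, 2 * s = t + 2 := ⟨2 * s - 2, by omega⟩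
  have h5 : (1 : ℤ) ≤ p ^ t := one_le_pow₀ (by linarith)
  have e1 : (p : ℤ) ^ (2 * s) = p ^ t * p ^ 2 := by rw [ht, pow_add]
  have e2 : (p : ℤ) ^ (2 * s - 1) = p ^ t * p := by
    rw [ht, show t + 2 - 1 = t + 1 by omega, pow_succ]
  have e3 : (p : ℤ) ^ (2 * s - 2) = p ^ t := by rw [ht, show t + 2 - 2 = t by omega]
  have h6 : (5 : ℤ) ≤ p ^ 2 - p - 1 := by nlinarith
  rw [e3] at hδ hδ'
  obtain ⟨w, hw⟩ : ∃ w : ℕ, (w : ℤ) = p ^ (2 * s) - p ^ (2 * s - 1) - δ := by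
    refine ⟨((p : ℤ) ^ (2 * s) - p ^ (2 * s - 1) - δ).toNat, Int.toNat_of_nonneg ?_⟩
    rw [e1, e2]
    nlinarith
  have hw2 : 2 ≤ w := by
    have : (2 : ℤ) ≤ w := by rw [hw, e1, e2]; nlinarith
    exact_mod_cast this
  have hiw : (w : ℚ) = i := by
    rw [hi]
    exact_mod_cast congrArg (Int.cast (R := ℚ)) hw
  have hcount := h.wordsThrough_eq_wordSum hτ hq hq1 hqP hα hw
  have hmin : ∀ v ∈ kasamiDualExtDual p s l α, v ≠ 0 → (p - 2) * w < (p - 1) * hammingNorm v := by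
    intro v hv hv0
    have h9 := h.le_hammingNorm hτ hq hq1 hqP hα hsmall hv hv0
    rw [e1, e2, e3] at h9
    have hp2 : 2 ≤ p := (Fact.out : p.Prime).two_le
    zify [hp2, (by omega : 1 ≤ p)]
    rw [hw, e1, e2]
    have h10 : ((p : ℤ) - 1) * (p ^ t * p ^ 2 - p ^ t * p - p ^ t) ≤ (p - 1) * hammingNorm v :=
      mul_le_mul_of_nonneg_left h9 (by linarith)
    have h11 : ((p : ℤ) - 2) * (p ^ t * p ^ 2 - p ^ t * p - δ) ≤
        (p - 2) * (p ^ t * p ^ 2 - p ^ t * p + (p - 1) * p ^ t) :=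
      mul_le_mul_of_nonneg_left (by linarith) (by linarith)
    refine (h11.trans_lt ?_).trans_le h10
    nlinarith
  have hN1 : p ^ (2 * s) - 1 + 1 = p ^ (2 * s) := by omega
  obtain ⟨hex, lam', hlam', hdes⟩ := exists_isDesign (D := kasamiDualExtDual p s l α) hN1 hw2 hmin
    (h.exists_perm hτ hq hq1 hqP hα) (fun h0 => hA (by rw [← hcount, h0, Nat.cast_zero]))
  · refine ⟨w, lam', hiw, ?_, hex, hdes⟩
    · have hp1 : 1 ≤ p := (Fact.out : p.Prime).one_lt.le
      have h7 := congrArg (Nat.cast (R := ℚ)) hlam'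
      push_cast [Nat.cast_sub hp1, Nat.cast_sub (by omega : 1 ≤ w),
        Nat.cast_sub (by omega : 1 ≤ p ^ (2 * s))] at h7
      rw [hcount, hiw, ← hlam] at h7
      have h8 : ((p : ℚ) ^ (2 * s) * (p ^ (2 * s) - 1)) * (p - 1) ≠ 0 := by
        have a1 : (p : ℚ) ^ (2 * s) ≠ 0 := by
          exact_mod_cast (by omega : p ^ (2 * s) ≠ 0)
        have a2 : (p : ℚ) ^ (2 * s) - 1 ≠ 0 := by
          rw [sub_ne_zero]; exact_mod_cast (by omega : p ^ (2 * s) ≠ 1)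
        have a3 : (p : ℚ) - 1 ≠ 0 := by
          rw [sub_ne_zero]; exact_mod_cast (Fact.out : p.Prime).one_lt.ne'
        exact mul_ne_zero (mul_ne_zero a1 a2) a3
      rw [mul_assoc, mul_assoc lam] at h7
      exact mul_right_cancel₀ h8 h7
end KasamiSetting

end KasamiDesigns

/-! ### The frequencies of the deviations -/

section Frequencies

/-- Compare p-adic valuations. The coefficients in use are ±1 and ±(p - 1), so deviations of two
families agree only if exponent and coefficient both do. -/
theorem mul_prime_pow_eq_iff {p : ℕ} (hp : p.Prime) {u v : ℤ} (hu : ¬(p : ℤ) ∣ u)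
    (hv : ¬(p : ℤ) ∣ v) (e f : ℕ) : u * p ^ e = v * p ^ f ↔ e = f ∧ u = v := by
  have hp0 : (p : ℤ) ≠ 0 := by exact_mod_cast hp.ne_zero
  have key : ∀ {u v : ℤ} {e f : ℕ}, ¬(p : ℤ) ∣ u → u * p ^ e = v * p ^ f → f ≤ e := by
    intro u v e f hu h
    by_contra! hlt
    obtain ⟨t, rfl⟩ := Nat.exists_eq_add_of_lt hlt
    apply hu
    refine ⟨v * p ^ t, mul_right_cancel₀ (pow_ne_zero e hp0) ?_⟩
    rw [h]; ring
  constructor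
  · intro h
    obtain rfl := le_antisymm (key hv h.symm) (key hu h)
    exact ⟨rfl, mul_right_cancel₀ (pow_ne_zero e hp0) h⟩
  · rintro ⟨rfl, rfl⟩; rfl

variable {p : ℕ} (hp : p.Prime) (hp2 : p ≠ 2) {ε η : ℤ} (hε : ε = 1 ∨ ε = -1)
  (hη : η = 1 ∨ η = -1) (P R : ℚ) (e f : ℕ)

section
include hp hε

theorem not_dvd_sign : ¬(p : ℤ) ∣ ε := by
  intro h
  have : (p : ℤ) ∣ 1 := by
    rcases hε with rfl | rfl
    · exact h
    · exact (dvd_neg.mpr h).trans (by norm_num)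
  exact hp.one_lt.ne' (by exact_mod_cast Int.eq_one_of_dvd_one (by positivity) this)

theorem not_dvd_sub_one_mul_sign : ¬(p : ℤ) ∣ (p - 1) * ε := by
  intro h
  apply not_dvd_sign hp hε
  have : (p : ℤ) ∣ p * ε - (p - 1) * ε := dvd_sub (dvd_mul_right _ _) h
  rwa [← sub_mul, sub_sub_cancel, one_mul] at this

include hp2 hη

theorem sub_one_mul_sign_ne : (p - 1) * ε ≠ -η := by
  have h1 := hp.two_le
  have h2 : (3 : ℤ) ≤ p := by exact_mod_cast (by omega : 3 ≤ p)
  rcases hε with rfl | rfl <;> rcases hη with rfl | rfl <;> intro h <;> linarith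

theorem evenTerm_of_eq_sub_one_mul :
    evenTerm p P R (fun x => if x = (p - 1) * (η * p ^ f) then 1 else 0) (ε * p ^ e) =
      if e = f ∧ ε = η then P ^ 2 / R else 0 := by
  have hp1 : (p : ℤ) - 1 ≠ 0 := by rw [sub_ne_zero]; exact_mod_cast hp.one_lt.ne'
  have hp0 : (p : ℤ) ≠ 0 := by exact_mod_cast hp.ne_zero
  have hη0 : η ≠ 0 := by rcases hη with rfl | rfl <;> norm_num
  have h1 : ((p : ℤ) - 1) * (ε * p ^ e) = (p - 1) * (η * p ^ f) ↔ e = f ∧ ε = η := by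
    rw [mul_right_inj' hp1, mul_prime_pow_eq_iff hp (not_dvd_sign hp hε) (not_dvd_sign hp hη)]
  have h2 : ¬ -(ε * (p : ℤ) ^ e) = (p - 1) * (η * p ^ f) := by
    rw [← neg_mul, ← mul_assoc, mul_prime_pow_eq_iff hp
      (fun h => not_dvd_sign hp hε (by rwa [dvd_neg] at h)) (not_dvd_sub_one_mul_sign hp hη)]
    exact fun h => sub_one_mul_sign_ne hp hp2 hη hε h.2.symm
  have h3 : ¬ (0 : ℤ) = (p - 1) * (η * p ^ f) :=
    (mul_ne_zero hp1 (mul_ne_zero hη0 (pow_ne_zero _ hp0))).symm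
  simp only [evenTerm, h1, h2, h3, if_false, mul_zero, add_zero]
  split_ifs <;> simp

theorem evenTerm_of_eq_neg :
    evenTerm p P R (fun x => if x = -(η * p ^ f) then 1 else 0) (ε * p ^ e) =
      if e = f ∧ ε = η then P ^ 2 / R * (p - 1) else 0 := by
  have hp0 : (p : ℤ) ≠ 0 := by exact_mod_cast hp.ne_zero
  have hη0 : η ≠ 0 := by rcases hη with rfl | rfl <;> norm_num
  have h1 : -(ε * (p : ℤ) ^ e) = -(η * p ^ f) ↔ e = f ∧ ε = η := by
    rw [neg_inj, mul_prime_pow_eq_iff hp (not_dvd_sign hp hε) (not_dvd_sign hp hη)]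
  have h2 : ¬ ((p : ℤ) - 1) * (ε * p ^ e) = -(η * p ^ f) := by
    rw [← neg_mul, ← mul_assoc, mul_prime_pow_eq_iff hp (not_dvd_sub_one_mul_sign hp hε)
      (fun h => not_dvd_sign hp hη (by rwa [dvd_neg] at h))]
    exact fun h => sub_one_mul_sign_ne hp hp2 hε hη h.2
  have h3 : ¬ (0 : ℤ) = -(η * p ^ f) :=
    (neg_ne_zero.mpr (mul_ne_zero hη0 (pow_ne_zero _ hp0))).symm
  simp only [evenTerm, h1, h2, h3, if_false, mul_zero, add_zero, zero_add]
  split_ifs <;> simp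

end

section
include hp hε

theorem evenTerm_of_eq_zero :
    evenTerm p P R (fun x => if x = 0 then 1 else 0) (ε * p ^ e) =
      (P ^ 2 - P ^ 2 / R) * p := by
  have hp1 : (p : ℤ) - 1 ≠ 0 := by rw [sub_ne_zero]; exact_mod_cast hp.one_lt.ne'
  have hε0 : ε ≠ 0 := by rcases hε with rfl | rfl <;> norm_num
  simp [evenTerm, hp1, hp.ne_zero, hε0]

/-- For positive sign the largest deviation is (p - 1)p^e, which needs the spare exponent; for
negative sign it is p^e. -/
theorem evenTerm_of_lt {N : ℕ} (he : e ≤ N) (he' : ε = 1 → e + 1 ≤ N) :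
    evenTerm p P R (fun x => if (p : ℤ) ^ N < x then 1 else 0) (ε * p ^ e) = 0 := by
  have hp1 : (2 : ℤ) ≤ p := by exact_mod_cast hp.two_le
  have h0 : (0 : ℤ) < p ^ e := by positivity
  have h1 : (p : ℤ) ^ e ≤ p ^ N := pow_le_pow_right₀ (by linarith) he
  have h2 : ¬ (p : ℤ) ^ N < (p - 1) * (ε * p ^ e) := by
    rcases hε with rfl | rfl
    · have h5 : (p : ℤ) ^ (e + 1) ≤ p ^ N := pow_le_pow_right₀ (by linarith) (he' rfl)
      rw [pow_succ] at h5
      nlinarith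
    · nlinarith
  have h3 : ¬ (p : ℤ) ^ N < -(ε * p ^ e) := by
    rcases hε with rfl | rfl <;> nlinarith
  have h4 : ¬ (p : ℤ) ^ N < 0 := by
    have : (0 : ℤ) < p ^ N := by positivity
    linarith
  simp only [evenTerm, h2, h3, h4, if_false]
  ring

end

include hp

theorem oddTerm_of_lt {N : ℕ} (he : e ≤ N) :
    oddTerm p P R (fun x => if (p : ℤ) ^ N < x then 1 else 0) (p ^ e) = 0 := by
  have hp1 : (1 : ℤ) ≤ p := by exact_mod_cast hp.one_lt.le
  have h1 : (p : ℤ) ^ e ≤ p ^ N := pow_le_pow_right₀ hp1 he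
  have h2 : ¬ (p : ℤ) ^ N < p ^ e := h1.not_gt
  have h0 : (0 : ℤ) < p ^ e := by positivity
  have h3 : ¬ (p : ℤ) ^ N < -(p ^ e) := by linarith
  have h4 : ¬ (p : ℤ) ^ N < 0 := by linarith
  simp only [oddTerm, h2, h3, h4, if_false]
  ring

theorem oddTerm_of_eq_zero :
    oddTerm p P R (fun x => if x = 0 then 1 else 0) (p ^ e) =
      P ^ 2 / R + (P ^ 2 - P ^ 2 / R) * p := by
  simp [oddTerm, hp.ne_zero]

include hp2 hη

theorem oddTerm_of_eq_sub_one_mul :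
    oddTerm p P R (fun x => if x = (p - 1) * (η * p ^ f) then 1 else 0) (p ^ e) = 0 := by
  have hp1 : (p : ℤ) - 1 ≠ 0 := by rw [sub_ne_zero]; exact_mod_cast hp.one_lt.ne'
  have hp0 : (p : ℤ) ≠ 0 := by exact_mod_cast hp.ne_zero
  have hη0 : η ≠ 0 := by rcases hη with rfl | rfl <;> norm_num
  have h1 : ∀ ε : ℤ, (ε = 1 ∨ ε = -1) → ¬ ε * (p : ℤ) ^ e = (p - 1) * (η * p ^ f) := by
    intro ε hε
    have hε' : -ε = 1 ∨ -ε = -1 := by rcases hε with rfl | rfl <;> norm_num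
    rw [← mul_assoc, mul_prime_pow_eq_iff hp (not_dvd_sign hp hε) (not_dvd_sub_one_mul_sign hp hη)]
    exact fun h => sub_one_mul_sign_ne hp hp2 hη hε' (by rw [neg_neg]; exact h.2.symm)
  have h2 := h1 1 (Or.inl rfl)
  have h3 := h1 (-1) (Or.inr rfl)
  rw [one_mul] at h2
  rw [neg_one_mul] at h3
  have h4 : ¬ (0 : ℤ) = (p - 1) * (η * p ^ f) :=
    (mul_ne_zero hp1 (mul_ne_zero hη0 (pow_ne_zero _ hp0))).symm
  simp only [oddTerm, h2, h3, h4, if_false]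
  ring

omit hp2 in
theorem oddTerm_of_eq_neg :
    oddTerm p P R (fun x => if x = -(η * p ^ f) then 1 else 0) (p ^ e) =
      if e = f then P ^ 2 / R * ((p - 1) / 2) else 0 := by
  have hp0 : (p : ℤ) ≠ 0 := by exact_mod_cast hp.ne_zero
  have hη0 : η ≠ 0 := by rcases hη with rfl | rfl <;> norm_num
  have hη' : -η = 1 ∨ -η = -1 := by rcases hη with rfl | rfl <;> norm_num
  have h1 : ∀ ε : ℤ, (ε = 1 ∨ ε = -1) → (ε * (p : ℤ) ^ e = -(η * p ^ f) ↔ e = f ∧ ε = -η) := by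
    intro ε hε
    rw [← neg_mul, mul_prime_pow_eq_iff hp (not_dvd_sign hp hε) (not_dvd_sign hp hη')]
  have h2 := h1 1 (Or.inl rfl)
  have h3 := h1 (-1) (Or.inr rfl)
  rw [one_mul] at h2
  rw [neg_one_mul] at h3
  have h4 : ¬ (0 : ℤ) = -(η * p ^ f) :=
    (neg_ne_zero.mpr (mul_ne_zero hη0 (pow_ne_zero _ hp0))).symm
  simp only [oddTerm, h2, h3, h4, if_false]
  rcases hη with rfl | rfl <;> by_cases hef : e = f <;> simp [hef]

end Frequencies

/-! ### The designs in the three cases -/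

section Cases

variable {p s d : ℕ} [Fact p.Prime] {K : Type*} [Field K] [Algebra (ZMod p) K]
  [Fintype K] [DecidableEq K] {τ κ : K ≃+* K}

namespace KasamiSetting

variable (h : KasamiSetting p s τ κ)
include h

section CaseOne

variable {k : Type*} [Field k] [Fintype k] [DecidableEq k] [Algebra k K] [Algebra (ZMod p) k]
  [IsScalarTower (ZMod p) k K]
  (hd : 0 < d) (hds : 2 * d ≤ s)
  (hfix : ∀ x : K, τ x = x ↔ ∃ r : k, algebraMap k K r = x)
  (hκk : ∀ r : k, κ (algebraMap k K r) = algebraMap k K r)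
  (hk : Fintype.card k = p ^ d)
include hfix hκk hk hd hds

/-- The nondegenerate frequencies are the half-sum and half-difference of the two linear equations.
-/
theorem wordSum_eq_of_odd (hodd : Odd d) {P D : ℚ} (hP : P = p ^ s) (hD : D = p ^ d)
    (ψ : ℤ → ℚ) : wordSum p s τ κ ψ = evenTerm p P (P ^ 2) ψ (1 * p ^ (2 * s - 1)) +
      (D * (P ^ 2 - 1) * (P + 1) / (2 * (D + 1)) * evenTerm p P 1 ψ (1 * p ^ (s - 1)) +
      (D * P ^ 2 - 2 * P ^ 2 + D) * (P - 1) / (2 * (D - 1)) *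
        evenTerm p P 1 ψ (-1 * p ^ (s - 1)) +
      (P ^ 2 - 1) * P / D * oddTerm p P D ψ (p ^ (s + (d - 1) / 2)) +
      (P ^ 2 - 1) * (P - D) / ((D ^ 2 - 1) * D) *
        evenTerm p P (D ^ 2) ψ (-1 * p ^ (s - 1 + d))) := by
  have hD1 : 1 < D := by
    rw [hD]; exact one_lt_pow₀ (by exact_mod_cast (Fact.out : p.Prime).one_lt) hd.ne'
  obtain ⟨n₁, n₂, h1, h2, hW⟩ := h.wordSum_of_odd hd hds hfix hκk hk hodd
  rw [← hP, ← hD] at h1 h2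
  have a1 : D + 1 ≠ 0 := by linarith
  have a2 : D - 1 ≠ 0 := by linarith
  have a3 : D ≠ 0 := by linarith
  have a4 : D ^ 2 - 1 ≠ 0 := by nlinarith
  have e1 : n₁ = D * (P ^ 2 - 1) * (P + 1) / (2 * (D + 1)) := by
    have : n₁ = ((P ^ 3 - 1 - (P ^ 2 - 1) * P / D - (P ^ 2 - 1) * (P - D) / ((D ^ 2 - 1) * D)) +
      (P ^ 2 - P + (P ^ 2 - 1) * (P - D) / (D ^ 2 - 1))) / 2 := by linear_combination (h1 + h2) / 2
    rw [this, show D ^ 2 - 1 = (D + 1) * (D - 1) by ring]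
    field_simp
    ring
  have e2 : n₂ = (D * P ^ 2 - 2 * P ^ 2 + D) * (P - 1) / (2 * (D - 1)) := by
    have : n₂ = ((P ^ 3 - 1 - (P ^ 2 - 1) * P / D - (P ^ 2 - 1) * (P - D) / ((D ^ 2 - 1) * D)) -
      (P ^ 2 - P + (P ^ 2 - 1) * (P - D) / (D ^ 2 - 1))) / 2 := by linear_combination (h1 - h2) / 2
    rw [this, show D ^ 2 - 1 = (D + 1) * (D - 1) by ring]
    field_simp
    ring
  rw [hW, ← hP, ← hD, ← e1, ← e2]
  simp only [one_mul, neg_one_mul]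

theorem wordSum_eq_of_even {e : ℕ} (hde : d = 2 * e) {P D : ℚ} (hP : P = p ^ s) (hD : D = p ^ d)
    (ψ : ℤ → ℚ) : wordSum p s τ κ ψ = evenTerm p P (P ^ 2) ψ (1 * p ^ (2 * s - 1)) +
      (D * (P ^ 2 - 1) * (P + 1) / (2 * (D + 1)) * evenTerm p P 1 ψ (1 * p ^ (s - 1)) +
      (D * P ^ 2 - 2 * P ^ 2 + D) * (P - 1) / (2 * (D - 1)) *
        evenTerm p P 1 ψ (-1 * p ^ (s - 1)) +
      (P ^ 2 - 1) * P / (2 * D) *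
        (evenTerm p P D ψ (1 * p ^ (s - 1 + e)) + evenTerm p P D ψ (-1 * p ^ (s - 1 + e))) +
      (P ^ 2 - 1) * (P - D) / ((D ^ 2 - 1) * D) *
        evenTerm p P (D ^ 2) ψ (-1 * p ^ (s - 1 + d))) := by
  have hD1 : 1 < D := by
    rw [hD]; exact one_lt_pow₀ (by exact_mod_cast (Fact.out : p.Prime).one_lt) hd.ne'
  obtain ⟨n₁, n₂, h1, h2, hW⟩ := h.wordSum_of_even hd hds hfix hκk hk hde
  rw [← hP, ← hD] at h1 h2
  have a1 : D + 1 ≠ 0 := by linarith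
  have a2 : D - 1 ≠ 0 := by linarith
  have a3 : D ≠ 0 := by linarith
  have a4 : D ^ 2 - 1 ≠ 0 := by nlinarith
  have e1 : n₁ = D * (P ^ 2 - 1) * (P + 1) / (2 * (D + 1)) := by
    have : n₁ = ((P ^ 3 - 1 - (P ^ 2 - 1) * P / D - (P ^ 2 - 1) * (P - D) / ((D ^ 2 - 1) * D)) +
      (P ^ 2 - P + (P ^ 2 - 1) * (P - D) / (D ^ 2 - 1))) / 2 := by linear_combination (h1 + h2) / 2
    rw [this, show D ^ 2 - 1 = (D + 1) * (D - 1) by ring]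
    field_simp
    ring
  have e2 : n₂ = (D * P ^ 2 - 2 * P ^ 2 + D) * (P - 1) / (2 * (D - 1)) := by
    have : n₂ = ((P ^ 3 - 1 - (P ^ 2 - 1) * P / D - (P ^ 2 - 1) * (P - D) / ((D ^ 2 - 1) * D)) -
      (P ^ 2 - P + (P ^ 2 - 1) * (P - D) / (D ^ 2 - 1))) / 2 := by linear_combination (h1 - h2) / 2
    rw [this, show D ^ 2 - 1 = (D + 1) * (D - 1) by ring]
    field_simp
    ring
  rw [hW, ← hP, ← hD, ← e1, ← e2]
  simp only [one_mul, neg_one_mul]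

end CaseOne

section CaseTwo

variable (hd : 0 < d) (hds : 3 * d ≤ s)
  (hfix : (Finset.univ.filter fun x => τ x = x).card = (p ^ d) ^ 2)
  (hanti : (Finset.univ.filter fun x => τ x = x ∧ κ x = -x).card = p ^ d)
  (hU : (Finset.univ.filter fun u : K => u ^ (p ^ d + 1) = 1).card = p ^ d + 1)
  (hUκ : ∀ u : K, u ^ (p ^ d + 1) = 1 → u * κ u = 1)
  (hUτ : ∀ u : K, u ^ (p ^ d + 1) = 1 → u * τ (κ u) = 1)
  (hdvd : ((p : ℤ) ^ d + 1) ∣ p ^ s + 1)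
include hd hds hfix hanti hU hUκ hUτ hdvd

theorem wordSum_eq_of_double {P D : ℚ} (hP : P = p ^ s) (hD : D = p ^ d) (ψ : ℤ → ℚ) :
    wordSum p s τ κ ψ = evenTerm p P (P ^ 2) ψ (1 * p ^ (2 * s - 1)) +
      ((D ^ 3 * P ^ 2 - D * P ^ 2 - P ^ 2 + D ^ 3 * P - D ^ 2 * P + D ^ 3) * (P - 1) /
        ((D + 1) * (D ^ 2 - 1)) * evenTerm p P 1 ψ (-1 * p ^ (s - 1)) +
      (P ^ 2 - 1) * (D ^ 2 * P + D * P + P + D ^ 2) / (D * (D + 1) ^ 2) *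
        evenTerm p P (D ^ 2) ψ (1 * p ^ (s - 1 + d)) +
      (P ^ 2 - 1) * (P - D) / (D * (D + 1) * (D ^ 2 - 1)) *
        evenTerm p P (D ^ 4) ψ (-1 * p ^ (s - 1 + 2 * d))) := by
  have hD1 : 1 < D := by
    rw [hD]; exact one_lt_pow₀ (by exact_mod_cast (Fact.out : p.Prime).one_lt) hd.ne'
  obtain ⟨n₀, n₂, n₄, h1, h2, h3, hW⟩ :=
    h.wordSum_of_double hd hds hfix hanti hU hUκ hUτ hdvd
  rw [← hP] at h1 h2 h3
  rw [← hD] at h2 h3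
  have a1 : D + 1 ≠ 0 := by linarith
  have a2 : D - 1 ≠ 0 := by linarith
  have a3 : D ≠ 0 := by linarith
  have a4 : D ^ 2 - 1 ≠ 0 := by nlinarith
  -- Adding the first and third equations removes n₀; D - 1 times the result has the same n₂ term as
  -- the second, which isolates n₄.
  have h13 : (D + 1) * n₂ + (1 - D ^ 2) * n₄ = P ^ 3 - 1 + P ^ 2 - P := by
    linear_combination h1 + h3
  have e4 : n₄ = (P ^ 2 - 1) * (P - D) / (D * (D + 1) * (D ^ 2 - 1)) := by
    rw [eq_div_iff (mul_ne_zero (mul_ne_zero a3 a1) a4)]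
    linear_combination h2 - (D - 1) * h13
  have e2 : n₂ = (P ^ 2 - 1) * (D ^ 2 * P + D * P + P + D ^ 2) / (D * (D + 1) ^ 2) := by
    have : n₂ = (P ^ 3 - 1 + P ^ 2 - P - (1 - D ^ 2) * n₄) / (D + 1) := by
      rw [eq_div_iff a1]; linear_combination h13
    rw [this, e4, show D ^ 2 - 1 = (D + 1) * (D - 1) by ring]
    field_simp
    ring
  have e0 : n₀ = (D ^ 3 * P ^ 2 - D * P ^ 2 - P ^ 2 + D ^ 3 * P - D ^ 2 * P + D ^ 3) * (P - 1) /
      ((D + 1) * (D ^ 2 - 1)) := by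
    have : n₀ = P ^ 3 - 1 - n₂ - n₄ := by linear_combination h1
    rw [this, e2, e4, show D ^ 2 - 1 = (D + 1) * (D - 1) by ring]
    field_simp
    ring
  rw [hW, ← hP, ← hD, ← e0, ← e2, ← e4]
  simp only [one_mul, neg_one_mul]

end CaseTwo

end KasamiSetting

end Cases

/-! ### The parameters of the designs -/

section Tables

variable {p s d : ℕ} (hp : p.Prime) (hp2 : p ≠ 2) (hs : 0 < s) (hd : 0 < d) {P D : ℚ}
  {W : (ℤ → ℚ) → ℚ}
include hp

/-- Among the affine functions Tr(cx) + r only the zero word has a positive deviation: nonzero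
constants have -p^(2s-1), nonconstant ones 0. -/
theorem evenTerm_of_lt_self (hs : 0 < s) (hP : P ≠ 0) :
    evenTerm p P (P ^ 2) (fun x => if (p : ℤ) ^ (2 * s - 2) < x then 1 else 0)
      (1 * p ^ (2 * s - 1)) = 1 := by
  obtain ⟨t, ht⟩ : ∃ t, 2 * s = t + 2 := ⟨2 * s - 2, by omega⟩
  have hp1 : (2 : ℤ) ≤ p := by exact_mod_cast hp.two_le
  have h0 : (0 : ℤ) < p ^ t := by positivity
  have h1 : (p : ℤ) ^ t < (p - 1) * (1 * (p ^ t * p)) := by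
    have : (1 : ℤ) < (p - 1) * p := by nlinarith
    nlinarith
  have h2 : ¬ (p : ℤ) ^ t < -(1 * (p ^ t * p)) := by nlinarith
  rw [show 2 * s - 2 = t by omega, show 2 * s - 1 = t + 1 by omega,
    pow_succ (p : ℤ) t]
  simp only [evenTerm, h1, h2, h0.not_gt, if_true, if_false]
  field_simp
  ring

/-- The bound 2d ≤ s keeps every deviation of a nonzero form at or below p^(2s-2), so only the zero
word is counted. -/
theorem oddTable_lt (hP : P ≠ 0) (hd : 0 < d) (hds : 2 * d ≤ s) {n₁ n₂ n₃ n₄ : ℚ}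
    (hW : ∀ ψ, W ψ = evenTerm p P (P ^ 2) ψ (1 * p ^ (2 * s - 1)) +
      (n₁ * evenTerm p P 1 ψ (1 * p ^ (s - 1)) + n₂ * evenTerm p P 1 ψ (-1 * p ^ (s - 1)) +
      n₃ * oddTerm p P D ψ (p ^ (s + (d - 1) / 2)) +
      n₄ * evenTerm p P (D ^ 2) ψ (-1 * p ^ (s - 1 + d)))) :
    W (fun x => if (p : ℤ) ^ (2 * s - 2) < x then 1 else 0) = 1 := by
  rw [hW, evenTerm_of_lt_self hp (by omega) hP, evenTerm_of_lt hp (Or.inl rfl) _ _ _ (by omega) (by omega),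
    evenTerm_of_lt hp (Or.inr rfl) _ _ _ (by omega) (by omega), oddTerm_of_lt hp _ _ _ (by omega),
    evenTerm_of_lt hp (Or.inr rfl) _ _ _ (by omega) (by omega)]
  ring

theorem evenTable_lt {e : ℕ} (hP : P ≠ 0) (hd : 0 < d) (hds : 2 * d ≤ s) (hde : d = 2 * e)
    {n₁ n₂ n₃ n₄ : ℚ}
    (hW : ∀ ψ, W ψ = evenTerm p P (P ^ 2) ψ (1 * p ^ (2 * s - 1)) +
      (n₁ * evenTerm p P 1 ψ (1 * p ^ (s - 1)) + n₂ * evenTerm p P 1 ψ (-1 * p ^ (s - 1)) +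
      n₃ * (evenTerm p P D ψ (1 * p ^ (s - 1 + e)) + evenTerm p P D ψ (-1 * p ^ (s - 1 + e))) +
      n₄ * evenTerm p P (D ^ 2) ψ (-1 * p ^ (s - 1 + d)))) :
    W (fun x => if (p : ℤ) ^ (2 * s - 2) < x then 1 else 0) = 1 := by
  rw [hW, evenTerm_of_lt_self hp (by omega) hP, evenTerm_of_lt hp (Or.inl rfl) _ _ _ (by omega) (by omega),
    evenTerm_of_lt hp (Or.inr rfl) _ _ _ (by omega) (by omega),
    evenTerm_of_lt hp (Or.inl rfl) _ _ _ (by omega) (by omega),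
    evenTerm_of_lt hp (Or.inr rfl) _ _ _ (by omega) (by omega),
    evenTerm_of_lt hp (Or.inr rfl) _ _ _ (by omega) (by omega)]
  ring

theorem doubleTable_lt (hP : P ≠ 0) (hd : 0 < d) (hds : 3 * d ≤ s) {n₀ n₂ n₄ : ℚ}
    (hW : ∀ ψ, W ψ = evenTerm p P (P ^ 2) ψ (1 * p ^ (2 * s - 1)) +
      (n₀ * evenTerm p P 1 ψ (-1 * p ^ (s - 1)) +
      n₂ * evenTerm p P (D ^ 2) ψ (1 * p ^ (s - 1 + d)) +
      n₄ * evenTerm p P (D ^ 4) ψ (-1 * p ^ (s - 1 + 2 * d)))) :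
    W (fun x => if (p : ℤ) ^ (2 * s - 2) < x then 1 else 0) = 1 := by
  rw [hW, evenTerm_of_lt_self hp (by omega) hP, evenTerm_of_lt hp (Or.inr rfl) _ _ _ (by omega) (by omega),
    evenTerm_of_lt hp (Or.inl rfl) _ _ _ (by omega) (by omega),
    evenTerm_of_lt hp (Or.inr rfl) _ _ _ (by omega) (by omega)]
  ring

theorem oddTable_max (hp2 : p ≠ 2) {n₁ n₂ n₃ n₄ : ℚ}
    (hW : ∀ ψ, W ψ = evenTerm p P (P ^ 2) ψ (1 * p ^ (2 * s - 1)) +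
      (n₁ * evenTerm p P 1 ψ (1 * p ^ (s - 1)) + n₂ * evenTerm p P 1 ψ (-1 * p ^ (s - 1)) +
      n₃ * oddTerm p P D ψ (p ^ (s + (d - 1) / 2)) +
      n₄ * evenTerm p P (D ^ 2) ψ (-1 * p ^ (s - 1 + d))))
    {η : ℤ} (hη : η = 1 ∨ η = -1) (f : ℕ) :
    W (fun x => if x = (p - 1) * (η * p ^ f) then 1 else 0) =
      (if 2 * s - 1 = f ∧ 1 = η then P ^ 2 / P ^ 2 else 0) +
      n₁ * (if s - 1 = f ∧ 1 = η then P ^ 2 / 1 else 0) +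
      n₂ * (if s - 1 = f ∧ -1 = η then P ^ 2 / 1 else 0) +
      n₄ * (if s - 1 + d = f ∧ -1 = η then P ^ 2 / D ^ 2 else 0) := by
  rw [hW, evenTerm_of_eq_sub_one_mul hp hp2 (Or.inl rfl) hη,
    evenTerm_of_eq_sub_one_mul hp hp2 (Or.inl rfl) hη,
    evenTerm_of_eq_sub_one_mul hp hp2 (Or.inr rfl) hη,
    oddTerm_of_eq_sub_one_mul hp hp2 hη,
    evenTerm_of_eq_sub_one_mul hp hp2 (Or.inr rfl) hη]
  ring

theorem oddTable_neg (hp2 : p ≠ 2) {n₁ n₂ n₃ n₄ : ℚ}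
    (hW : ∀ ψ, W ψ = evenTerm p P (P ^ 2) ψ (1 * p ^ (2 * s - 1)) +
      (n₁ * evenTerm p P 1 ψ (1 * p ^ (s - 1)) + n₂ * evenTerm p P 1 ψ (-1 * p ^ (s - 1)) +
      n₃ * oddTerm p P D ψ (p ^ (s + (d - 1) / 2)) +
      n₄ * evenTerm p P (D ^ 2) ψ (-1 * p ^ (s - 1 + d))))
    {η : ℤ} (hη : η = 1 ∨ η = -1) (f : ℕ) :
    W (fun x => if x = -(η * p ^ f) then 1 else 0) =
      (if 2 * s - 1 = f ∧ 1 = η then P ^ 2 / P ^ 2 * (p - 1) else 0) +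
      n₁ * (if s - 1 = f ∧ 1 = η then P ^ 2 / 1 * (p - 1) else 0) +
      n₂ * (if s - 1 = f ∧ -1 = η then P ^ 2 / 1 * (p - 1) else 0) +
      n₃ * (if s + (d - 1) / 2 = f then P ^ 2 / D * ((p - 1) / 2) else 0) +
      n₄ * (if s - 1 + d = f ∧ -1 = η then P ^ 2 / D ^ 2 * (p - 1) else 0) := by
  rw [hW, evenTerm_of_eq_neg hp hp2 (Or.inl rfl) hη,
    evenTerm_of_eq_neg hp hp2 (Or.inl rfl) hη,
    evenTerm_of_eq_neg hp hp2 (Or.inr rfl) hη,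
    oddTerm_of_eq_neg hp hη,
    evenTerm_of_eq_neg hp hp2 (Or.inr rfl) hη]
  ring

theorem oddTable_zero {n₁ n₂ n₃ n₄ : ℚ}
    (hW : ∀ ψ, W ψ = evenTerm p P (P ^ 2) ψ (1 * p ^ (2 * s - 1)) +
      (n₁ * evenTerm p P 1 ψ (1 * p ^ (s - 1)) + n₂ * evenTerm p P 1 ψ (-1 * p ^ (s - 1)) +
      n₃ * oddTerm p P D ψ (p ^ (s + (d - 1) / 2)) +
      n₄ * evenTerm p P (D ^ 2) ψ (-1 * p ^ (s - 1 + d)))) :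
    W (fun x => if x = 0 then 1 else 0) =
      ((P ^ 2 - P ^ 2 / P ^ 2) * p) +
      n₁ * ((P ^ 2 - P ^ 2 / 1) * p) +
      n₂ * ((P ^ 2 - P ^ 2 / 1) * p) +
      n₃ * (P ^ 2 / D + (P ^ 2 - P ^ 2 / D) * p) +
      n₄ * ((P ^ 2 - P ^ 2 / D ^ 2) * p) := by
  rw [hW, evenTerm_of_eq_zero hp (Or.inl rfl),
    evenTerm_of_eq_zero hp (Or.inl rfl),
    evenTerm_of_eq_zero hp (Or.inr rfl),
    oddTerm_of_eq_zero hp,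
    evenTerm_of_eq_zero hp (Or.inr rfl)]
  ring

theorem evenTable_max (hp2 : p ≠ 2) {n₁ n₂ n₃ n₄ : ℚ} {e : ℕ}
    (hW : ∀ ψ, W ψ = evenTerm p P (P ^ 2) ψ (1 * p ^ (2 * s - 1)) +
      (n₁ * evenTerm p P 1 ψ (1 * p ^ (s - 1)) + n₂ * evenTerm p P 1 ψ (-1 * p ^ (s - 1)) +
      n₃ * (evenTerm p P D ψ (1 * p ^ (s - 1 + e)) + evenTerm p P D ψ (-1 * p ^ (s - 1 + e))) +
      n₄ * evenTerm p P (D ^ 2) ψ (-1 * p ^ (s - 1 + d))))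
    {η : ℤ} (hη : η = 1 ∨ η = -1) (f : ℕ) :
    W (fun x => if x = (p - 1) * (η * p ^ f) then 1 else 0) =
      (if 2 * s - 1 = f ∧ 1 = η then P ^ 2 / P ^ 2 else 0) +
      n₁ * (if s - 1 = f ∧ 1 = η then P ^ 2 / 1 else 0) +
      n₂ * (if s - 1 = f ∧ -1 = η then P ^ 2 / 1 else 0) +
      n₃ * (if s - 1 + e = f ∧ 1 = η then P ^ 2 / D else 0) +
      n₃ * (if s - 1 + e = f ∧ -1 = η then P ^ 2 / D else 0) +
      n₄ * (if s - 1 + d = f ∧ -1 = η then P ^ 2 / D ^ 2 else 0) := by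
  rw [hW, evenTerm_of_eq_sub_one_mul hp hp2 (Or.inl rfl) hη,
    evenTerm_of_eq_sub_one_mul hp hp2 (Or.inl rfl) hη,
    evenTerm_of_eq_sub_one_mul hp hp2 (Or.inr rfl) hη,
    evenTerm_of_eq_sub_one_mul hp hp2 (Or.inl rfl) hη,
    evenTerm_of_eq_sub_one_mul hp hp2 (Or.inr rfl) hη,
    evenTerm_of_eq_sub_one_mul hp hp2 (Or.inr rfl) hη]
  ring

theorem evenTable_neg (hp2 : p ≠ 2) {n₁ n₂ n₃ n₄ : ℚ} {e : ℕ}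
    (hW : ∀ ψ, W ψ = evenTerm p P (P ^ 2) ψ (1 * p ^ (2 * s - 1)) +
      (n₁ * evenTerm p P 1 ψ (1 * p ^ (s - 1)) + n₂ * evenTerm p P 1 ψ (-1 * p ^ (s - 1)) +
      n₃ * (evenTerm p P D ψ (1 * p ^ (s - 1 + e)) + evenTerm p P D ψ (-1 * p ^ (s - 1 + e))) +
      n₄ * evenTerm p P (D ^ 2) ψ (-1 * p ^ (s - 1 + d))))
    {η : ℤ} (hη : η = 1 ∨ η = -1) (f : ℕ) :
    W (fun x => if x = -(η * p ^ f) then 1 else 0) =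
      (if 2 * s - 1 = f ∧ 1 = η then P ^ 2 / P ^ 2 * (p - 1) else 0) +
      n₁ * (if s - 1 = f ∧ 1 = η then P ^ 2 / 1 * (p - 1) else 0) +
      n₂ * (if s - 1 = f ∧ -1 = η then P ^ 2 / 1 * (p - 1) else 0) +
      n₃ * (if s - 1 + e = f ∧ 1 = η then P ^ 2 / D * (p - 1) else 0) +
      n₃ * (if s - 1 + e = f ∧ -1 = η then P ^ 2 / D * (p - 1) else 0) +
      n₄ * (if s - 1 + d = f ∧ -1 = η then P ^ 2 / D ^ 2 * (p - 1) else 0) := by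
  rw [hW, evenTerm_of_eq_neg hp hp2 (Or.inl rfl) hη,
    evenTerm_of_eq_neg hp hp2 (Or.inl rfl) hη,
    evenTerm_of_eq_neg hp hp2 (Or.inr rfl) hη,
    evenTerm_of_eq_neg hp hp2 (Or.inl rfl) hη,
    evenTerm_of_eq_neg hp hp2 (Or.inr rfl) hη,
    evenTerm_of_eq_neg hp hp2 (Or.inr rfl) hη]
  ring

theorem evenTable_zero {n₁ n₂ n₃ n₄ : ℚ} {e : ℕ}
    (hW : ∀ ψ, W ψ = evenTerm p P (P ^ 2) ψ (1 * p ^ (2 * s - 1)) +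
      (n₁ * evenTerm p P 1 ψ (1 * p ^ (s - 1)) + n₂ * evenTerm p P 1 ψ (-1 * p ^ (s - 1)) +
      n₃ * (evenTerm p P D ψ (1 * p ^ (s - 1 + e)) + evenTerm p P D ψ (-1 * p ^ (s - 1 + e))) +
      n₄ * evenTerm p P (D ^ 2) ψ (-1 * p ^ (s - 1 + d)))) :
    W (fun x => if x = 0 then 1 else 0) =
      ((P ^ 2 - P ^ 2 / P ^ 2) * p) +
      n₁ * ((P ^ 2 - P ^ 2 / 1) * p) +
      n₂ * ((P ^ 2 - P ^ 2 / 1) * p) +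
      n₃ * ((P ^ 2 - P ^ 2 / D) * p) +
      n₃ * ((P ^ 2 - P ^ 2 / D) * p) +
      n₄ * ((P ^ 2 - P ^ 2 / D ^ 2) * p) := by
  rw [hW, evenTerm_of_eq_zero hp (Or.inl rfl),
    evenTerm_of_eq_zero hp (Or.inl rfl),
    evenTerm_of_eq_zero hp (Or.inr rfl),
    evenTerm_of_eq_zero hp (Or.inl rfl),
    evenTerm_of_eq_zero hp (Or.inr rfl),
    evenTerm_of_eq_zero hp (Or.inr rfl)]
  ring

theorem doubleTable_max (hp2 : p ≠ 2) {n₀ n₂ n₄ : ℚ}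
    (hW : ∀ ψ, W ψ = evenTerm p P (P ^ 2) ψ (1 * p ^ (2 * s - 1)) +
      (n₀ * evenTerm p P 1 ψ (-1 * p ^ (s - 1)) +
      n₂ * evenTerm p P (D ^ 2) ψ (1 * p ^ (s - 1 + d)) +
      n₄ * evenTerm p P (D ^ 4) ψ (-1 * p ^ (s - 1 + 2 * d))))
    {η : ℤ} (hη : η = 1 ∨ η = -1) (f : ℕ) :
    W (fun x => if x = (p - 1) * (η * p ^ f) then 1 else 0) =
      (if 2 * s - 1 = f ∧ 1 = η then P ^ 2 / P ^ 2 else 0) +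
      n₀ * (if s - 1 = f ∧ -1 = η then P ^ 2 / 1 else 0) +
      n₂ * (if s - 1 + d = f ∧ 1 = η then P ^ 2 / D ^ 2 else 0) +
      n₄ * (if s - 1 + 2 * d = f ∧ -1 = η then P ^ 2 / D ^ 4 else 0) := by
  rw [hW, evenTerm_of_eq_sub_one_mul hp hp2 (Or.inl rfl) hη,
    evenTerm_of_eq_sub_one_mul hp hp2 (Or.inr rfl) hη,
    evenTerm_of_eq_sub_one_mul hp hp2 (Or.inl rfl) hη,
    evenTerm_of_eq_sub_one_mul hp hp2 (Or.inr rfl) hη]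
  ring

theorem doubleTable_neg (hp2 : p ≠ 2) {n₀ n₂ n₄ : ℚ}
    (hW : ∀ ψ, W ψ = evenTerm p P (P ^ 2) ψ (1 * p ^ (2 * s - 1)) +
      (n₀ * evenTerm p P 1 ψ (-1 * p ^ (s - 1)) +
      n₂ * evenTerm p P (D ^ 2) ψ (1 * p ^ (s - 1 + d)) +
      n₄ * evenTerm p P (D ^ 4) ψ (-1 * p ^ (s - 1 + 2 * d))))
    {η : ℤ} (hη : η = 1 ∨ η = -1) (f : ℕ) :
    W (fun x => if x = -(η * p ^ f) then 1 else 0) =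
      (if 2 * s - 1 = f ∧ 1 = η then P ^ 2 / P ^ 2 * (p - 1) else 0) +
      n₀ * (if s - 1 = f ∧ -1 = η then P ^ 2 / 1 * (p - 1) else 0) +
      n₂ * (if s - 1 + d = f ∧ 1 = η then P ^ 2 / D ^ 2 * (p - 1) else 0) +
      n₄ * (if s - 1 + 2 * d = f ∧ -1 = η then P ^ 2 / D ^ 4 * (p - 1) else 0) := by
  rw [hW, evenTerm_of_eq_neg hp hp2 (Or.inl rfl) hη,
    evenTerm_of_eq_neg hp hp2 (Or.inr rfl) hη,
    evenTerm_of_eq_neg hp hp2 (Or.inl rfl) hη,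
    evenTerm_of_eq_neg hp hp2 (Or.inr rfl) hη]
  ring

theorem doubleTable_zero {n₀ n₂ n₄ : ℚ}
    (hW : ∀ ψ, W ψ = evenTerm p P (P ^ 2) ψ (1 * p ^ (2 * s - 1)) +
      (n₀ * evenTerm p P 1 ψ (-1 * p ^ (s - 1)) +
      n₂ * evenTerm p P (D ^ 2) ψ (1 * p ^ (s - 1 + d)) +
      n₄ * evenTerm p P (D ^ 4) ψ (-1 * p ^ (s - 1 + 2 * d)))) :
    W (fun x => if x = 0 then 1 else 0) =
      ((P ^ 2 - P ^ 2 / P ^ 2) * p) +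
      n₀ * ((P ^ 2 - P ^ 2 / 1) * p) +
      n₂ * ((P ^ 2 - P ^ 2 / D ^ 2) * p) +
      n₄ * ((P ^ 2 - P ^ 2 / D ^ 4) * p) := by
  rw [hW, evenTerm_of_eq_zero hp (Or.inl rfl),
    evenTerm_of_eq_zero hp (Or.inr rfl),
    evenTerm_of_eq_zero hp (Or.inl rfl),
    evenTerm_of_eq_zero hp (Or.inr rfl)]
  ring

end Tables

/-! ### Designs from a single deviation, and the parameters for d' = d odd. -/

section DesignParameters

variable {p s l d : ℕ} [Fact p.Prime] {K : Type*} [Field K] [Algebra (ZMod p) K]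
  [Fintype K] [DecidableEq K] {τ κ : K ≃+* K}

namespace KasamiSetting

variable (h : KasamiSetting p s τ κ) (hτ : ∀ x, τ (κ x) = x ^ p ^ l)
  {α : K} (hα : IsPrimitiveRoot α (p ^ (2 * s) - 1))
include h hτ hα

section

variable {q : ℕ} (hq : (Finset.univ.filter fun x => τ x = x).card = q) (hq1 : 1 < q)
  (hqP : q ^ 2 < (p ^ s) ^ 2)
  (hsmall : wordSum p s τ κ (fun x => if (p : ℤ) ^ (2 * s - 2) < x then 1 else 0) = 1)
include hq hq1 hqP hsmall

theorem givesTwoDesign_of_sub_one_mul {η : ℤ} (hη : η = 1 ∨ η = -1) {f : ℕ} (hf : f ≤ 2 * s - 2)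
    (hf' : η = 1 → f + 1 ≤ 2 * s - 2) {A i lam : ℚ}
    (hA : wordSum p s τ κ (fun x => if x = (p - 1) * (η * p ^ f) then 1 else 0) = A) (hA0 : 0 < A)
    (hi : i = (p : ℚ) ^ (2 * s) - p ^ (2 * s - 1) - (p - 1) * (η * p ^ f))
    (hlam : lam * ((p : ℚ) ^ (2 * s) * (p ^ (2 * s) - 1)) * (p - 1) = A * (i * (i - 1))) :
    GivesTwoDesign (kasamiDualExtDual p s l α) (p ^ (2 * s)) (i, lam) := by
  have hp1 : (1 : ℤ) ≤ p := by exact_mod_cast (Fact.out : p.Prime).one_lt.le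
  have h0 : (0 : ℤ) < p ^ f := by positivity
  have h2 : (p : ℤ) ^ f ≤ p ^ (2 * s - 2) := pow_le_pow_right₀ hp1 hf
  refine h.givesTwoDesign hτ hq hq1 hqP hα hsmall (δ := (p - 1) * (η * p ^ f)) ?_ ?_ ?_ ?_ ?_
  · rcases hη with rfl | rfl <;> nlinarith
  · rcases hη with rfl | rfl
    · have h1 : (p : ℤ) ^ (f + 1) ≤ p ^ (2 * s - 2) := pow_le_pow_right₀ hp1 (hf' rfl)
      rw [pow_succ] at h1
      nlinarith
    · nlinarith
  · rw [hi]; push_cast; ring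
  · rw [hA]; exact hA0.ne'
  · rw [hA, hlam]

theorem givesTwoDesign_of_neg {η : ℤ} (hη : η = 1 ∨ η = -1) {f : ℕ} (hf : f ≤ 2 * s - 2)
    {A i lam : ℚ} (hA : wordSum p s τ κ (fun x => if x = -(η * p ^ f) then 1 else 0) = A)
    (hA0 : 0 < A) (hi : i = (p : ℚ) ^ (2 * s) - p ^ (2 * s - 1) + η * p ^ f)
    (hlam : lam * ((p : ℚ) ^ (2 * s) * (p ^ (2 * s) - 1)) * (p - 1) = A * (i * (i - 1))) :
    GivesTwoDesign (kasamiDualExtDual p s l α) (p ^ (2 * s)) (i, lam) := by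
  have hp1 : (2 : ℤ) ≤ p := by exact_mod_cast (Fact.out : p.Prime).two_le
  have h0 : (0 : ℤ) < p ^ f := by positivity
  have h2 : (p : ℤ) ^ f ≤ p ^ (2 * s - 2) := pow_le_pow_right₀ (by linarith) hf
  refine h.givesTwoDesign hτ hq hq1 hqP hα hsmall (δ := -(η * p ^ f)) ?_ ?_ ?_ ?_ ?_
  · rcases hη with rfl | rfl <;> nlinarith
  · rcases hη with rfl | rfl <;> nlinarith
  · rw [hi]; push_cast; ring
  · rw [hA]; exact hA0.ne'
  · rw [hA, hlam]

theorem givesTwoDesign_of_zero {A i lam : ℚ}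
    (hA : wordSum p s τ κ (fun x => if x = 0 then 1 else 0) = A)
    (hA0 : 0 < A) (hi : i = (p : ℚ) ^ (2 * s) - p ^ (2 * s - 1))
    (hlam : lam * ((p : ℚ) ^ (2 * s) * (p ^ (2 * s) - 1)) * (p - 1) = A * (i * (i - 1))) :
    GivesTwoDesign (kasamiDualExtDual p s l α) (p ^ (2 * s)) (i, lam) := by
  have hp1 : (1 : ℤ) ≤ p := by exact_mod_cast (Fact.out : p.Prime).one_lt.le
  have h0 : (0 : ℤ) < p ^ (2 * s - 2) := by positivity
  refine h.givesTwoDesign hτ hq hq1 hqP hα hsmall (δ := 0) ?_ ?_ ?_ ?_ ?_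
  · nlinarith
  · exact h0.le
  · rw [hi]; push_cast; ring
  · rw [hA]; exact hA0.ne'
  · rw [hA, hlam]

end

section CaseOne

variable {k : Type*} [Field k] [Fintype k] [DecidableEq k] [Algebra k K] [Algebra (ZMod p) k]
  [IsScalarTower (ZMod p) k K]
  (hd : 0 < d) (hds : 2 * d ≤ s)
  (hfix : ∀ x : K, τ x = x ↔ ∃ r : k, algebraMap k K r = x)
  (hκk : ∀ r : k, κ (algebraMap k K r) = algebraMap k K r)
  (hk : Fintype.card k = p ^ d)
include hfix hκk hk hd hds

set_option maxHeartbeats 1000000 in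
theorem givesTwoDesign_of_odd (hodd : Odd d) : ∀ x ∈ oddPairs p (2 * s) s d,
    GivesTwoDesign (kasamiDualExtDual p s l α) (p ^ (2 * s)) x := by
  obtain ⟨j, hj⟩ := id hodd
  have hp := (Fact.out : p.Prime)
  have hp2 := h.ne_two
  have hq := card_fixed_tau (τ := τ) hfix hk
  have hq1 : 1 < p ^ d := Nat.one_lt_pow hd.ne' hp.one_lt
  have hqP := pow_lt_pow_card (p := p) (s := s) d (by omega)
  have hp3 : (3 : ℚ) ≤ p := by exact_mod_cast (by have := hp.two_le; omega : 3 ≤ p)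
  have hp0 : (p : ℚ) ≠ 0 := by linarith
  -- All powers of p are rewritten through p, P, D and g, which turns each claim into an identity of
  -- rational functions.
  obtain ⟨P, hP⟩ : ∃ P : ℚ, (p : ℚ) ^ s = P := ⟨_, rfl⟩
  obtain ⟨D, hD⟩ : ∃ D : ℚ, (p : ℚ) ^ d = D := ⟨_, rfl⟩
  obtain ⟨g, hg⟩ : ∃ g : ℚ, (p : ℚ) ^ j = g := ⟨_, rfl⟩
  have hDg : D = p * g ^ 2 := by rw [← hD, ← hg, hj, ← pow_mul, ← pow_succ']; congr 1; omega
  have hpD : (p : ℚ) ≤ D := by rw [← hD]; exact le_self_pow₀ (by linarith) hd.ne'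
  have hDP : D < P := by
    rw [← hP, ← hD]; exact pow_lt_pow_right₀ (by linarith) (by omega)
  have hg0 : 0 < g := by rw [← hg]; positivity
  have hD0 : 0 < D := by linarith
  have hP0 : 0 < P := by linarith
  have hW := h.wordSum_eq_of_odd hd hds hfix hκk hk hodd hP.symm hD.symm
  have q0 : D ≠ 0 := hD0.ne'
  have q1 : (p : ℚ) - 1 ≠ 0 := by linarith
  have q2 : D - 1 ≠ 0 := by linarith
  have q3 : D + 1 ≠ 0 := by linarith
  have q4 : P + 1 ≠ 0 := by linarith
  have q5 : D ^ 2 - 1 = (D - 1) * (D + 1) := by ring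
  have r1 : 0 < (p : ℚ) - 1 := by linarith
  have r2 : 0 < P ^ 2 - 1 := by
    have : 0 < (P - 1) * (P + 1) := mul_pos (by linarith) (by linarith)
    linarith
  have r3 : 0 < P - D := by linarith
  have r4 : 0 < D - 1 := by linarith
  have r5 : 0 < P - 1 := by linarith
  have r6 : 0 < D * P ^ 2 - 2 * P ^ 2 + D := by
    have : 0 < (D - 2) * P ^ 2 := mul_pos (by linarith) (by positivity)
    linarith
  have r7 : 0 < D ^ 2 - 1 := by rw [q5]; exact mul_pos r4 (by linarith)
  have hsmall := oddTable_lt hp hP0.ne' hd hds hW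
  have Gmax := fun {η : ℤ} => h.givesTwoDesign_of_sub_one_mul hτ hα hq hq1 hqP hsmall (η := η)
  have Gneg := fun {η : ℤ} => h.givesTwoDesign_of_neg hτ hα hq hq1 hqP hsmall (η := η)
  have Gzero := fun {A i lam : ℚ} =>
    h.givesTwoDesign_of_zero hτ hα hq hq1 hqP hsmall (A := A) (i := i) (lam := lam)
  have hmax := fun {η : ℤ} => oddTable_max hp hp2 hW (η := η)
  have hneg := fun {η : ℤ} => oddTable_neg hp hp2 hW (η := η)
  have hzero := oddTable_zero hp hW
  clear hW hsmall hqP hq1 hq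
  have j1 : (d - 1) / 2 = j := by omega
  have j2 : (3 * d + 1) / 2 = 3 * j + 2 := by omega
  rw [oddPairs, List.forall_mem_append, List.forall_mem_append]
  simp only [List.forall_mem_cons, List.not_mem_nil, IsEmpty.forall_iff, implies_true, and_true, oddWeightSign, oddLamSign,
    oddWeightSeven, oddLamSeven, j1, j2]
  simp only [j1] at hneg hmax
  refine ⟨⟨⟨?_, ?_, ?_, ?_, ?_⟩, ?_⟩, ?_, ?_⟩
  · refine Gmax (Or.inl rfl) (f := s - 1) (by omega) (by omega) (A := D * (P ^ 2 - 1) * (P + 1) / (2 * (D + 1)) * P ^ 2) ?_ (by positivity) ?_ ?_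
    · rw [hmax (Or.inl rfl), if_neg (by omega), if_pos (by omega), if_neg (by omega), if_neg (by omega)]
      ring
    · simp (disch := first | assumption | omega) only [pow_sub₀, pow_add, pow_mul', pow_one, hP, hD]
      push_cast
      field_simp
    · simp (disch := first | assumption | omega) only [pow_sub₀, pow_add, pow_mul', pow_one, hP, hD]
      field_simp
      ring
  · refine Gneg (Or.inl rfl) (f := s - 1) (by omega) (A := D * (P ^ 2 - 1) * (P + 1) / (2 * (D + 1)) * (P ^ 2 * (p - 1))) ?_ (by positivity) ?_ ?_
    · rw [hneg (Or.inl rfl), if_neg (by omega), if_pos (by omega), if_neg (by omega), if_neg (by omega), if_neg (by omega)]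
      ring
    · simp (disch := first | assumption | omega) only [pow_sub₀, pow_add, pow_mul', pow_one, hP, hD]
      push_cast
      field_simp
    · simp (disch := first | assumption | omega) only [pow_sub₀, pow_add, pow_mul', pow_one, hP, hD]
      field_simp
  · refine Gmax (Or.inr rfl) (f := s - 1) (by omega) (by omega) (A := (D * P ^ 2 - 2 * P ^ 2 + D) * (P - 1) / (2 * (D - 1)) * P ^ 2) ?_ (by positivity) ?_ ?_
    · rw [hmax (Or.inr rfl), if_neg (by omega), if_neg (by omega), if_pos (by omega), if_neg (by omega)]
      ring
    · simp (disch := first | assumption | omega) only [pow_sub₀, pow_add, pow_mul', pow_one, hP, hD]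
      push_cast
      field_simp
      ring
    · simp (disch := first | assumption | omega) only [pow_sub₀, pow_add, pow_mul', pow_one, hP, hD]
      field_simp
      ring
  · refine Gneg (Or.inr rfl) (f := s - 1) (by omega) (A := (D * P ^ 2 - 2 * P ^ 2 + D) * (P - 1) / (2 * (D - 1)) * (P ^ 2 * (p - 1))) ?_ (by positivity) ?_ ?_
    · rw [hneg (Or.inr rfl), if_neg (by omega), if_neg (by omega), if_pos (by omega), if_neg (by omega), if_neg (by omega)]
      ring
    · simp (disch := first | assumption | omega) only [pow_sub₀, pow_add, pow_mul', pow_one, hP, hD]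
      push_cast
      field_simp
      ring
    · simp (disch := first | assumption | omega) only [pow_sub₀, pow_add, pow_mul', pow_one, hP, hD]
      field_simp
      ring
  · refine Gneg (Or.inl rfl) (f := s + j) (by omega) (A := (P ^ 2 - 1) * P / D * (P ^ 2 / D * ((p - 1) / 2))) ?_ (by positivity) ?_ ?_
    · rw [hneg (Or.inl rfl), if_neg (by omega), if_neg (by omega), if_neg (by omega), if_pos (by omega), if_neg (by omega)]
      ring
    · simp (disch := first | assumption | omega) only [pow_sub₀, pow_add, pow_mul', pow_one, hP, hD, hg]
      push_cast
      field_simp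
    · simp (disch := first | assumption | omega) only [pow_sub₀, pow_add, pow_mul', pow_one, hP, hD, hg]
      subst hDg
      field_simp
  -- For d = 1 the exponents s + (d-1)/2 and s - 1 + d coincide, so the corank-one family of
  -- negative sign and the corank-two family share a weight and their frequencies add.
  · split_ifs with hd1
    · obtain rfl : j = 0 := by omega
      subst hd1
      rw [pow_zero] at hg
      rw [pow_one] at hD
      subst hg hD
      simp only [List.forall_mem_cons, List.not_mem_nil, IsEmpty.forall_iff, implies_true, and_true]
      · refine Gneg (Or.inr rfl) (f := s + 0) (by omega)
          (A := (P ^ 2 - 1) * P / p * (P ^ 2 / p * ((p - 1) / 2)) + (P ^ 2 - 1) * (P - p) / ((p ^ 2 - 1) * p) * (P ^ 2 / p ^ 2 * (p - 1))) ?_ (by positivity) ?_ ?_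
        · rw [hneg (Or.inr rfl), if_neg (by omega), if_neg (by omega), if_neg (by omega), if_pos (by omega), if_pos (by omega)]
          ring
        · simp (disch := first | assumption | omega) only [pow_sub₀, pow_add, pow_mul', pow_one, hP, pow_zero, one_pow, mul_zero]
          push_cast
          field_simp
          ring
        · simp (disch := first | assumption | omega) only [pow_sub₀, pow_add, pow_mul', pow_one, hP, pow_zero, one_pow, mul_zero]
          field_simp
          ring
    · simp only [List.forall_mem_cons, List.not_mem_nil, IsEmpty.forall_iff, implies_true, and_true]
      refine ⟨?_, ?_⟩
      · refine Gneg (Or.inr rfl) (f := s + j) (by omega)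
          (A := (P ^ 2 - 1) * P / D * (P ^ 2 / D * ((p - 1) / 2))) ?_ (by positivity) ?_ ?_
        · rw [hneg (Or.inr rfl), if_neg (by omega), if_neg (by omega), if_neg (by omega), if_pos (by omega), if_neg (by omega)]
          ring
        · simp (disch := first | assumption | omega) only [pow_sub₀, pow_add, pow_mul', pow_one, hP, hg]
          push_cast
          field_simp
        · simp (disch := first | assumption | omega) only [pow_sub₀, pow_add, pow_mul', pow_one, hP, hg]
          subst hDg
          field_simp
      · refine Gneg (Or.inr rfl) (f := s - 1 + d) (by omega)
          (A := (P ^ 2 - 1) * (P - D) / ((D ^ 2 - 1) * D) * (P ^ 2 / D ^ 2 * (p - 1))) ?_ (by positivity) ?_ ?_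
        · rw [hneg (Or.inr rfl), if_neg (by omega), if_neg (by omega), if_neg (by omega), if_neg (by omega), if_pos (by omega)]
          ring
        · simp (disch := first | assumption | omega) only [pow_sub₀, pow_add, pow_mul', pow_one, hP, hD]
          push_cast
          field_simp
          ring
        · simp (disch := first | assumption | omega) only [pow_sub₀, pow_add, pow_mul', pow_one, hP, hD]
          field_simp
  · refine Gmax (Or.inr rfl) (f := s - 1 + d) (by omega) (by omega)
      (A := (P ^ 2 - 1) * (P - D) / ((D ^ 2 - 1) * D) * (P ^ 2 / D ^ 2)) ?_ (by positivity) ?_ ?_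
    · rw [hmax (Or.inr rfl), if_neg (by omega), if_neg (by omega), if_neg (by omega), if_pos (by omega)]
      ring
    · simp (disch := first | assumption | omega) only [pow_sub₀, pow_add, pow_mul', pow_one, hP, hD]
      push_cast
      field_simp
      ring
    · simp (disch := first | assumption | omega) only [pow_sub₀, pow_add, pow_mul', pow_one, hP, hD]
      field_simp
  -- Nondegenerate forms drop out: every c is in the range of E, and no level has the mean size.
  · refine Gzero (A := (P ^ 2 - 1) * p + (P ^ 2 - 1) * P / D * (P ^ 2 / D + P ^ 2 * (D - 1) / D * p) +
      (P ^ 2 - 1) * (P - D) / ((D ^ 2 - 1) * D) * (P ^ 2 * (D ^ 2 - 1) / D ^ 2 * p)) ?_ (by positivity) ?_ ?_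
    · rw [hzero]
      field_simp
      ring
    · simp (disch := first | assumption | omega) only [pow_sub₀, pow_mul', pow_one, hP]
      field_simp
    · simp (disch := first | assumption | omega) only [pow_sub₀, pow_add, pow_mul', pow_one, hP, hD]
      field_simp
      ring

end CaseOne

end KasamiSetting

end DesignParameters

/-! ### The parameters for d' = d even. -/

section DesignParameters

variable {p s l d : ℕ} [Fact p.Prime] {K : Type*} [Field K] [Algebra (ZMod p) K]
  [Fintype K] [DecidableEq K] {τ κ : K ≃+* K}

namespace KasamiSetting

variable (h : KasamiSetting p s τ κ) (hτ : ∀ x, τ (κ x) = x ^ p ^ l)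
  {α : K} (hα : IsPrimitiveRoot α (p ^ (2 * s) - 1))
include h hτ hα

section CaseOne

variable {k : Type*} [Field k] [Fintype k] [DecidableEq k] [Algebra k K] [Algebra (ZMod p) k]
  [IsScalarTower (ZMod p) k K]
  (hd : 0 < d) (hds : 2 * d ≤ s)
  (hfix : ∀ x : K, τ x = x ↔ ∃ r : k, algebraMap k K r = x)
  (hκk : ∀ r : k, κ (algebraMap k K r) = algebraMap k K r)
  (hk : Fintype.card k = p ^ d)
include hfix hκk hk hd hds

set_option maxHeartbeats 1000000 in
theorem givesTwoDesign_of_even {j : ℕ} (hj : d = 2 * j) : ∀ x ∈ evenPairs p (2 * s) s d,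
    GivesTwoDesign (kasamiDualExtDual p s l α) (p ^ (2 * s)) x := by
  have hp := (Fact.out : p.Prime)
  have hp2 := h.ne_two
  have hq := card_fixed_tau (τ := τ) hfix hk
  have hq1 : 1 < p ^ d := Nat.one_lt_pow hd.ne' hp.one_lt
  have hqP := pow_lt_pow_card (p := p) (s := s) d (by omega)
  have hp3 : (3 : ℚ) ≤ p := by exact_mod_cast (by have := hp.two_le; omega : 3 ≤ p)
  have hp0 : (p : ℚ) ≠ 0 := by linarith
  obtain ⟨P, hP⟩ : ∃ P : ℚ, (p : ℚ) ^ s = P := ⟨_, rfl⟩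
  obtain ⟨D, hD⟩ : ∃ D : ℚ, (p : ℚ) ^ d = D := ⟨_, rfl⟩
  obtain ⟨g, hg⟩ : ∃ g : ℚ, (p : ℚ) ^ j = g := ⟨_, rfl⟩
  have hDg : D = g ^ 2 := by rw [← hD, ← hg, hj, ← pow_mul, mul_comm]
  have hpD : (p : ℚ) ≤ D := by rw [← hD]; exact le_self_pow₀ (by linarith) hd.ne'
  have hDP : D < P := by
    rw [← hP, ← hD]; exact pow_lt_pow_right₀ (by linarith) (by omega)
  have hg0 : 0 < g := by rw [← hg]; positivity
  have hD0 : 0 < D := by linarith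
  have hP0 : 0 < P := by linarith
  have hW := h.wordSum_eq_of_even hd hds hfix hκk hk hj hP.symm hD.symm
  have q0 : D ≠ 0 := hD0.ne'
  have q1 : (p : ℚ) - 1 ≠ 0 := by linarith
  have q2 : D - 1 ≠ 0 := by linarith
  have q3 : D + 1 ≠ 0 := by linarith
  have q4 : P + 1 ≠ 0 := by linarith
  have q5 : D ^ 2 - 1 = (D - 1) * (D + 1) := by ring
  have r1 : 0 < (p : ℚ) - 1 := by linarith
  have r2 : 0 < P ^ 2 - 1 := by
    have : 0 < (P - 1) * (P + 1) := mul_pos (by linarith) (by linarith)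
    linarith
  have r3 : 0 < P - D := by linarith
  have r4 : 0 < D - 1 := by linarith
  have r5 : 0 < P - 1 := by linarith
  have r6 : 0 < D * P ^ 2 - 2 * P ^ 2 + D := by
    have : 0 < (D - 2) * P ^ 2 := mul_pos (by linarith) (by positivity)
    linarith
  have r7 : 0 < D ^ 2 - 1 := by rw [q5]; exact mul_pos r4 (by linarith)
  have hsmall := evenTable_lt hp hP0.ne' hd hds hj hW
  have Gmax := fun {η : ℤ} => h.givesTwoDesign_of_sub_one_mul hτ hα hq hq1 hqP hsmall (η := η)
  have Gneg := fun {η : ℤ} => h.givesTwoDesign_of_neg hτ hα hq hq1 hqP hsmall (η := η)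
  have Gzero := fun {A i lam : ℚ} =>
    h.givesTwoDesign_of_zero hτ hα hq hq1 hqP hsmall (A := A) (i := i) (lam := lam)
  have hmax := fun {η : ℤ} => evenTable_max hp hp2 hW (η := η)
  have hneg := fun {η : ℤ} => evenTable_neg hp hp2 hW (η := η)
  have hzero := evenTable_zero hp hW
  clear hW hsmall hqP hq1 hq
  have j1 : d / 2 = j := by omega
  have j2 : 3 * d / 2 = 3 * j := by omega
  simp only [evenPairs, evenPairsSign, List.forall_mem_append, List.forall_mem_cons,
    List.not_mem_nil, IsEmpty.forall_iff, implies_true, and_true, j1, j2]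
  refine ⟨⟨⟨⟨?_, ?_, ?_, ?_⟩, ?_, ?_⟩, ?_, ?_⟩, ?_, ?_, ?_⟩
  · refine Gmax (Or.inl rfl) (f := s - 1) (by omega) (by omega)
      (A := D * (P ^ 2 - 1) * (P + 1) / (2 * (D + 1)) * P ^ 2) ?_ (by positivity) ?_ ?_
    · rw [hmax (Or.inl rfl), if_neg (by omega), if_pos (by omega), if_neg (by omega), if_neg (by omega), if_neg (by omega), if_neg (by omega)]
      ring
    · simp (disch := first | assumption | omega) only [pow_sub₀, pow_add, pow_mul', pow_one, hP, hD]
      push_cast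
      field_simp
    · simp (disch := first | assumption | omega) only [pow_sub₀, pow_add, pow_mul', pow_one, hP, hD]
      field_simp
      ring
  · refine Gneg (Or.inl rfl) (f := s - 1) (by omega)
      (A := D * (P ^ 2 - 1) * (P + 1) / (2 * (D + 1)) * (P ^ 2 * (p - 1))) ?_ (by positivity) ?_ ?_
    · rw [hneg (Or.inl rfl), if_neg (by omega), if_pos (by omega), if_neg (by omega), if_neg (by omega), if_neg (by omega), if_neg (by omega)]
      ring
    · simp (disch := first | assumption | omega) only [pow_sub₀, pow_add, pow_mul', pow_one, hP, hD]
      push_cast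
      field_simp
    · simp (disch := first | assumption | omega) only [pow_sub₀, pow_add, pow_mul', pow_one, hP, hD]
      field_simp
  · refine Gmax (Or.inr rfl) (f := s - 1) (by omega) (by omega)
      (A := (D * P ^ 2 - 2 * P ^ 2 + D) * (P - 1) / (2 * (D - 1)) * P ^ 2) ?_ (by positivity) ?_ ?_
    · rw [hmax (Or.inr rfl), if_neg (by omega), if_neg (by omega), if_pos (by omega), if_neg (by omega), if_neg (by omega), if_neg (by omega)]
      ring
    · simp (disch := first | assumption | omega) only [pow_sub₀, pow_add, pow_mul', pow_one, hP, hD]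
      push_cast
      field_simp
      ring
    · simp (disch := first | assumption | omega) only [pow_sub₀, pow_add, pow_mul', pow_one, hP, hD]
      field_simp
      ring
  · refine Gneg (Or.inr rfl) (f := s - 1) (by omega)
      (A := (D * P ^ 2 - 2 * P ^ 2 + D) * (P - 1) / (2 * (D - 1)) * (P ^ 2 * (p - 1))) ?_ (by positivity) ?_ ?_
    · rw [hneg (Or.inr rfl), if_neg (by omega), if_neg (by omega), if_pos (by omega), if_neg (by omega), if_neg (by omega), if_neg (by omega)]
      ring
    · simp (disch := first | assumption | omega) only [pow_sub₀, pow_add, pow_mul', pow_one, hP, hD]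
      push_cast
      field_simp
      ring
    · simp (disch := first | assumption | omega) only [pow_sub₀, pow_add, pow_mul', pow_one, hP, hD]
      field_simp
      ring
  -- Weight is the mean minus the deviation. The deviation is (p - 1)ηp^f in the first family and
  -- -ηp^f in the second, so the sign 1 of the pair means η = -1 here and η = 1 there.
  · refine Gmax (Or.inr rfl) (f := s - 1 + j) (by omega) (by omega)
      (A := (P ^ 2 - 1) * P / (2 * D) * (P ^ 2 / D)) ?_ (by positivity) ?_ ?_
    · rw [hmax (Or.inr rfl), if_neg (by omega), if_neg (by omega), if_neg (by omega), if_neg (by omega), if_pos (by omega), if_neg (by omega)]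
      ring
    · simp (disch := first | assumption | omega) only [pow_sub₀, pow_add, pow_mul', pow_one, hP, hg]
      push_cast
      field_simp
      ring
    · simp (disch := first | assumption | omega) only [pow_sub₀, pow_add, pow_mul', pow_one, hP, hg]
      subst hDg
      field_simp
  · refine Gneg (Or.inl rfl) (f := s - 1 + j) (by omega)
      (A := (P ^ 2 - 1) * P / (2 * D) * (P ^ 2 / D * (p - 1))) ?_ (by positivity) ?_ ?_
    · rw [hneg (Or.inl rfl), if_neg (by omega), if_neg (by omega), if_neg (by omega), if_pos (by omega), if_neg (by omega), if_neg (by omega)]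
      ring
    · simp (disch := first | assumption | omega) only [pow_sub₀, pow_add, pow_mul', pow_one, hP, hg]
      push_cast
      field_simp
    · simp (disch := first | assumption | omega) only [pow_sub₀, pow_add, pow_mul', pow_one, hP, hg]
      subst hDg
      field_simp
  · refine Gmax (Or.inl rfl) (f := s - 1 + j) (by omega) (by omega)
      (A := (P ^ 2 - 1) * P / (2 * D) * (P ^ 2 / D)) ?_ (by positivity) ?_ ?_
    · rw [hmax (Or.inl rfl), if_neg (by omega), if_neg (by omega), if_neg (by omega), if_pos (by omega), if_neg (by omega), if_neg (by omega)]
      ring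
    · simp (disch := first | assumption | omega) only [pow_sub₀, pow_add, pow_mul', pow_one, hP, hg]
      push_cast
      field_simp
      ring
    · simp (disch := first | assumption | omega) only [pow_sub₀, pow_add, pow_mul', pow_one, hP, hg]
      subst hDg
      field_simp
  · refine Gneg (Or.inr rfl) (f := s - 1 + j) (by omega)
      (A := (P ^ 2 - 1) * P / (2 * D) * (P ^ 2 / D * (p - 1))) ?_ (by positivity) ?_ ?_
    · rw [hneg (Or.inr rfl), if_neg (by omega), if_neg (by omega), if_neg (by omega), if_neg (by omega), if_pos (by omega), if_neg (by omega)]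
      ring
    · simp (disch := first | assumption | omega) only [pow_sub₀, pow_add, pow_mul', pow_one, hP, hg]
      push_cast
      field_simp
    · simp (disch := first | assumption | omega) only [pow_sub₀, pow_add, pow_mul', pow_one, hP, hg]
      subst hDg
      field_simp
  · refine Gmax (Or.inr rfl) (f := s - 1 + d) (by omega) (by omega)
      (A := (P ^ 2 - 1) * (P - D) / ((D ^ 2 - 1) * D) * (P ^ 2 / D ^ 2)) ?_ (by positivity) ?_ ?_
    · rw [hmax (Or.inr rfl), if_neg (by omega), if_neg (by omega), if_neg (by omega), if_neg (by omega), if_neg (by omega), if_pos (by omega)]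
      ring
    · simp (disch := first | assumption | omega) only [pow_sub₀, pow_add, pow_mul', pow_one, hP, hD]
      push_cast
      field_simp
      ring
    · simp (disch := first | assumption | omega) only [pow_sub₀, pow_add, pow_mul', pow_one, hP, hD]
      field_simp
      ring
  · refine Gneg (Or.inr rfl) (f := s - 1 + d) (by omega)
      (A := (P ^ 2 - 1) * (P - D) / ((D ^ 2 - 1) * D) * (P ^ 2 / D ^ 2 * (p - 1))) ?_ (by positivity) ?_ ?_
    · rw [hneg (Or.inr rfl), if_neg (by omega), if_neg (by omega), if_neg (by omega), if_neg (by omega), if_neg (by omega), if_pos (by omega)]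
      ring
    · simp (disch := first | assumption | omega) only [pow_sub₀, pow_add, pow_mul', pow_one, hP, hD]
      push_cast
      field_simp
      ring
    · simp (disch := first | assumption | omega) only [pow_sub₀, pow_add, pow_mul', pow_one, hP, hD]
      field_simp
  · refine Gzero (A := (P ^ 2 - 1) * p + (P ^ 2 - 1) * P / D * (P ^ 2 * (D - 1) / D * p) +
      (P ^ 2 - 1) * (P - D) / ((D ^ 2 - 1) * D) * (P ^ 2 * (D ^ 2 - 1) / D ^ 2 * p)) ?_ (by positivity) ?_ ?_
    · rw [hzero]
      field_simp
      ring
    · simp (disch := first | assumption | omega) only [pow_sub₀, pow_mul', pow_one, hP]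
      field_simp
    · simp (disch := first | assumption | omega) only [pow_sub₀, pow_add, pow_mul', pow_one, hP, hD]
      field_simp
      ring

end CaseOne

end KasamiSetting

end DesignParameters

/-! ### The parameters for d' = 2d. -/

section DesignParameters

variable {p s l d : ℕ} [Fact p.Prime] {K : Type*} [Field K] [Algebra (ZMod p) K]
  [Fintype K] [DecidableEq K] {τ κ : K ≃+* K}

namespace KasamiSetting

variable (h : KasamiSetting p s τ κ) (hτ : ∀ x, τ (κ x) = x ^ p ^ l)
  {α : K} (hα : IsPrimitiveRoot α (p ^ (2 * s) - 1))
include h hτ hα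

section CaseTwo

variable (hd : 0 < d) (hds : 3 * d ≤ s)
  (hfix : (Finset.univ.filter fun x => τ x = x).card = (p ^ d) ^ 2)
  (hanti : (Finset.univ.filter fun x => τ x = x ∧ κ x = -x).card = p ^ d)
  (hU : (Finset.univ.filter fun u : K => u ^ (p ^ d + 1) = 1).card = p ^ d + 1)
  (hUκ : ∀ u : K, u ^ (p ^ d + 1) = 1 → u * κ u = 1)
  (hUτ : ∀ u : K, u ^ (p ^ d + 1) = 1 → u * τ (κ u) = 1)
  (hdvd : ((p : ℤ) ^ d + 1) ∣ p ^ s + 1)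
include hd hds hfix hanti hU hUκ hUτ hdvd

set_option maxHeartbeats 1000000 in
theorem givesTwoDesign_of_double : ∀ x ∈ doublePairs p (2 * s) s d,
    GivesTwoDesign (kasamiDualExtDual p s l α) (p ^ (2 * s)) x := by
  have hp := (Fact.out : p.Prime)
  have hp2 := h.ne_two
  have hq := hfix
  have hq1 : 1 < (p ^ d) ^ 2 := by
    rw [← pow_mul]; exact Nat.one_lt_pow (by omega) hp.one_lt
  have hqP : ((p ^ d) ^ 2) ^ 2 < (p ^ s) ^ 2 := by
    rw [← pow_mul p d 2]; exact pow_lt_pow_card _ (by omega)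
  have hp3 : (3 : ℚ) ≤ p := by exact_mod_cast (by have := hp.two_le; omega : 3 ≤ p)
  have hp0 : (p : ℚ) ≠ 0 := by linarith
  obtain ⟨P, hP⟩ : ∃ P : ℚ, (p : ℚ) ^ s = P := ⟨_, rfl⟩
  obtain ⟨D, hD⟩ : ∃ D : ℚ, (p : ℚ) ^ d = D := ⟨_, rfl⟩
  have hpD : (p : ℚ) ≤ D := by rw [← hD]; exact le_self_pow₀ (by linarith) hd.ne'
  have hDP : D < P := by
    rw [← hP, ← hD]; exact pow_lt_pow_right₀ (by linarith) (by omega)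
  have hD0 : 0 < D := by linarith
  have hP0 : 0 < P := by linarith
  have hW := h.wordSum_eq_of_double hd hds hfix hanti hU hUκ hUτ hdvd hP.symm hD.symm
  have q0 : D ≠ 0 := hD0.ne'
  have q1 : (p : ℚ) - 1 ≠ 0 := by linarith
  have q2 : D - 1 ≠ 0 := by linarith
  have q3 : D + 1 ≠ 0 := by linarith
  have q4 : P + 1 ≠ 0 := by linarith
  have q5 : D ^ 2 - 1 = (D - 1) * (D + 1) := by ring
  have r1 : 0 < (p : ℚ) - 1 := by linarith
  have r2 : 0 < P ^ 2 - 1 := by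
    have : 0 < (P - 1) * (P + 1) := mul_pos (by linarith) (by linarith)
    linarith
  have r3 : 0 < P - D := by linarith
  have r4 : 0 < D - 1 := by linarith
  have r5 : 0 < P - 1 := by linarith
  have r6 : 0 < D ^ 3 * P ^ 2 - D * P ^ 2 - P ^ 2 + D ^ 3 * P - D ^ 2 * P + D ^ 3 := by
    have h1 : 0 < ((D ^ 2 - 1) * D - 1) * P ^ 2 :=
      mul_pos (by nlinarith [mul_pos r4 hD0]) (by positivity)
    have h2 : 0 < (D - 1) * (D ^ 2 * P) := mul_pos r4 (by positivity)
    have h3 : 0 < D ^ 3 := by positivity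
    linarith
  have r7 : 0 < D ^ 2 - 1 := by rw [q5]; exact mul_pos r4 (by linarith)
  have hsmall := doubleTable_lt hp hP0.ne' hd hds hW
  have Gmax := fun {η : ℤ} => h.givesTwoDesign_of_sub_one_mul hτ hα hq hq1 hqP hsmall (η := η)
  have Gneg := fun {η : ℤ} => h.givesTwoDesign_of_neg hτ hα hq hq1 hqP hsmall (η := η)
  have Gzero := fun {A i lam : ℚ} =>
    h.givesTwoDesign_of_zero hτ hα hq hq1 hqP hsmall (A := A) (i := i) (lam := lam)
  have hmax := fun {η : ℤ} => doubleTable_max hp hp2 hW (η := η)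
  have hneg := fun {η : ℤ} => doubleTable_neg hp hp2 hW (η := η)
  have hzero := doubleTable_zero hp hW
  have r8 : 0 < D ^ 4 - 1 := by
    have : D ^ 4 - 1 = (D ^ 2 - 1) * (D ^ 2 + 1) := by ring
    rw [this]; exact mul_pos r7 (by positivity)
  clear hW hsmall hqP hq1 hq
  simp only [doublePairs, List.forall_mem_cons,
    List.not_mem_nil, IsEmpty.forall_iff, implies_true, and_true]
  refine ⟨?_, ?_, ?_, ?_, ?_, ?_, ?_⟩
  · refine Gmax (Or.inr rfl) (f := s - 1) (by omega) (by omega)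
      (A := (D ^ 3 * P ^ 2 - D * P ^ 2 - P ^ 2 + D ^ 3 * P - D ^ 2 * P + D ^ 3) * (P - 1) /
        ((D + 1) * (D ^ 2 - 1)) * P ^ 2) ?_ (by positivity) ?_ ?_
    · rw [hmax (Or.inr rfl), if_neg (by omega), if_pos (by omega), if_neg (by omega), if_neg (by omega)]
      ring
    · simp (disch := first | assumption | omega) only [pow_sub₀, pow_add, pow_mul', pow_one, hP, hD]
      push_cast
      field_simp
      ring
    · simp (disch := first | assumption | omega) only [pow_sub₀, pow_add, pow_mul', pow_one, hP, hD]
      field_simp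
      ring
  · refine Gneg (Or.inr rfl) (f := s - 1) (by omega)
      (A := (D ^ 3 * P ^ 2 - D * P ^ 2 - P ^ 2 + D ^ 3 * P - D ^ 2 * P + D ^ 3) * (P - 1) /
        ((D + 1) * (D ^ 2 - 1)) * (P ^ 2 * (p - 1))) ?_ (by positivity) ?_ ?_
    · rw [hneg (Or.inr rfl), if_neg (by omega), if_pos (by omega), if_neg (by omega), if_neg (by omega)]
      ring
    · simp (disch := first | assumption | omega) only [pow_sub₀, pow_add, pow_mul', pow_one, hP, hD]
      push_cast
      field_simp
      ring
    · simp (disch := first | assumption | omega) only [pow_sub₀, pow_add, pow_mul', pow_one, hP, hD]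
      field_simp
      ring
  · refine Gmax (Or.inl rfl) (f := s - 1 + d) (by omega) (by omega)
      (A := (P ^ 2 - 1) * (D ^ 2 * P + D * P + P + D ^ 2) / (D * (D + 1) ^ 2) * (P ^ 2 / D ^ 2)) ?_ (by positivity) ?_ ?_
    · rw [hmax (Or.inl rfl), if_neg (by omega), if_neg (by omega), if_pos (by omega), if_neg (by omega)]
      ring
    · simp (disch := first | assumption | omega) only [pow_sub₀, pow_add, pow_mul', pow_one, hP, hD]
      push_cast
      field_simp
    · simp (disch := first | assumption | omega) only [pow_sub₀, pow_add, pow_mul', pow_one, hP, hD]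
      field_simp
  · refine Gneg (Or.inl rfl) (f := s - 1 + d) (by omega)
      (A := (P ^ 2 - 1) * (D ^ 2 * P + D * P + P + D ^ 2) / (D * (D + 1) ^ 2) * (P ^ 2 / D ^ 2 * (p - 1))) ?_ (by positivity) ?_ ?_
    · rw [hneg (Or.inl rfl), if_neg (by omega), if_neg (by omega), if_pos (by omega), if_neg (by omega)]
      ring
    · simp (disch := first | assumption | omega) only [pow_sub₀, pow_add, pow_mul', pow_one, hP, hD]
      push_cast
      field_simp
    · simp (disch := first | assumption | omega) only [pow_sub₀, pow_add, pow_mul', pow_one, hP, hD]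
      field_simp
  · refine Gmax (Or.inr rfl) (f := s - 1 + 2 * d) (by omega) (by omega)
      (A := (P ^ 2 - 1) * (P - D) / (D * (D + 1) * (D ^ 2 - 1)) * (P ^ 2 / D ^ 4)) ?_ (by positivity) ?_ ?_
    · rw [hmax (Or.inr rfl), if_neg (by omega), if_neg (by omega), if_neg (by omega), if_pos (by omega)]
      ring
    · simp (disch := first | assumption | omega) only [pow_sub₀, pow_add, pow_mul', pow_one, hP, hD]
      push_cast
      field_simp
      ring
    · simp (disch := first | assumption | omega) only [pow_sub₀, pow_add, pow_mul', pow_one, hP, hD]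
      field_simp
  · refine Gneg (Or.inr rfl) (f := s - 1 + 2 * d) (by omega)
      (A := (P ^ 2 - 1) * (P - D) / (D * (D + 1) * (D ^ 2 - 1)) * (P ^ 2 / D ^ 4 * (p - 1))) ?_ (by positivity) ?_ ?_
    · rw [hneg (Or.inr rfl), if_neg (by omega), if_neg (by omega), if_neg (by omega), if_pos (by omega)]
      ring
    · simp (disch := first | assumption | omega) only [pow_sub₀, pow_add, pow_mul', pow_one, hP, hD]
      push_cast
      field_simp
      ring
    · simp (disch := first | assumption | omega) only [pow_sub₀, pow_add, pow_mul', pow_one, hP, hD]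
      field_simp
  · refine Gzero (A := (P ^ 2 - 1) * p + (P ^ 2 - 1) * (D ^ 2 * P + D * P + P + D ^ 2) / (D * (D + 1) ^ 2) *
      (P ^ 2 * (D ^ 2 - 1) / D ^ 2 * p) + (P ^ 2 - 1) * (P - D) / (D * (D + 1) * (D ^ 2 - 1)) *
      (P ^ 2 * (D ^ 4 - 1) / D ^ 4 * p)) ?_ (by positivity) ?_ ?_
    · rw [hzero]
      field_simp
      ring
    · simp (disch := first | assumption | omega) only [pow_sub₀, pow_mul', pow_one, hP]
      field_simp
    · simp (disch := first | assumption | omega) only [pow_sub₀, pow_add, pow_mul', pow_one, hP, hD]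
      field_simp
      ring

end CaseTwo

end KasamiSetting

end DesignParameters

/-! ### The Frobenius automorphisms -/

section Frobenius

variable {p s l d : ℕ} [hpf : Fact p.Prime] {K : Type*} [Field K] [Algebra (ZMod p) K]
  [Fintype K] [DecidableEq K] {α : K}

theorem card_filter_pow_eq_one {N : ℕ} (hN : 0 < N) (hα : IsPrimitiveRoot α N) {k : ℕ}
    (hk : k ∣ N) : (Finset.univ.filter fun x : K => x ^ k = 1).card = k := by
  obtain ⟨a, rfl⟩ := hk
  have hk0 : 0 < k := Nat.pos_of_mul_pos_right hN
  have h1 : IsPrimitiveRoot (α ^ a) k := hα.pow hN (mul_comm k a)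
  have h2 : (Finset.univ.filter fun x : K => x ^ k = 1) = nthRootsFinset k 1 := by
    ext x
    simp [mem_nthRootsFinset hk0]
  rw [h2, h1.card_nthRootsFinset]

/-- The solutions are 0 and the (p^g - 1)-th roots of unity, all of which lie in K because g divides
2s. -/
theorem card_filter_pow_prime_pow_eq (hs : 0 < s) (hα : IsPrimitiveRoot α (p ^ (2 * s) - 1)) {g : ℕ}
    (hg0 : 0 < g) (hg : g ∣ 2 * s) :
    (Finset.univ.filter fun x : K => x ^ p ^ g = x).card = p ^ g := by
  have hp := hpf.out
  have hN : 0 < p ^ (2 * s) - 1 := Nat.sub_pos_of_lt (Nat.one_lt_pow (by omega) hp.one_lt)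
  have h1 : 1 < p ^ g := Nat.one_lt_pow hg0.ne' hp.one_lt
  have h2 : (Finset.univ.filter fun x : K => x ^ p ^ g = x) =
      insert 0 (Finset.univ.filter fun x : K => x ^ (p ^ g - 1) = 1) := by
    ext x
    simp only [Finset.mem_filter, Finset.mem_univ, true_and, Finset.mem_insert]
    by_cases hx : x = 0
    · simp [hx, hp.ne_zero]
    · have : x ^ p ^ g = x ^ (p ^ g - 1) * x := by rw [← pow_succ]; congr 1; omega
      rw [this]
      simp [hx]
  rw [h2, Finset.card_insert_of_notMem, card_filter_pow_eq_one hN hα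
    (Nat.pow_sub_one_dvd_pow_sub_one p hg)]
  · omega
  · simp [zero_pow (by omega : p ^ g - 1 ≠ 0)]

theorem pow_prime_pow_gcd [CharP K p] {x : K} {a b : ℕ} (ha : x ^ p ^ a = x) (hb : x ^ p ^ b = x) :
    x ^ p ^ Nat.gcd a b = x := by
  have key : ∀ n, Function.IsPeriodicPt (frobenius K p) n x ↔ x ^ p ^ n = x := by
    intro n
    rw [Function.IsPeriodicPt, Function.IsFixedPt, iterate_frobenius]
  exact (key _).mp (((key a).mpr ha).gcd ((key b).mpr hb))

theorem pow_prime_pow_of_dvd {x : K} {a b : ℕ} (hab : a ∣ b) (ha : x ^ p ^ a = x) :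
    x ^ p ^ b = x := by
  obtain ⟨c, rfl⟩ := hab
  induction c with
  | zero => simp
  | succ c ih => rw [mul_add, mul_one, pow_add, pow_mul, ih, ha]

variable (hK : Fintype.card K = p ^ (2 * s))
include hK

theorem pow_prime_pow_two_mul (x : K) : x ^ p ^ (2 * s) = x := by
  rw [← hK, FiniteField.pow_card]

theorem pow_eq_iff_pow_gcd_eq [CharP K p] (x : K) (n : ℕ) :
    x ^ p ^ n = x ↔ x ^ p ^ Nat.gcd n (2 * s) = x :=
  ⟨fun h => pow_prime_pow_gcd h (pow_prime_pow_two_mul hK x),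
    pow_prime_pow_of_dvd (Nat.gcd_dvd_left _ _)⟩

variable [CharP K p] (hp2 : p ≠ 2) (hs : 0 < s) (hα : IsPrimitiveRoot α (p ^ (2 * s) - 1))
include hs hα

theorem card_fixed_iterateFrobenius {n : ℕ} (hn : 0 < n) :
    (Finset.univ.filter fun x : K => iterateFrobeniusEquiv K p n x = x).card =
      p ^ Nat.gcd n (2 * s) := by
  simp only [iterateFrobeniusEquiv_def, pow_eq_iff_pow_gcd_eq hK _ n]
  exact card_filter_pow_prime_pow_eq hs hα (Nat.gcd_pos_of_pos_left _ hn) (Nat.gcd_dvd_right _ _)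

include hp2

theorem kasamiSetting_iterateFrobenius (l : ℕ) : KasamiSetting p s
    (iterateFrobeniusEquiv K p (s + l)) (iterateFrobeniusEquiv K p s) where
  ne_two := hp2
  pos := hs
  invol x := by
    rw [iterateFrobeniusEquiv_def, iterateFrobeniusEquiv_def, ← pow_mul, ← pow_add, ← two_mul,
      pow_prime_pow_two_mul hK]
  comm x := by
    simp only [iterateFrobeniusEquiv_def, ← pow_mul]
    rw [mul_comm]
  apply_eq x := rfl
  card_eq := by rw [hK, ← pow_mul, mul_comm]
  card_fixed := by
    rw [card_fixed_iterateFrobenius hK hs hα hs, Nat.gcd_mul_left_right]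

omit hp2 hs hα in
theorem iterateFrobenius_iterateFrobenius (l : ℕ) (x : K) :
    iterateFrobeniusEquiv K p (s + l) (iterateFrobeniusEquiv K p s x) = x ^ p ^ l := by
  rw [iterateFrobeniusEquiv_def, iterateFrobeniusEquiv_def, ← pow_mul, ← pow_add,
    show s + (s + l) = 2 * s + l by ring, pow_add, pow_mul, pow_prime_pow_two_mul hK]

omit hK hs hα [DecidableEq K] [Fintype K] [Algebra (ZMod p) K] [CharP K p] in
theorem odd_prime : Odd p := hpf.out.odd_of_ne_two hp2

/-- The solutions of `x ^ q = -x`. -/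
theorem card_filter_pow_eq_neg {g : ℕ} (hg0 : 0 < g) (hg : 2 * g ∣ 2 * s) :
    (Finset.univ.filter fun x : K => x ^ p ^ g = -x).card = p ^ g := by
  have hp := hpf.out
  have hN : 0 < p ^ (2 * s) - 1 := Nat.sub_pos_of_lt (Nat.one_lt_pow (by omega) hp.one_lt)
  have h1 : 1 < p ^ g := Nat.one_lt_pow hg0.ne' hp.one_lt
  have hodd : Odd (p ^ g) := (odd_prime hp2).pow
  have hchar : (2 : K) ≠ 0 :=
    (kasamiSetting_iterateFrobenius hK hp2 hs hα 0).two_ne_zero'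
  have hd1 : p ^ (2 * g) - 1 ∣ p ^ (2 * s) - 1 := Nat.pow_sub_one_dvd_pow_sub_one p hg
  have hd2 : (p ^ g - 1) * (p ^ g + 1) = p ^ (2 * g) - 1 := by
    rw [mul_comm 2 g, pow_mul, mul_comm, ← Nat.sq_sub_sq, one_pow]
  -- Since p^g + 1 is even. The nonzero solutions are the 2(p^g - 1)-th roots of unity that are not
  -- (p^g - 1)-th roots.
  have hd3 : 2 * (p ^ g - 1) ∣ p ^ (2 * s) - 1 := by
    refine dvd_trans ?_ hd1
    rw [← hd2, mul_comm]
    exact mul_dvd_mul_left _ (by obtain ⟨t, ht⟩ := hodd; omega)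
  have hd4 : p ^ g - 1 ∣ p ^ (2 * s) - 1 := dvd_trans (dvd_mul_left _ _) hd3
  have hset : (Finset.univ.filter fun x : K => x ^ p ^ g = -x) = insert 0
      ((Finset.univ.filter fun x : K => x ^ (2 * (p ^ g - 1)) = 1) \
        Finset.univ.filter fun x : K => x ^ (p ^ g - 1) = 1) := by
    ext x
    simp only [Finset.mem_filter, Finset.mem_univ, true_and, Finset.mem_insert, Finset.mem_sdiff]
    by_cases hx : x = 0
    · simp [hx, hp.ne_zero]
    · have e : x ^ p ^ g = x ^ (p ^ g - 1) * x := by rw [← pow_succ]; congr 1; omega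
      have e' : x ^ p ^ g = -x ↔ x ^ (p ^ g - 1) = -1 := by
        rw [e, ← neg_one_mul, mul_left_inj' hx]
      rw [e', mul_comm 2, pow_mul, sq_eq_one_iff]
      simp only [hx, false_or]
      constructor
      · intro h
        refine ⟨Or.inr h, fun h' => hchar ?_⟩
        rw [h] at h'
        linear_combination -h'
      · rintro ⟨h | h, h'⟩
        · exact absurd h h'
        · exact h
  rw [hset, Finset.card_insert_of_notMem, Finset.card_sdiff_of_subset,
    card_filter_pow_eq_one hN hα hd3, card_filter_pow_eq_one hN hα hd4]
  · omega
  · intro x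
    simp only [Finset.mem_filter, Finset.mem_univ, true_and]
    intro hx
    rw [mul_comm, pow_mul, hx, one_pow]
  · simp [zero_pow (by omega : 2 * (p ^ g - 1) ≠ 0)]

end Frobenius

/-! ### The two cases -/

section Gcd

/-- Modulo s + l one has 2l ≡ -2s. The right side is the exponent of the order of the fixed field of
`τ`. -/
theorem gcd_add_two_mul (s l : ℕ) : Nat.gcd (s + l) (2 * l) = Nat.gcd (s + l) (2 * s) := by
  apply Nat.dvd_antisymm <;> refine Nat.dvd_gcd (Nat.gcd_dvd_left _ _) ?_
  · have h1 := Nat.gcd_dvd_left (s + l) (2 * l)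
    have h2 := Nat.gcd_dvd_right (s + l) (2 * l)
    have := Nat.dvd_sub (h1.mul_left 2) h2
    rwa [show 2 * (s + l) - 2 * l = 2 * s by omega] at this
  · have h1 := Nat.gcd_dvd_left (s + l) (2 * s)
    have h2 := Nat.gcd_dvd_right (s + l) (2 * s)
    have := Nat.dvd_sub (h1.mul_left 2) h2
    rwa [show 2 * (s + l) - 2 * s = 2 * l by omega] at this

variable {s l : ℕ} (hl : 1 ≤ l) (hls : l ≠ s)
include hl

theorem gcd_eq_or : Nat.gcd (s + l) (2 * l) = Nat.gcd s l ∨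
    Nat.gcd (s + l) (2 * l) = 2 * Nat.gcd s l := by
  obtain ⟨t, ht⟩ : Nat.gcd s l ∣ Nat.gcd (s + l) (2 * l) :=
    Nat.dvd_gcd (dvd_add (Nat.gcd_dvd_left _ _) (Nat.gcd_dvd_right _ _))
      ((Nat.gcd_dvd_right _ _).mul_left 2)
  have h2 : Nat.gcd (s + l) (2 * l) ∣ 2 * Nat.gcd s l := by
    rw [← Nat.gcd_mul_left]
    refine Nat.dvd_gcd ?_ (Nat.gcd_dvd_right _ _)
    rw [gcd_add_two_mul]
    exact Nat.gcd_dvd_right _ _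
  have hg : 0 < Nat.gcd s l := Nat.gcd_pos_of_pos_right _ hl
  rw [ht, mul_comm 2, Nat.mul_dvd_mul_iff_left hg, Nat.dvd_prime Nat.prime_two] at h2
  rw [ht]
  rcases h2 with rfl | rfl
  · left; rw [mul_one]
  · right; rw [mul_comm]

include hls

/-- Otherwise s divides l, which is impossible for 0 < l < 2s and l ≠ s. -/
theorem two_mul_gcd_le (hs : 0 < s) (hlm : l ≤ 2 * s - 1) : 2 * Nat.gcd s l ≤ s := by
  obtain ⟨a, ha⟩ := Nat.gcd_dvd_left s l
  obtain ⟨b, hb⟩ := Nat.gcd_dvd_right s l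
  set g := Nat.gcd s l
  rcases Nat.lt_or_ge a 2 with h | h
  · exfalso
    have : a = 1 := by
      rcases Nat.eq_zero_or_pos a with rfl | h'
      · omega
      · omega
    subst this
    have hb2 : b < 2 := by
      by_contra! hb2
      have := Nat.mul_le_mul_left g hb2
      omega
    interval_cases b <;> omega
  · have := Nat.mul_le_mul_left g h
    omega

omit hls in
-- The coprime quotients of s and l by their gcd have even sum, so neither is even.
theorem exists_odd_of_gcd_eq_two_mul (h2 : Nat.gcd (s + l) (2 * l) = 2 * Nat.gcd s l) :
    ∃ a b, Odd a ∧ Odd b ∧ s = Nat.gcd s l * a ∧ l = Nat.gcd s l * b := by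
  have hg : 0 < Nat.gcd s l := Nat.gcd_pos_of_pos_right _ hl
  obtain ⟨a, b, hco, ha, hb⟩ := Nat.exists_coprime s l
  rw [mul_comm] at ha hb
  refine ⟨a, b, ?_, ?_, ha, hb⟩
  all_goals
    have h3 : 2 * Nat.gcd s l ∣ s + l := h2 ▸ Nat.gcd_dvd_left _ _
    rw [show s + l = Nat.gcd s l * (a + b) by rw [mul_add, ← ha, ← hb], mul_comm 2,
      Nat.mul_dvd_mul_iff_left hg] at h3
    by_contra ho
    rw [Nat.not_odd_iff_even] at ho
    have h4 := ho.two_dvd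
  · have h5 : 2 ∣ b := (Nat.dvd_add_right h4).mp h3
    have := Nat.dvd_gcd h4 h5
    rw [hco] at this
    omega
  · have h5 : 2 ∣ a := (Nat.dvd_add_left h4).mp h3
    have := Nat.dvd_gcd h5 h4
    rw [hco] at this
    omega

end Gcd

theorem mainTheorem3 (p m s l d d' : ℕ) [Fact p.Prime] (hp : p ≠ 2) (hms : m = 2 * s)
    (hm : 4 ≤ m) (hl : 1 ≤ l) (hlm : l ≤ m - 1) (hls : l ≠ s)
    (hd' : d' = Nat.gcd (s + l) (2 * l)) (hd : d = Nat.gcd s l)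
    {K : Type*} [Field K] [Algebra (ZMod p) K] (hK : Nat.card K = p ^ m)
    (α : K) (hα : IsPrimitiveRoot α (p ^ m - 1)) :
    (kasamiDualExtDual p s l α : Set (Fin (p ^ (2 * s) - 1 + 1) → ZMod p)) =
        traceWords p s l (coordLabel α) ∧
      (d' = d → Odd d →
        ∀ x ∈ oddPairs p m s d, GivesTwoDesign (kasamiDualExtDual p s l α) (p ^ m) x) ∧
      (d' = d → Even d →
        ∀ x ∈ evenPairs p m s d, GivesTwoDesign (kasamiDualExtDual p s l α) (p ^ m) x) ∧
      (d' = 2 * d →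
        ∀ x ∈ doublePairs p m s d, GivesTwoDesign (kasamiDualExtDual p s l α) (p ^ m) x) := by
  classical
  subst hms
  have hpp := (Fact.out : p.Prime)
  have hs : 0 < s := by omega
  have : Finite K := Nat.finite_of_card_ne_zero (by rw [hK]; exact pow_ne_zero _ hpp.ne_zero)
  have := Fintype.ofFinite K
  have : CharP K p := charP_of_injective_algebraMap (algebraMap (ZMod p) K).injective p
  rw [Nat.card_eq_fintype_card] at hK
  set κ := iterateFrobeniusEquiv K p s with hκ
  set τ := iterateFrobeniusEquiv K p (s + l) with hτ
  have h : KasamiSetting p s τ κ := kasamiSetting_iterateFrobenius hK hp hs hα l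
  have hτκ : ∀ x, τ (κ x) = x ^ p ^ l := iterateFrobenius_iterateFrobenius hK l
  have hq : (Finset.univ.filter fun x => τ x = x).card = p ^ d' := by
    rw [hd', gcd_add_two_mul]
    exact card_fixed_iterateFrobenius hK hs hα (by omega)
  have hd0 : 0 < d := by rw [hd]; exact Nat.gcd_pos_of_pos_right _ hl
  have hds : 2 * d ≤ s := hd ▸ two_mul_gcd_le hl hls hs hlm
  have hdd : d' = d ∨ d' = 2 * d := by rw [hd, hd']; exact gcd_eq_or hl
  have hdouble : d' = 2 * d → 3 * d ≤ s ∧ ∃ a b, Odd a ∧ Odd b ∧ s = d * a ∧ l = d * b := by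
    intro h2
    rw [hd', hd] at h2
    obtain ⟨a, b, ha, hb, hsa, hlb⟩ := exists_odd_of_gcd_eq_two_mul hl h2
    rw [← hd] at hsa hlb
    refine ⟨?_, a, b, ha, hb, hsa, hlb⟩
    -- The quotient s/d is odd, and it is not 1 because 2d ≤ s.
    have h3 : 3 ≤ a := by
      obtain ⟨t, rfl⟩ := ha
      rcases Nat.eq_zero_or_pos t with rfl | ht
      · omega
      · omega
    have := Nat.mul_le_mul_left d h3
    omega
  have hd's : d' < s := by
    rcases hdd with h1 | h1
    · omega
    · have := (hdouble h1).1
      omega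
  have hq1 : 1 < p ^ d' := Nat.one_lt_pow (by omega) hpp.one_lt
  have hqP : (p ^ d') ^ 2 < (p ^ s) ^ 2 :=
    Nat.pow_lt_pow_left (Nat.pow_lt_pow_right hpp.one_lt hd's) two_ne_zero
  -- The fixed field of `τ` has order p^d here, and d divides s, so `κ` fixes it pointwise. This
  -- inclusion distinguishes the first two cases from the third.
  have hk : d' = d → ∃ k : IntermediateField (ZMod p) K, (∀ x, τ x = x ↔ x ∈ k) ∧
      (∀ x ∈ k, κ x = x) ∧ Nat.card k = p ^ d := by
    intro h1
    let k : IntermediateField (ZMod p) K := Subfield.toIntermediateField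
      (RingHom.eqLocusField (τ : K →+* K) (RingHom.id K)) (ringEquiv_algebraMap_zmod τ)
    have hk : ∀ x, τ x = x ↔ x ∈ k := fun x => Iff.rfl
    refine ⟨k, hk, fun x hx => ?_, ?_⟩
    · rw [← hk, hτ, iterateFrobeniusEquiv_def, pow_eq_iff_pow_gcd_eq hK, ← gcd_add_two_mul, ← hd',
        h1] at hx
      rw [h.apply_eq]
      exact pow_prime_pow_of_dvd (hd ▸ Nat.gcd_dvd_left s l) hx
    · rw [← h1, ← hq, Nat.card_eq_fintype_card, Fintype.card_subtype]
      simp only [hk]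
  refine ⟨?_, ?_, ?_, ?_⟩
  · ext w
    rw [SetLike.mem_coe, h.mem_kasamiDualExtDual_iff hτκ hq hq1 hqP hα, h.mem_traceWords_iff hτκ]
  · intro h1 hodd
    obtain ⟨k, hfix, hκk, hkd⟩ := hk h1
    have := Fintype.ofFinite k
    rw [Nat.card_eq_fintype_card] at hkd
    exact h.givesTwoDesign_of_odd hτκ hα hd0 hds (k := k)
      (fun x => (hfix x).trans ⟨fun hx => ⟨⟨x, hx⟩, rfl⟩, by rintro ⟨r, rfl⟩; exact r.2⟩)
      (fun r => hκk r r.2) hkd hodd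
  · rintro h1 ⟨j, hj⟩
    obtain ⟨k, hfix, hκk, hkd⟩ := hk h1
    have := Fintype.ofFinite k
    rw [Nat.card_eq_fintype_card] at hkd
    exact h.givesTwoDesign_of_even hτκ hα hd0 hds (k := k)
      (fun x => (hfix x).trans ⟨fun hx => ⟨⟨x, hx⟩, rfl⟩, by rintro ⟨r, rfl⟩; exact r.2⟩)
      (fun r => hκk r r.2) hkd (by omega : d = 2 * j)
  · intro hdd2
    obtain ⟨hds3, a, b, ha, hb, hsa, hlb⟩ := hdouble hdd2
    -- Applied with c = s/d and c = l/d, both odd: the (p^d + 1)-th roots of unity u then satisfy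
    -- uκ(u) = 1 and uτκ(u) = 1.
    have hdvd : ∀ {c : ℕ}, Odd c → p ^ d + 1 ∣ p ^ (d * c) + 1 := fun hc => by
      have := hc.nat_add_dvd_pow_add_pow (p ^ d) 1
      rwa [one_pow, ← pow_mul] at this
    have hU : ∀ {c : ℕ}, Odd c → ∀ u : K, u ^ (p ^ d + 1) = 1 → u * u ^ p ^ (d * c) = 1 := by
      intro c hc u hu
      obtain ⟨t, ht⟩ := hdvd hc
      rw [← pow_succ', ht, pow_mul, hu, one_pow]
    have hd2s : 2 * d ∣ 2 * s := mul_dvd_mul_left 2 ⟨a, hsa⟩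
    refine h.givesTwoDesign_of_double hτκ hα hd0 hds3 (by rw [hq, hdd2, ← pow_mul, mul_comm])
      ?_ ?_ (fun u hu => ?_) (fun u hu => ?_) ?_
    · rw [← card_filter_pow_eq_neg hK hp hs hα hd0 hd2s]
      congr 1
      ext x
      simp only [Finset.mem_filter, Finset.mem_univ, true_and]
      -- As s is an odd multiple of d, `κ` acts on the field of order p^(2d) as y ↦ y^(p^d). The
      -- `τ`-fixed elements negated by `κ` are thus the solutions of x^(p^d) = -x.
      have hx2 : ∀ y : K, y ^ p ^ (2 * d) = y → κ y = y ^ p ^ d := by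
        intro y hy
        obtain ⟨t, rfl⟩ := ha
        rw [h.apply_eq, hsa, show d * (2 * t + 1) = 2 * d * t + d by ring, pow_add, pow_mul,
          pow_prime_pow_of_dvd (dvd_mul_right _ _) hy]
      have hτx : τ x = x ↔ x ^ p ^ (2 * d) = x := by
        rw [hτ, iterateFrobeniusEquiv_def, pow_eq_iff_pow_gcd_eq hK, ← gcd_add_two_mul, ← hd', hdd2]
      rw [hτx]
      constructor
      · rintro ⟨h1, h2⟩
        rw [← hx2 x h1, h2]
      · intro h1
        have h2 : x ^ p ^ (2 * d) = x := by
          rw [two_mul, pow_add, pow_mul, h1, neg_pow, h1, (odd_prime hp).pow.neg_one_pow]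
          ring
        exact ⟨h2, by rw [hx2 x h2, h1]⟩
    · refine card_filter_pow_eq_one (Nat.sub_pos_of_lt (Nat.one_lt_pow (by omega) hpp.one_lt)) hα ?_
      refine dvd_trans ?_ (Nat.pow_sub_one_dvd_pow_sub_one p hd2s)
      refine ⟨p ^ d - 1, ?_⟩
      rw [mul_comm 2 d, pow_mul, ← Nat.sq_sub_sq, one_pow]
    · rw [h.apply_eq, hsa]
      exact hU ha u hu
    · rw [hτκ, hlb]
      exact hU hb u hu
    · rw [hsa]
      exact_mod_cast hdvd ha
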